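/- Let $w_1,\dots,w_n$ be positive integers, $w_0=1$, $\mu=1+w_1+\cdots+w_n$, and let $S_w$ be the disjoint union of the sets $\{\ell\mu/w_i \mid 0\le \ell<w_i\}$, $i=0,\dots,n$, numbered increasingly as $s_0\le s_1\le\cdots\le s_{\mu-1}$. Put $\alpha_k=k-s_k$. Let $U=(\mathbb C^*)^n$ and $$F(u,x)=u_1+\cdots+u_n+\frac{x}{u_1^{w_1}\cdots u_n^{w_n}}.$$ Let $K=\mathbb C\{x\}[x^{-1}]$ and let $$G=\frac{\Omega^n(U)\otimes K[\tau,\tau^{-1}]}{(d_u-\tau\, d_uF)\wedge\big(\Omega^{n-1}(U)\otimes K[\tau,\tau^{-1}]\big)}$$ be the germ at $x=0$ of the (Fourier–Laplace transformed) Gauss–Manin system of $F$, with the connection $\nabla_{\partial_\tau}=\partial_\tau-F$, $\nabla_{\partial_x}=\partial_x-\tau\,\partial F/\partial x$; write $\theta=\tau^{-1}$. Let $\omega_0^\varphi$ be the class of $\frac{du_1}{u_1}\wedge\cdots\wedge\frac{du_n}{u_n}$ and define $\omega_1^\varphi,\dots,\omega_{\mu-1}^\varphi\in G$ by $$\tau\,\omega_{k+1}^\varphi=-\tfrac1\mu\,(\tau\nabla_{\partial_\tau}+\alpha_k)\,\omega_k^\varphi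 .$$ Put $v(\omega_k^\varphi)=s_k/\mu\in[0,1)$. For $0\le\alpha<1$ let $$V^\alpha G=\sum_{\alpha\le v(\omega_k^\varphi)}\mathbb C\{x\}[\theta,\theta^{-1}]\,\omega_k^\varphi+x\sum_{\alpha>v(\omega_k^\varphi)}\mathbb C\{x\}[\theta,\theta^{-1}]\,\omega_k^\varphi ,$$ $$V^{>\alpha} G=\sum_{\alpha< v(\omega_k^\varphi)}\mathbb C\{x\}[\theta,\theta^{-1}]\,\omega_k^\varphi+x\sum_{\alpha\ge v(\omega_k^\varphi)}\mathbb C\{x\}[\theta,\theta^{-1}]\,\omega_k^\varphi ,$$ and $V^{\alpha+p}G=x^pV^\alpha G$, $V^{>\alpha+p}G=x^pV^{>\alpha}G$ for $p\in\mathbb Z$. Let $H^\alpha=V^\alpha G/V^{>\alpha}G$ and $H=\bigoplus_{\alpha\in[0,1)}H^\alpha$. Then: 1. For every $\alpha\in\mathbb R$, $V^{>\alpha}G=\bigcup_{\beta>\alpha}V^\beta G$, the operator $x\nabla_{\partial_x}$ preserves $V^\alpha G$ and $V^{>\alpha}G$, and $x\nabla_{\partial_x}-\alpha$ is nilpotent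 on $H^\alpha$. 2. The endomorphism $N$ of $H$ which restricts to $x\nabla_{\partial_x}-\alpha$ on $H^\alpha$ ($0\le\alpha<1$) is $\mathbb C[\theta,\theta^{-1}]$-linear and nilpotent, and its Jordan blocks are in one-to-one correspondence with the maximal constant runs of the sequence $(s_0,\dots,s_{\mu-1})$, with the same sizes: $H$ has a $\mathbb C[\theta,\theta^{-1}]$-basis $b_{r,j}$, where $r$ runs over the maximal constant runs and $0\le j<\mathrm{length}(r)$, with $N b_{r,j}=b_{r,j+1}$ if $j+1<\mathrm{length}(r)$ and $Nb_{r,j}=0$ otherwise. 3. $(V^\alpha G)_{\alpha\in\mathbb R}$ is the Kashiwara–Malgrange filtration of $G$ along $x=0$: with $O=\mathbb C\{x\}[\theta,\theta^{-1}]$, it is the unique family of $O$-submodules $(V^\alpha)_{\alpha\in\mathbb R}$ of $G$ that is decreasing, exhaustive and left continuous with jumps contained in $S+\mathbb Z$ for some finite $S\subset\mathbb R$, and that satisfies: $xV^\alpha\subseteq V^{\alpha+1}$, with equality for $\alpha\gg0$; $\nabla_{\partial_x}V^\alpha\subseteq V^{\alpha-1}$, with $V^{\alpha-1}=V^\alpha+\nabla_{\partial_x}V^\alpha$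 for $\alpha\ll0$; $\nabla_{\partial_\tau}V^\alpha\subseteq V^\alpha$; every $V^\alpha$ is finitely generated over $O\langle\nabla_{\partial_\tau},x\nabla_{\partial_x}\rangle$; and $x\nabla_{\partial_x}-\alpha$ is nilpotent on $V^\alpha/\bigcup_{\beta>\alpha}V^\beta$ for every $\alpha$. -/

import Mathlib

open scoped LaurentPolynomial LaurentSeries DirectSum

noncomputable section

namespace GaussManin

/-! ### Derivations of (Laurent) polynomial rings, realised as additive monoid algebras -/

section Derivations

open AddMonoidAlgebra

variable {k S M : Type*} [CommRing k] [CommRing S] [Algebra k S] [AddCommMonoid M]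

/-- The derivation of `S[M]` that applies a derivation `δ` of `S` to every coefficient. -/
def coeffDerivation (δ : Derivation k S S) :
    Derivation k (AddMonoidAlgebra S M) (AddMonoidAlgebra S M) :=
  Derivation.mk'
    ((coeffLinearEquiv (S := S) (M := M) k).symm.toLinearMap ∘ₗ
      Finsupp.mapRange.linearMap (δ : S →ₗ[k] S) ∘ₗ
      (coeffLinearEquiv (S := S) (M := M) k).toLinearMap)
    (by
      have key : ∀ (m : M) (s : S), ((coeffLinearEquiv (S := S) (M := M) k).symm.toLinearMap ∘ₗ
          Finsupp.mapRange.linearMap (δ : S →ₗ[k] S) ∘ₗ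
          (coeffLinearEquiv (S := S) (M := M) k).toLinearMap) (single m s) = single m (δ s) := by
        intro m s
        ext
        simp [coeffLinearEquiv]
      intro a b
      induction a using AddMonoidAlgebra.induction_linear with
      | zero => simp only [zero_mul, map_zero, smul_zero, zero_smul, add_zero]
      | add f g hf hg =>
        rw [add_mul, map_add, hf, hg, map_add, add_smul, smul_add]; abel
      | single m s =>
        induction b using AddMonoidAlgebra.induction_linear with
        | zero => simp only [mul_zero, map_zero, smul_zero, zero_smul, add_zero]
        | add f g hf hg =>
          rw [mul_add, map_add, hf, hg, map_add, add_smul, smul_add]; abel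
        | single m' s' =>
          rw [single_mul_single, key, key, key, smul_eq_mul, smul_eq_mul, single_mul_single,
            single_mul_single, δ.leibniz, add_comm m' m, ← single_add, smul_eq_mul, smul_eq_mul])

theorem coeffDerivation_single (δ : Derivation k S S) (m : M) (s : S) :
    coeffDerivation δ (single m s) = single m (δ s) := by
  ext
  simp [coeffDerivation, coeffLinearEquiv]

/-- For an additive map `φ : M → S`, the `S`-linear derivation of `S[M]` that multiplies the
monomial of exponent `m` by `φ m`. -/
def weightDerivation (φ : M →+ S) :
    Derivation S (AddMonoidAlgebra S M) (AddMonoidAlgebra S M) :=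
  Derivation.mk'
    ((coeffLinearEquiv (S := S) (M := M) S).symm.toLinearMap ∘ₗ
      Finsupp.lsum S (fun m => φ m • Finsupp.lsingle m) ∘ₗ
      (coeffLinearEquiv (S := S) (M := M) S).toLinearMap)
    (by
      have key : ∀ (m : M) (s : S), ((coeffLinearEquiv (S := S) (M := M) S).symm.toLinearMap ∘ₗ
          Finsupp.lsum S (fun m => φ m • Finsupp.lsingle m) ∘ₗ
          (coeffLinearEquiv (S := S) (M := M) S).toLinearMap) (single m s)
            = single m (φ m * s) := by
        intro m s
        ext
        simp [coeffLinearEquiv]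
      intro a b
      induction a using AddMonoidAlgebra.induction_linear with
      | zero => simp only [zero_mul, map_zero, smul_zero, zero_smul, add_zero]
      | add f g hf hg =>
        rw [add_mul, map_add, hf, hg, map_add, add_smul, smul_add]; abel
      | single m s =>
        induction b using AddMonoidAlgebra.induction_linear with
        | zero => simp only [mul_zero, map_zero, smul_zero, zero_smul, add_zero]
        | add f g hf hg =>
          rw [mul_add, map_add, hf, hg, map_add, add_smul, smul_add]; abel
        | single m' s' =>
          rw [single_mul_single, key, key, key, smul_eq_mul, smul_eq_mul, single_mul_single,
            single_mul_single, add_comm m' m, ← single_add, map_add]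
          congr 1
          ring)

theorem weightDerivation_single (φ : M →+ S) (m : M) (s : S) :
    weightDerivation φ (single m s) = single m (φ m * s) := by
  ext
  simp [weightDerivation, coeffLinearEquiv]

theorem coeffDerivation_comm_weightDerivation (δ : Derivation k S S) (φ : M →+ S)
    (hφ : ∀ m, δ (φ m) = 0) (b : AddMonoidAlgebra S M) :
    coeffDerivation δ (weightDerivation φ b) = weightDerivation φ (coeffDerivation δ b) := by
  induction b using AddMonoidAlgebra.induction_linear with
  | zero => simp
  | add f g hf hg => simp [hf, hg]
  | single m s =>
    rw [weightDerivation_single, coeffDerivation_single, coeffDerivation_single,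
      weightDerivation_single, δ.leibniz, hφ]
    simp

end Derivations

/-! ### The Gauss–Manin system -/

section System

variable {n : ℕ} (A : Type*) [CommRing A] [Algebra ℂ A]

/-- `A[τ, τ⁻¹][u₁, u₁⁻¹, …, uₙ, uₙ⁻¹]`: regular functions on the torus `U = (ℂ^*)ⁿ` with
coefficients in `A[τ, τ⁻¹]`. The monomial `c u^a` is `AddMonoidAlgebra.single a c`. -/
abbrev TorusFun (n : ℕ) : Type _ := AddMonoidAlgebra A[T;T⁻¹] (Fin n → ℤ)

variable {A}

/-- The function `F = u₁ + ⋯ + uₙ + x / (u₁^{w₁} ⋯ uₙ^{wₙ})`. -/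
def potential (w : Fin n → ℕ) (x : A) : TorusFun A n :=
  ∑ i, AddMonoidAlgebra.single (Pi.single i 1) 1 +
    AddMonoidAlgebra.single (fun i => -(w i : ℤ)) (LaurentPolynomial.C x)

/-- The logarithmic derivation `uᵢ ∂/∂uᵢ`. -/
def logU (i : Fin n) : Derivation A[T;T⁻¹] (TorusFun A n) (TorusFun A n) :=
  weightDerivation ((Int.castAddHom A[T;T⁻¹]).comp (Pi.evalAddMonoidHom (fun _ => ℤ) i))

/-- The derivation `∂/∂τ` of `A[τ, τ⁻¹]`. -/
def derivTau : Derivation ℂ A[T;T⁻¹] A[T;T⁻¹] :=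
  (LaurentPolynomial.T (-1) : A[T;T⁻¹]) •
    (weightDerivation (Int.castAddHom A)).restrictScalars ℂ

/-- `∂/∂τ` on functions. -/
def funTau : Derivation ℂ (TorusFun A n) (TorusFun A n) := coeffDerivation derivTau

/-- `∂/∂x` on functions, where `δ` is the derivation `∂/∂x` of the coefficient ring `A`. -/
def funX (δ : Derivation ℂ A A) : Derivation ℂ (TorusFun A n) (TorusFun A n) :=
  coeffDerivation (coeffDerivation δ)

/-- The operator `(d_u - τ d_u F) ∧ : Ωⁿ⁻¹(U)[τ, τ⁻¹] → Ωⁿ(U)[τ, τ⁻¹]` (coefficients in `A`).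

With `ω₀ = du₁/u₁ ∧ ⋯ ∧ duₙ/uₙ`, an `n`-form is `h ω₀` and is represented by the function `h`.
An `(n-1)`-form is `∑ᵢ gᵢ ι_{uᵢ∂/∂uᵢ} ω₀`, that is
`∑ᵢ (-1)^{i-1} gᵢ du₁/u₁ ∧ ⋯ (omit i) ⋯ ∧ duₙ/uₙ`, and is represented by the family `g`.
Then `d_u` of it is `(∑ᵢ uᵢ∂gᵢ/∂uᵢ) ω₀` and `d_u F ∧` it is `(∑ᵢ (uᵢ∂F/∂uᵢ) gᵢ) ω₀`. -/
def twistedDiff (w : Fin n → ℕ) (x : A) : (Fin n → TorusFun A n) →ₗ[A[T;T⁻¹]] TorusFun A n where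
  toFun g := ∑ i, (logU i (g i) -
    (LaurentPolynomial.T 1 : A[T;T⁻¹]) • (logU i (potential w x) * g i))
  map_add' g h := by
    rw [← Finset.sum_add_distrib]
    refine Finset.sum_congr rfl fun i _ => ?_
    rw [Pi.add_apply, map_add, mul_add, smul_add]
    abel
  map_smul' c g := by
    rw [RingHom.id_apply, Finset.smul_sum]
    refine Finset.sum_congr rfl fun i _ => ?_
    rw [Pi.smul_apply, Derivation.map_smul, mul_smul_comm, smul_sub, smul_comm c]

/-- The (Fourier–Laplace transform of the) Gauss–Manin system of `F`, with coefficients in the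
ring `A`: `Ωⁿ(U)[τ, τ⁻¹] / (d_u - τ d_u F) ∧ Ωⁿ⁻¹(U)[τ, τ⁻¹]`, a module over `A[τ, τ⁻¹]`.
For `A = ℂ[x, x⁻¹]` this is the algebraic
Gauss–Manin system over `ℂ^*`, and for `A = ℂ{x}[x⁻¹]` its germ at `x = 0`. -/
def System (w : Fin n → ℕ) (x : A) : Type _ :=
  TorusFun A n ⧸ LinearMap.range (twistedDiff w x)

instance (w : Fin n → ℕ) (x : A) : AddCommGroup (System w x) :=
  inferInstanceAs (AddCommGroup (TorusFun A n ⧸ LinearMap.range (twistedDiff w x)))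

instance (w : Fin n → ℕ) (x : A) : Module A[T;T⁻¹] (System w x) :=
  inferInstanceAs (Module A[T;T⁻¹] (TorusFun A n ⧸ LinearMap.range (twistedDiff w x)))

instance (w : Fin n → ℕ) (x : A) : Module ℂ (System w x) :=
  inferInstanceAs (Module ℂ (TorusFun A n ⧸ LinearMap.range (twistedDiff w x)))

instance (w : Fin n → ℕ) (x : A) : IsScalarTower ℂ A[T;T⁻¹] (System w x) :=
  inferInstanceAs (IsScalarTower ℂ A[T;T⁻¹] (TorusFun A n ⧸ LinearMap.range (twistedDiff w x)))

/-- The class of the `n`-form `h ω₀`. -/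
def System.mk (w : Fin n → ℕ) (x : A) : TorusFun A n →ₗ[A[T;T⁻¹]] System w x :=
  (LinearMap.range (twistedDiff w x)).mkQ

/-- `∂/∂x - τ ∂F/∂x` on `n`-forms. -/
def preNablaX (w : Fin n → ℕ) (x : A) (δ : Derivation ℂ A A) :
    TorusFun A n →ₗ[ℂ] TorusFun A n where
  toFun h := funX δ h - (LaurentPolynomial.T 1 : A[T;T⁻¹]) • (funX δ (potential w x) * h)
  map_add' a b := by rw [map_add, mul_add, smul_add]; abel
  map_smul' c a := by
    rw [RingHom.id_apply, Derivation.map_smul, mul_smul_comm, smul_sub, smul_comm c]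

/-- `∂/∂τ - F` on `n`-forms. -/
def preNablaTau (w : Fin n → ℕ) (x : A) : TorusFun A n →ₗ[ℂ] TorusFun A n where
  toFun h := funTau h - potential w x * h
  map_add' a b := by rw [map_add, mul_add]; abel
  map_smul' c a := by
    rw [RingHom.id_apply, Derivation.map_smul, mul_smul_comm, smul_sub]

theorem funX_smul_T (δ : Derivation ℂ A A) (m : ℤ) (h : TorusFun A n) :
    funX δ ((LaurentPolynomial.T m : A[T;T⁻¹]) • h) =
      (LaurentPolynomial.T m : A[T;T⁻¹]) • funX δ h := by
  induction h using AddMonoidAlgebra.induction_linear with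
  | zero => simp
  | add f g hf hg => rw [smul_add, map_add, hf, hg, map_add, smul_add]
  | single a c =>
    rw [AddMonoidAlgebra.smul_single, funX, coeffDerivation_single, coeffDerivation_single,
      AddMonoidAlgebra.smul_single, smul_eq_mul, Derivation.leibniz, LaurentPolynomial.T,
      coeffDerivation_single, Derivation.map_one_eq_zero]
    simp

theorem derivTau_T_one : derivTau (LaurentPolynomial.T 1 : A[T;T⁻¹]) = 1 := by
  have h : weightDerivation (Int.castAddHom A) (LaurentPolynomial.T 1 : A[T;T⁻¹]) =
      LaurentPolynomial.T 1 := by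
    rw [LaurentPolynomial.T, weightDerivation_single]
    simp
  rw [derivTau, Derivation.smul_apply, Derivation.restrictScalars_apply, h, smul_eq_mul,
    ← LaurentPolynomial.T_add]
  simp

theorem funTau_smul_T (h : TorusFun A n) :
    funTau ((LaurentPolynomial.T 1 : A[T;T⁻¹]) • h) =
      (LaurentPolynomial.T 1 : A[T;T⁻¹]) • funTau h + h := by
  induction h using AddMonoidAlgebra.induction_linear with
  | zero => simp
  | add f g hf hg => rw [smul_add, map_add, hf, hg, map_add, smul_add]; abel
  | single a c =>
    rw [AddMonoidAlgebra.smul_single, funTau, coeffDerivation_single, coeffDerivation_single,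
      AddMonoidAlgebra.smul_single, smul_eq_mul, Derivation.leibniz, derivTau_T_one,
      AddMonoidAlgebra.single_add]
    simp

theorem funTau_potential (w : Fin n → ℕ) (x : A) : funTau (potential w x) = 0 := by
  have h1 : ∀ a : A, derivTau (LaurentPolynomial.C a : A[T;T⁻¹]) = 0 := by
    intro a
    have h : weightDerivation (Int.castAddHom A) (LaurentPolynomial.C a : A[T;T⁻¹]) = 0 := by
      rw [← LaurentPolynomial.single_eq_C, weightDerivation_single]
      simp
    rw [derivTau, Derivation.smul_apply, Derivation.restrictScalars_apply, h, smul_zero]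
  rw [potential, map_add, map_sum, funTau, coeffDerivation_single, h1]
  simp [coeffDerivation_single]

theorem funX_logU (δ : Derivation ℂ A A) (i : Fin n) (h : TorusFun A n) :
    funX δ (logU i h) = logU i (funX δ h) :=
  coeffDerivation_comm_weightDerivation _ _ (fun m => by simp) h

theorem funTau_logU (i : Fin n) (h : TorusFun A n) :
    funTau (logU i h) = logU i (funTau h) :=
  coeffDerivation_comm_weightDerivation _ _ (fun m => by simp) h

theorem preNablaX_mem (w : Fin n → ℕ) (x : A) (δ : Derivation ℂ A A) :
    (LinearMap.range (twistedDiff w x)).restrictScalars ℂ ≤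
      ((LinearMap.range (twistedDiff w x)).restrictScalars ℂ).comap (preNablaX w x δ) := by
  rintro _ ⟨g, rfl⟩
  refine ⟨fun i => preNablaX w x δ (g i), ?_⟩
  simp only [twistedDiff, preNablaX, LinearMap.coe_mk, AddHom.coe_mk, map_sum]
  refine Finset.sum_congr rfl fun i _ => ?_
  simp only [map_sub, funX_smul_T, Derivation.map_smul, Derivation.leibniz, smul_eq_mul, funX_logU,
    mul_sub, smul_sub, mul_smul_comm, smul_add]
  rw [mul_left_comm (logU i (potential w x)), mul_comm (g i) (logU i (funX δ (potential w x)))]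
  abel

theorem preNablaTau_mem (w : Fin n → ℕ) (x : A) :
    (LinearMap.range (twistedDiff w x)).restrictScalars ℂ ≤
      ((LinearMap.range (twistedDiff w x)).restrictScalars ℂ).comap (preNablaTau w x) := by
  rintro _ ⟨g, rfl⟩
  refine ⟨fun i => preNablaTau w x (g i), ?_⟩
  simp only [twistedDiff, preNablaTau, LinearMap.coe_mk, AddHom.coe_mk, map_sum]
  refine Finset.sum_congr rfl fun i _ => ?_
  simp only [map_sub, funTau_smul_T, Derivation.leibniz, smul_eq_mul, funTau_logU,
    funTau_potential, map_zero, mul_zero, add_zero, mul_sub, smul_sub, mul_smul_comm]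
  rw [mul_left_comm (logU i (potential w x)), mul_comm (g i) (logU i (potential w x))]
  abel

/-- A `ℂ`-linear operator on forms that preserves the relations induces one on the system. -/
def descend (w : Fin n → ℕ) (x : A) (f : TorusFun A n →ₗ[ℂ] TorusFun A n)
    (hf : (LinearMap.range (twistedDiff w x)).restrictScalars ℂ ≤
      ((LinearMap.range (twistedDiff w x)).restrictScalars ℂ).comap f) :
    System w x →ₗ[ℂ] System w x :=
  (Submodule.Quotient.restrictScalarsEquiv ℂ (LinearMap.range (twistedDiff w x))).toLinearMap ∘ₗ
    Submodule.mapQ _ _ f hf ∘ₗ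
    (Submodule.Quotient.restrictScalarsEquiv ℂ (LinearMap.range (twistedDiff w x))).symm.toLinearMap

/-- `∇_{∂/∂x}`, induced by `η τⁱ ↦ (∂η/∂x) τⁱ - (∂F/∂x) η τⁱ⁺¹`. -/
def nablaX (w : Fin n → ℕ) (x : A) (δ : Derivation ℂ A A) : System w x →ₗ[ℂ] System w x :=
  descend w x (preNablaX w x δ) (preNablaX_mem w x δ)

/-- `∇_{∂/∂τ}`, induced by `η τⁱ ↦ i η τⁱ⁻¹ - F η τⁱ`. -/
def nablaTau (w : Fin n → ℕ) (x : A) : System w x →ₗ[ℂ] System w x :=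
  descend w x (preNablaTau w x) (preNablaTau_mem w x)

theorem nablaX_mk (w : Fin n → ℕ) (x : A) (δ : Derivation ℂ A A) (h : TorusFun A n) :
    nablaX w x δ (System.mk w x h) = System.mk w x (preNablaX w x δ h) := rfl

theorem nablaTau_mk (w : Fin n → ℕ) (x : A) (h : TorusFun A n) :
    nablaTau w x (System.mk w x h) = System.mk w x (preNablaTau w x h) := rfl

end System

/-! ### Convergent power series and Laurent series -/

section Convergent

/-- A power series over `ℂ` has positive radius of convergence. -/
def IsConvergent (f : PowerSeries ℂ) : Prop :=
  ∃ C r : ℝ, 0 ≤ C ∧ 1 ≤ r ∧ ∀ k : ℕ, ‖PowerSeries.coeff k f‖ ≤ C * r ^ k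

theorem IsConvergent.add {f g : PowerSeries ℂ} (hf : IsConvergent f) (hg : IsConvergent g) :
    IsConvergent (f + g) := by
  obtain ⟨C, r, hC, hr, h⟩ := hf
  obtain ⟨D, s, hD, hs, h'⟩ := hg
  refine ⟨C + D, r * s, by positivity, by nlinarith, fun k => ?_⟩
  have h1 : r ^ k ≤ (r * s) ^ k := by gcongr; nlinarith
  have h2 : s ^ k ≤ (r * s) ^ k := by gcongr; nlinarith
  calc ‖PowerSeries.coeff k (f + g)‖ ≤ C * r ^ k + D * s ^ k := by
        rw [map_add]; exact (norm_add_le _ _).trans (add_le_add (h k) (h' k))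
    _ ≤ C * (r * s) ^ k + D * (r * s) ^ k := by gcongr
    _ = _ := by ring

theorem IsConvergent.mul {f g : PowerSeries ℂ} (hf : IsConvergent f) (hg : IsConvergent g) :
    IsConvergent (f * g) := by
  obtain ⟨C, r, hC, hr, h⟩ := hf
  obtain ⟨D, s, hD, hs, h'⟩ := hg
  refine ⟨C * D, 2 * (r * s), by positivity, by nlinarith, fun k => ?_⟩
  rw [PowerSeries.coeff_mul]
  calc ‖∑ p ∈ Finset.HasAntidiagonal.antidiagonal k, PowerSeries.coeff p.1 f * PowerSeries.coeff p.2 g‖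
      ≤ ∑ p ∈ Finset.HasAntidiagonal.antidiagonal k, C * D * (r * s) ^ k := by
        refine norm_sum_le_of_le _ fun p hp => ?_
        rw [Finset.HasAntidiagonal.mem_antidiagonal] at hp
        rw [norm_mul]
        have h1 : r ^ p.1 ≤ (r * s) ^ p.1 := by gcongr; nlinarith
        have h2 : s ^ p.2 ≤ (r * s) ^ p.2 := by gcongr; nlinarith
        calc _ ≤ (C * r ^ p.1) * (D * s ^ p.2) := by gcongr <;> simp [h, h']
          _ ≤ (C * (r * s) ^ p.1) * (D * (r * s) ^ p.2) := by gcongr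
          _ = C * D * (r * s) ^ k := by rw [← hp, pow_add]; ring
    _ = C * D * ((k + 1 : ℝ) * (r * s) ^ k) := by
        rw [Finset.sum_const, Finset.Nat.card_antidiagonal, nsmul_eq_mul]; push_cast; ring
    _ ≤ C * D * (2 ^ k * (r * s) ^ k) := by
        gcongr
        exact_mod_cast Nat.succ_le_of_lt k.lt_two_pow_self
    _ = _ := by rw [← mul_pow]

/-- `ℂ{x}`, the ring of convergent power series. -/
def convergentPowerSeries : Subalgebra ℂ (PowerSeries ℂ) where
  carrier := {f | IsConvergent f}
  mul_mem' := IsConvergent.mul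
  add_mem' := IsConvergent.add
  algebraMap_mem' c := by
    refine ⟨‖c‖, 1, by positivity, le_rfl, fun k => ?_⟩
    rw [PowerSeries.algebraMap_apply, PowerSeries.coeff_C]
    split_ifs <;> simp

theorem IsConvergent.derivative {f : PowerSeries ℂ} (hf : IsConvergent f) :
    IsConvergent (PowerSeries.derivative ℂ f) := by
  obtain ⟨C, r, hC, hr, h⟩ := hf
  refine ⟨C * r, 2 * r, by positivity, by linarith, fun k => ?_⟩
  rw [PowerSeries.coeff_derivative, norm_mul]
  have h1 : ‖(k : ℂ) + 1‖ = (k : ℝ) + 1 := by exact_mod_cast Complex.norm_natCast (k + 1)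
  rw [h1]
  calc _ ≤ (C * r ^ (k + 1)) * 2 ^ k := by
        gcongr
        · exact h _
        · exact_mod_cast Nat.succ_le_of_lt k.lt_two_pow_self
    _ = _ := by rw [mul_pow]; ring

theorem isConvergent_X : IsConvergent PowerSeries.X := by
  refine ⟨1, 1, by norm_num, le_rfl, fun k => ?_⟩
  rw [PowerSeries.coeff_X]
  split_ifs <;> simp

theorem coeff_derivative (f : ℂ⸨X⸩) (m : ℤ) :
    (LaurentSeries.derivative ℂ f).coeff m = (m + 1) * f.coeff (m + 1) := by
  rw [LaurentSeries.derivative_apply, LaurentSeries.hasseDeriv_coeff]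
  simp

theorem coeff_X_mul_derivative (f : ℂ⸨X⸩) (m : ℤ) :
    (HahnSeries.single 1 1 * LaurentSeries.derivative ℂ f).coeff m = m * f.coeff m := by
  have h := HahnSeries.coeff_single_mul_add (r := (1 : ℂ)) (x := LaurentSeries.derivative ℂ f)
    (a := m - 1) (b := 1)
  rw [sub_add_cancel] at h
  rw [h, coeff_derivative]
  push_cast
  simp

theorem single_mul_cancel {p : ℤ} {f g : ℂ⸨X⸩}
    (h : HahnSeries.single p 1 * f = HahnSeries.single p 1 * g) : f = g := by
  have h2 := congrArg (HahnSeries.single (-p) (1 : ℂ) * ·) h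
  simpa [← mul_assoc, HahnSeries.single_mul_single] using h2

/-- The derivative of Laurent series satisfies the Leibniz rule. -/
theorem laurent_leibniz (f g : ℂ⸨X⸩) : LaurentSeries.derivative ℂ (f * g) =
    f * LaurentSeries.derivative ℂ g + g * LaurentSeries.derivative ℂ f := by
  have hs : ∀ h : ℂ⸨X⸩, (HahnSeries.single 1 1 * LaurentSeries.derivative ℂ h).support ⊆
      h.support := by
    intro h m hm
    rw [HahnSeries.mem_support, coeff_X_mul_derivative] at hm
    exact right_ne_zero_of_mul hm
  apply single_mul_cancel (p := 1)
  rw [mul_add, mul_left_comm, mul_left_comm _ g, mul_comm g]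
  ext m
  rw [coeff_X_mul_derivative, HahnSeries.coeff_add,
    HahnSeries.coeff_mul_right' g.isPWO_support (hs g),
    HahnSeries.coeff_mul_left' f.isPWO_support (hs f), HahnSeries.coeff_mul, Finset.mul_sum,
    ← Finset.sum_add_distrib]
  refine Finset.sum_congr rfl fun p hp => ?_
  rw [Finset.mem_antidiagonal] at hp
  rw [coeff_X_mul_derivative, coeff_X_mul_derivative, ← hp.2.2]
  push_cast
  ring

/-- `ℂ{x}[x⁻¹]`, the ring of convergent Laurent series with finite principal part: those Laurent
series `f` for which some `x^p f` is a convergent power series. -/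
def convergentLaurentSeries : Subring ℂ⸨X⸩ where
  carrier := {f | ∃ p : ℕ, ∃ g : PowerSeries ℂ, IsConvergent g ∧
    HahnSeries.single (p : ℤ) 1 * f = HahnSeries.ofPowerSeries ℤ ℂ g}
  mul_mem' := by
    rintro f f' ⟨p, g, hg, h⟩ ⟨p', g', hg', h'⟩
    refine ⟨p + p', g * g', hg.mul hg', ?_⟩
    rw [map_mul, ← h, ← h', mul_mul_mul_comm, HahnSeries.single_mul_single]
    simp
  one_mem' := ⟨0, 1, convergentPowerSeries.one_mem, by simp⟩
  zero_mem' := ⟨0, 0, convergentPowerSeries.zero_mem, by simp⟩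
  add_mem' := by
    rintro f f' ⟨p, g, hg, h⟩ ⟨p', g', hg', h'⟩
    have hX : ∀ q : ℕ, IsConvergent (PowerSeries.X ^ q) := fun q =>
      convergentPowerSeries.pow_mem isConvergent_X q
    refine ⟨p + p', PowerSeries.X ^ p' * g + PowerSeries.X ^ p * g',
      ((hX _).mul hg).add ((hX _).mul hg'), ?_⟩
    rw [map_add, map_mul, map_mul, ← h, ← h', HahnSeries.ofPowerSeries_X_pow,
      HahnSeries.ofPowerSeries_X_pow, ← mul_assoc, ← mul_assoc, HahnSeries.single_mul_single,
      HahnSeries.single_mul_single, mul_add]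
    simp [add_comm]
  neg_mem' := by
    rintro f ⟨p, g, hg, h⟩
    exact ⟨p, -g, convergentPowerSeries.neg_mem hg, by rw [map_neg, ← h]; ring⟩

/-- `ℂ{x}` as a type. -/
def ConvO : Type := convergentPowerSeries

instance : CommRing ConvO := inferInstanceAs (CommRing convergentPowerSeries)

instance : Algebra ℂ ConvO := inferInstanceAs (Algebra ℂ convergentPowerSeries)

/-- `ℂ{x}[x⁻¹]` as a type. -/
def ConvK : Type := convergentLaurentSeries

instance : CommRing ConvK := inferInstanceAs (CommRing convergentLaurentSeries)

/-- The inclusion `ℂ{x} → ℂ{x}[x⁻¹]`. -/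
def inclOK : ConvO →+* ConvK :=
  show convergentPowerSeries →+* convergentLaurentSeries from
  ((HahnSeries.ofPowerSeries ℤ ℂ).comp convergentPowerSeries.val.toRingHom).codRestrict
    convergentLaurentSeries (fun f => ⟨0, f.1, f.2, by simp⟩)

instance : Algebra ConvO ConvK := inclOK.toAlgebra

instance : Algebra ℂ ConvK := (inclOK.comp (algebraMap ℂ ConvO)).toAlgebra

instance : IsScalarTower ℂ ConvO ConvK := IsScalarTower.of_algebraMap_eq fun _ => rfl

/-- The coordinate `x` in `ℂ{x}`. -/
def xO : ConvO := ⟨PowerSeries.X, isConvergent_X⟩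

/-- The element `x^p` (`p ∈ ℤ`) of `ℂ{x}[x⁻¹]`. -/
def xPow (p : ℤ) : ConvK := ⟨HahnSeries.single p 1, (-p).toNat, PowerSeries.X ^ p.toNat,
  convergentPowerSeries.pow_mem isConvergent_X _, by
    rw [HahnSeries.ofPowerSeries_X_pow, HahnSeries.single_mul_single, mul_one]
    have h : ((-p).toNat : ℤ) + p = p.toNat := by omega
    rw [h]⟩

theorem derivative_mem {f : ℂ⸨X⸩} (hf : f ∈ convergentLaurentSeries) :
    LaurentSeries.derivative ℂ f ∈ convergentLaurentSeries := by
  obtain ⟨p, g, hg, h⟩ := hf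
  refine ⟨p + 1, PowerSeries.X * PowerSeries.derivative ℂ g - PowerSeries.C (p : ℂ) * g,
    convergentPowerSeries.sub_mem (isConvergent_X.mul hg.derivative)
      (convergentPowerSeries.mul_mem (convergentPowerSeries.algebraMap_mem (p : ℂ)) hg), ?_⟩
  have h1 : LaurentSeries.derivative ℂ (HahnSeries.ofPowerSeries ℤ ℂ g) =
      HahnSeries.ofPowerSeries ℤ ℂ (PowerSeries.derivative ℂ g) := by
    ext m
    rw [coeff_derivative, PowerSeries.coeff_coe, PowerSeries.coeff_coe]
    rcases lt_trichotomy m (-1) with hm | hm | hm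
    · rw [if_pos (by omega), if_pos (by omega), mul_zero]
    · subst hm
      simp
    · obtain ⟨k, rfl⟩ := Int.eq_ofNat_of_zero_le (show 0 ≤ m by omega)
      rw [if_neg (by omega), if_neg (by omega), PowerSeries.coeff_derivative, mul_comm]
      simp [show ((k : ℤ) + 1).natAbs = k + 1 by omega]
  have h2 : HahnSeries.single 1 1 * LaurentSeries.derivative ℂ (HahnSeries.single (p : ℤ) (1 : ℂ))
      = HahnSeries.C (p : ℂ) * HahnSeries.single (p : ℤ) (1 : ℂ) := by
    ext m
    rw [coeff_X_mul_derivative, HahnSeries.C_apply, HahnSeries.single_mul_single, zero_add, mul_one,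
      HahnSeries.coeff_single, HahnSeries.coeff_single]
    split_ifs with hm
    · simp [hm]
    · simp
  have h3 := laurent_leibniz (HahnSeries.single (p : ℤ) (1 : ℂ)) f
  rw [h, h1] at h3
  have h4 := congrArg (HahnSeries.single 1 (1 : ℂ) * ·) h3
  rw [map_sub, map_mul, map_mul, HahnSeries.ofPowerSeries_X, h4, HahnSeries.ofPowerSeries_C,
    mul_add, mul_left_comm _ f, h2, ← h, mul_left_comm f, mul_comm f, add_sub_cancel_right,
    ← mul_assoc, HahnSeries.single_mul_single]
  simp [add_comm]

/-- `d/dx` on `ℂ{x}[x⁻¹]`. -/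
def derivK : Derivation ℂ ConvK ConvK :=
  Derivation.mk'
    { toFun := fun f => ⟨LaurentSeries.derivative ℂ f.1, derivative_mem f.2⟩
      map_add' := fun f g => Subtype.ext (map_add _ _ _)
      map_smul' := fun c f => by
        have hc : ∀ (c : ℂ) (f : ConvK), ((c • f : ConvK).1 : ℂ⸨X⸩) = HahnSeries.C c * f.1 := by
          intro c f
          rw [Algebra.smul_def]
          change HahnSeries.ofPowerSeries ℤ ℂ (PowerSeries.C c) * f.1 = _
          rw [HahnSeries.ofPowerSeries_C]
        have h2 := hc c (⟨LaurentSeries.derivative ℂ f.1, derivative_mem f.2⟩ : ConvK)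
        apply Subtype.ext
        change LaurentSeries.derivative ℂ (c • f).1 = _
        rw [RingHom.id_apply, hc]
        refine Eq.trans ?_ h2.symm
        ext m
        simp only [coeff_derivative, HahnSeries.C_mul_eq_smul, HahnSeries.coeff_smul, smul_eq_mul]
        ring }
    (fun f g => Subtype.ext (laurent_leibniz f.1 g.1))

end Convergent
/-- `ℂ[τ, τ⁻¹] = ℂ[θ, θ⁻¹]`, where `θ = τ⁻¹`. -/
abbrev LamC : Type := ℂ[T;T⁻¹]

/-- `ℂ{x}[τ, τ⁻¹] = ℂ{x}[θ, θ⁻¹]`. -/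
abbrev LamO : Type := ConvO[T;T⁻¹]

/-- `ℂ{x}[x⁻¹][τ, τ⁻¹]`. -/
abbrev LamK : Type := ConvK[T;T⁻¹]

instance : Algebra LamC LamO := (AddMonoidAlgebra.mapRingHom ℤ (algebraMap ℂ ConvO)).toAlgebra

instance : Algebra LamO LamK := (AddMonoidAlgebra.mapRingHom ℤ (algebraMap ConvO ConvK)).toAlgebra

instance : Algebra LamC LamK :=
  ((algebraMap LamO LamK).comp (algebraMap LamC LamO)).toAlgebra

instance : IsScalarTower LamC LamO LamK := IsScalarTower.of_algebraMap_eq fun _ => rfl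

/-! ### The Kashiwara–Malgrange filtration -/

section VFiltration

variable {O M : Type*} [CommRing O] [AddCommGroup M] [Module O M] [Module ℂ M]

/-- `V^{>α} = ⋃_{β > α} V^β` for a decreasing filtration. -/
def filtGt (V : ℝ → Submodule O M) (α : ℝ) : Submodule O M := ⨆ β : Set.Ioi α, V β

/-- The operator `x ∂ₓ - α`. -/
def eulerSub (x : O) (Dx : M →ₗ[ℂ] M) (α : ℝ) (m : M) : M := x • Dx m - (α : ℂ) • m

/-- Let `M` be a left `D`-module over `D = O⟨∂_τ, ∂_x⟩`, where `O` is a ring of functions in the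
variables `x, τ` and `Dτ`, `Dx` are the actions of `∂_τ` and `∂_x`. With
`V⁰D = O⟨∂_τ, x ∂_x⟩`, `IsKashiwaraMalgrange x Dτ Dx V` says that the family `V^α`, `α ∈ ℝ`, is a
Kashiwara–Malgrange filtration of `M` along `x = 0`. -/
structure IsKashiwaraMalgrange (x : O) (Dτ Dx : M →ₗ[ℂ] M) (V : ℝ → Submodule O M) : Prop where
  /-- The filtration is decreasing. -/
  antitone : Antitone V
  /-- The filtration is exhaustive. -/
  exhaustive : ∀ m : M, ∃ α, m ∈ V α
  /-- The filtration is left continuous and its jumps lie in `S + ℤ` for a finite set `S`. -/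
  discrete : ∃ S : Finset ℝ, ∀ α β : ℝ, α ≤ β →
    (∀ σ ∈ S, ∀ p : ℤ, ¬ (α ≤ σ + p ∧ σ + p < β)) → V α = V β
  /-- `x V^α ⊆ V^{α+1}`. -/
  smul_mem : ∀ α, ∀ m ∈ V α, x • m ∈ V (α + 1)
  /-- `∂_x V^α ⊆ V^{α-1}`. -/
  derivX_mem : ∀ α, ∀ m ∈ V α, Dx m ∈ V (α - 1)
  /-- `∂_τ V^α ⊆ V^α`. -/
  derivTau_mem : ∀ α, ∀ m ∈ V α, Dτ m ∈ V α
  /-- Each `V^α` is finitely generated over `V⁰D`. -/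
  finite : ∀ α, ∃ T : Finset M, (T : Set M) ⊆ V α ∧ ∀ W : Submodule O M, (T : Set M) ⊆ W →
    (∀ m ∈ W, Dτ m ∈ W) → (∀ m ∈ W, x • Dx m ∈ W) → V α ≤ W
  /-- `V^{α+1} = x V^α` for `α ≫ 0`. -/
  good_pos : ∃ α₀, ∀ α ≥ α₀, ∀ m ∈ V (α + 1), ∃ m' ∈ V α, m = x • m'
  /-- `V^{α-1} = V^α + ∂_x V^α` for `α ≪ 0`. -/
  good_neg : ∃ α₀, ∀ α ≤ α₀, ∀ m ∈ V (α - 1), ∃ a ∈ V α, ∃ b ∈ V α, m = a + Dx b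
  /-- `x ∂_x - α` is nilpotent on `V^α / V^{>α}`. -/
  nilpotent : ∀ α, ∃ N : ℕ, ∀ m ∈ V α, (eulerSub x Dx α)^[N] m ∈ filtGt V α

end VFiltration

/-! ### The combinatorial data of the weights -/

section Weights

variable {n : ℕ} (w : Fin n → ℕ)

/-- `μ = 1 + w₁ + ⋯ + wₙ`. -/
def mu : ℕ := 1 + ∑ i, w i

/-- The weights `w₀ = 1, w₁, …, wₙ`. -/
def allWeights : Fin (n + 1) → ℕ := Fin.cons 1 w

/-- The multiset `S_w`: the disjoint union of the sets `{ℓ μ / wᵢ | 0 ≤ ℓ < wᵢ}` for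
`i = 0, …, n`, where `w₀ = 1`. -/
def specMultiset : Multiset ℚ :=
  ∑ i : Fin (n + 1), (Multiset.range (allWeights w i)).map
    fun ℓ => (ℓ * mu w : ℚ) / allWeights w i

/-- `s_k`, the `k`-th element (`0 ≤ k < μ`) of `S_w` in increasing order. -/
def spec (k : ℕ) : ℚ := (specMultiset w).sort.getD k 0

/-- `α_k = k - s_k`. -/
def alphaInf (k : ℕ) : ℚ := k - spec w k

/-- `v(ω_k^φ) = s_k / μ`. -/
def weight (k : ℕ) : ℝ := (spec w k / mu w : ℚ)

/-- A maximal constant sequence `s_p = s_{p+1} = ⋯ = s_{p+ℓ-1}` (of length `ℓ > 0`) in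
`s_0 ≤ s_1 ≤ ⋯ ≤ s_{μ-1}`. -/
structure MaxRun where
  start : ℕ
  length : ℕ
  length_pos : 0 < length
  le_mu : start + length ≤ mu w
  constant : ∀ i < length, spec w (start + i) = spec w start
  maximal_left : ∀ p, p + 1 = start → spec w p ≠ spec w start
  maximal_right : start + length < mu w → spec w (start + length) ≠ spec w start

end Weights

/-! ### The filtration `V` of the Gauss–Manin system -/

section Filtration

variable {n : ℕ} (w : Fin n → ℕ)

/-- The germ at `x = 0` of the Gauss–Manin system `G` of `F`, with coefficients in
`ℂ{x}[x⁻¹]`. -/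
abbrev G : Type := System w (xPow 1)

instance : Module LamO (G w) := Module.compHom (G w) (algebraMap LamO LamK)

instance : Module LamC (G w) := Module.compHom (G w) (algebraMap LamC LamK)

instance : IsScalarTower LamO LamK (G w) where
  smul_assoc a b m := by
    rw [Algebra.smul_def, mul_smul]
    rfl

instance : IsScalarTower LamC LamO (G w) where
  smul_assoc a b m := by
    change (algebraMap LamO LamK (a • b)) • m =
      (algebraMap LamC LamK a) • (algebraMap LamO LamK b • m)
    rw [Algebra.smul_def, map_mul, mul_smul]
    rfl

/-- `∇_{∂/∂x}` on `G`. -/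
abbrev gNablaX : G w →ₗ[ℂ] G w := nablaX w (xPow 1) derivK

/-- `∇_{∂/∂τ}` on `G`. -/
abbrev gNablaTau : G w →ₗ[ℂ] G w := nablaTau w (xPow 1)

/-- Multiplication by `x^p`, `p ∈ ℤ`, on `G`. -/
def xMul (p : ℤ) : G w →ₗ[LamO] G w :=
  Algebra.lsmul LamO LamO (G w) (LaurentPolynomial.C (xPow p) : LamK)

/-- The sections `ω_k^φ`: `ω_0^φ` is the class of `du₁/u₁ ∧ ⋯ ∧ duₙ/uₙ` and
`τ ω_{k+1}^φ = -(1/μ) (τ ∇_{∂/∂τ} + α_k) ω_k^φ`. -/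
def omegaPhi : ℕ → G w
  | 0 => System.mk w (xPow 1) 1
  | k + 1 => (LaurentPolynomial.T (-1) : LamK) • ((-(1 / (mu w : ℂ))) •
      ((LaurentPolynomial.T 1 : LamK) • gNablaTau w (omegaPhi k) +
        ((alphaInf w k : ℚ) : ℂ) • omegaPhi k))

/-- The `ℂ{x}[θ, θ⁻¹]`-submodule of `G` generated by the `ω_k^φ`, `0 ≤ k < μ`, whose weight
satisfies `P`. -/
def spanWeight (P : ℝ → Prop) : Submodule LamO (G w) :=
  Submodule.span LamO {m | ∃ k < mu w, P (weight w k) ∧ m = omegaPhi w k}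

/-- `V^α G`. For `0 ≤ α < 1` it is
`∑_{α ≤ v(ω_k)} ℂ{x}[θ, θ⁻¹] ω_k + x ∑_{α > v(ω_k)} ℂ{x}[θ, θ⁻¹] ω_k`, and
`V^{α+p} G = x^p V^α G` for `p ∈ ℤ`. -/
def V (α : ℝ) : Submodule LamO (G w) :=
  (spanWeight w (fun v => Int.fract α ≤ v) ⊔
    (spanWeight w (fun v => v < Int.fract α)).map (xMul w 1)).map (xMul w ⌊α⌋)

/-- `V^{>α} G`. For `0 ≤ α < 1` it is
`∑_{α < v(ω_k)} ℂ{x}[θ, θ⁻¹] ω_k + x ∑_{α ≥ v(ω_k)} ℂ{x}[θ, θ⁻¹] ω_k`, and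
`V^{>α+p} G = x^p V^{>α} G` for `p ∈ ℤ`. -/
def VGt (α : ℝ) : Submodule LamO (G w) :=
  (spanWeight w (fun v => Int.fract α < v) ⊔
    (spanWeight w (fun v => v ≤ Int.fract α)).map (xMul w 1)).map (xMul w ⌊α⌋)

/-- `H^α = V^α G / V^{>α} G`. -/
abbrev Hgr (α : ℝ) : Type := V w α ⧸ (VGt w α).submoduleOf (V w α)

/-- `H = ⨁_{α ∈ [0, 1)} H^α`. -/
abbrev H : Type := ⨁ α : Set.Ico (0 : ℝ) 1, Hgr w α

/-- The class in `H` of an element of `V^α G`, `α ∈ [0, 1)`. -/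
def classH (α : Set.Ico (0 : ℝ) 1) (m : V w α) : H w :=
  DirectSum.of (fun α : Set.Ico (0 : ℝ) 1 => Hgr w α) α (Submodule.Quotient.mk m)

/-- The coordinate function `x`, as an element of `ℂ{x}[θ, θ⁻¹]`. -/
def xLam : LamO := LaurentPolynomial.C xO

end Filtration

end GaussManin

end

open GaussManin

noncomputable section

namespace GaussManin

/-! ### Modules with a connection along a logarithmic vector field -/

section Connection

open Polynomial

/-! Write D for x∇_{∂/∂x} and v_k = s_k/μ. The monomial classes e(a) = [u^a ω₀] satisfy τ e(a+1_i) =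
a_i e(a) − w_i D e(a) and D e(a) = −τx e(a−w). Eliminating D leaves exactly the defining relations
of G (`exists_system_lift`). Adding the relations over i gives τ∇_{∂/∂τ} e(a) = (μD − Σ a_i) e(a),
and this turns the recursion for ω_k into D ω_k = v_k ω_k − τ ω_{k+1} (`omegaPhi_spec`).

Hence ∏_{j<μ}(D − v_j) ω_0 = (−τ)^μ ω_μ. Up to a constant, ∏(X − v_j) is X ∏_i ∏_{l<w_i}(l − w_i X)
(`prod_X_sub_C_spec`), and the monomial relations make ω_0 a solution of the corresponding
hypergeometric equation. So ω_μ is a constant multiple of x ω_0, and D acts on ω_0, …, ω_{μ−1} by a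
companion matrix. These elements generate G (`span_omegaPhi`). Their independence comes from a
model: in R^μ with the companion connection the first standard vector solves the same equation, so a
family with the relations of the e(a) can be built from it, and the induced map out of G sends ω_k
to the k-th standard vector (`exists_coordMap`).

In this basis V^α is the set of elements whose k-th coordinate has x-order at least ⌈α − v_k⌉
(`mem_V`), and V^{>α} is given by ⌊α − v_k⌋ + 1 (`mem_VGt`). Since the v_k are nondecreasing and lie
in [0,1), D preserves both, and modulo V^{>α} the operator D − α is strictly triangular
(`eulerSub_iterate_mem`). The classes of the ω_k form a basis of H in which N ω_k is −τ ω_{k+1} when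
s_k = s_{k+1} with k+1 < μ, and 0 otherwise. The Jordan chains are therefore the maximal constant
runs, after rescaling by powers of −τ.

Among the Kashiwara–Malgrange axioms, the one for α ≪ 0 needs its own argument: at negative weights
D is invertible modulo deeper steps of the filtration (`exists_eq_add_eulerOp`). Uniqueness is the
general comparison of two such filtrations. Far out, one is contained in the other by finite
generation and goodness (`IsKashiwaraMalgrange.exists_le`); in between, D has distinct generalised
eigenvalues r ≠ s on the two graded pieces, so coprime polynomials in D push an element deeper into
one filtration or the other (`IsKashiwaraMalgrange.inf_le`). -/

/-- `D` satisfies the Leibniz rule over the derivation `δ`. -/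
def IsConnection {R M : Type*} [CommRing R] [Algebra ℂ R] [AddCommGroup M] [Module R M] [Module ℂ M]
    (δ : Derivation ℂ R R) (D : Module.End ℂ M) : Prop :=
  ∀ (f : R) (m : M), D (f • m) = δ f • m + f • D m

variable {R M : Type*} [CommRing R] [Algebra ℂ R] [AddCommGroup M] [Module R M] [Module ℂ M]
  [IsScalarTower ℂ R M] {δ : Derivation ℂ R R} {D : Module.End ℂ M}

theorem IsConnection.aeval_smul_const (hD : IsConnection δ D) {c : R} (hc : δ c = 0) (p : ℂ[X])
    (m : M) : aeval D p (c • m) = c • aeval D p m := by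
  induction p using Polynomial.induction_on generalizing m with
  | C a => rw [aeval_C, Module.algebraMap_end_apply, Module.algebraMap_end_apply, smul_comm]
  | add p q hp hq => simp [hp, hq]
  | monomial k a h =>
    rw [pow_succ, ← mul_assoc, map_mul, Module.End.mul_apply, Module.End.mul_apply, aeval_X, hD, hc,
      zero_smul, zero_add, h]

theorem IsConnection.derivation_inv (X : Rˣ) (hX : δ X = X) :
    δ (↑X⁻¹ : R) = -(↑X⁻¹ : R) := by
  have h : δ ((X : R) * ↑X⁻¹) = 0 := by rw [Units.mul_inv, Derivation.map_one_eq_zero]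
  rw [Derivation.leibniz, hX, smul_eq_mul, smul_eq_mul, Units.inv_mul] at h
  have h2 := congrArg ((↑X⁻¹ : R) * ·) h
  simp only [mul_add, ← mul_assoc, Units.inv_mul, one_mul, mul_one, mul_zero] at h2
  exact eq_neg_of_add_eq_zero_left h2

theorem derivation_unit_inv_eq_zero (t : Rˣ) (ht : δ t = 0) : δ (↑t⁻¹ : R) = 0 := by
  have h : δ ((t : R) * ↑t⁻¹) = 0 := by rw [Units.mul_inv, Derivation.map_one_eq_zero]
  rw [Derivation.leibniz, ht, smul_zero, add_zero, smul_eq_mul] at h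
  have h2 := congrArg ((↑t⁻¹ : R) * ·) h
  simpa only [← mul_assoc, Units.inv_mul, one_mul, mul_zero] using h2

theorem derivation_unit_pow_eq_zero (t : Rˣ) (ht : δ t = 0) (k : ℕ) : δ (↑(t ^ k) : R) = 0 := by
  rw [Units.val_pow_eq_pow_val, Derivation.leibniz_pow, ht, smul_zero, smul_zero]

/-- By Leibniz, x⁻¹ is an eigenvector of the derivation with eigenvalue −1, so moving D past it
replaces D by D − 1. -/
theorem IsConnection.aeval_inv_smul (hD : IsConnection δ D) (Y : Rˣ) (hY : δ Y = Y) (p : ℂ[X])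
    (m : M) : aeval D p ((↑Y⁻¹ : R) • m) = (↑Y⁻¹ : R) • aeval D (p.comp (X - 1)) m := by
  induction p using Polynomial.induction_on generalizing m with
  | C a =>
    rw [C_comp, aeval_C, Module.algebraMap_end_apply, Module.algebraMap_end_apply, smul_comm]
  | add p q hp hq => simp [hp, hq]
  | monomial k a h =>
    rw [pow_succ, ← mul_assoc, map_mul, Module.End.mul_apply, aeval_X, hD,
      IsConnection.derivation_inv Y hY, neg_smul, neg_add_eq_sub, ← smul_sub, h, mul_comp _ X,
      X_comp, map_mul, Module.End.mul_apply]
    simp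

/-- The operator `-τ⁻¹ x⁻¹ D`. -/
def downOp (t Y : Rˣ) (D : Module.End ℂ M) : Module.End ℂ M :=
  -(Algebra.lsmul ℂ ℂ M (↑(t⁻¹ * Y⁻¹) : R)) * D

theorem downOp_apply (t Y : Rˣ) (m : M) :
    downOp t Y D m = -((↑(t⁻¹ * Y⁻¹) : R) • D m) := rfl

/-- D commutes with p(D) and τ is constant for D, so only the factor x⁻¹ causes a shift of the
argument. -/
theorem IsConnection.aeval_downOp (hD : IsConnection δ D) {t Y : Rˣ} (ht : δ t = 0) (hY : δ Y = Y)
    (p : ℂ[X]) (m : M) :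
    aeval D p (downOp t Y D m) = downOp t Y D (aeval D (p.comp (X - 1)) m) := by
  have hc : ∀ q : ℂ[X], D (aeval D q m) = aeval D q (D m) := by
    intro q
    have h : D * aeval D q = aeval D q * D := by
      conv_lhs => rw [← aeval_X (R := ℂ) D, aeval_X, ← aeval_X (R := ℂ) D]
      conv_rhs => rw [← aeval_X (R := ℂ) D]
      simp only [aeval_X]
      have := congrArg (aeval D) (mul_comm X q)
      simpa using this
    exact congrArg (fun f : Module.End ℂ M => f m) h
  rw [downOp_apply, downOp_apply, map_neg, Units.val_mul, mul_smul, mul_smul,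
    hD.aeval_smul_const (derivation_unit_inv_eq_zero t ht), hD.aeval_inv_smul Y hY, hc]

theorem IsConnection.aeval_downOp_pow (hD : IsConnection δ D) {t Y : Rˣ} (ht : δ t = 0)
    (hY : δ Y = Y) (p : ℂ[X]) (k : ℕ) (m : M) :
    aeval D p ((downOp t Y D ^ k) m) =
      (downOp t Y D ^ k) (aeval D (p.comp (X - C (k : ℂ))) m) := by
  induction k generalizing p with
  | zero => simp
  | succ k ih =>
    rw [pow_succ', Module.End.mul_apply, hD.aeval_downOp ht hY, ih, Module.End.mul_apply, comp_assoc]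
    congr 6
    simp
    ring

theorem IsConnection.downOp_pow_smul_const (hD : IsConnection δ D) {t Y : Rˣ} {c : R} (hc : δ c = 0)
    (k : ℕ) (m : M) : (downOp t Y D ^ k) (c • m) = c • (downOp t Y D ^ k) m := by
  induction k generalizing m with
  | zero => simp
  | succ k ih =>
    rw [pow_succ, Module.End.mul_apply, Module.End.mul_apply, downOp_apply, downOp_apply, hD, hc,
      zero_smul, zero_add, smul_comm, ← smul_neg, ih]

/-! ### The hypergeometric polynomials -/

variable {n : ℕ}

/-- `∏_{l < b} (l - w X)`. -/
def fallPoly (w b : ℕ) : ℂ[X] := ∏ l ∈ Finset.range b, (C (l : ℂ) - C (w : ℂ) * X)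

/-- `∏ᵢ ∏_{l < bᵢ} (l - wᵢ X)`. -/
def hyperPoly (w b : Fin n → ℕ) : ℂ[X] := ∏ i, fallPoly (w i) (b i)

/-- Replacing X by X − 1 turns l − w_i X into (l + w_i) − w_i X; the shifted factors are thus those
with index at least w_i in the longer product, and the first w_i factors are left over. -/
theorem hyperPoly_add (w b : Fin n → ℕ) :
    hyperPoly w (b + w) = (hyperPoly w b).comp (X - 1) * hyperPoly w w := by
  rw [hyperPoly, hyperPoly, hyperPoly, prod_comp, ← Finset.prod_mul_distrib]
  refine Finset.prod_congr rfl fun i _ => ?_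
  rw [fallPoly, fallPoly, fallPoly, Pi.add_apply, add_comm, Finset.prod_range_add, mul_comm,
    prod_comp]
  congr 1
  refine Finset.prod_congr rfl fun l _ => ?_
  simp
  ring

theorem hyperPoly_add_single (w b : Fin n → ℕ) (i : Fin n) :
    hyperPoly w (b + Pi.single i 1) = (C (b i : ℂ) - C (w i : ℂ) * X) * hyperPoly w b := by
  rw [hyperPoly, hyperPoly, ← Finset.mul_prod_erase _ _ (Finset.mem_univ i),
    ← Finset.mul_prod_erase _ (fun i => fallPoly (w i) (b i)) (Finset.mem_univ i), ← mul_assoc]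
  congr 1
  · rw [fallPoly, fallPoly, Pi.add_apply, Pi.single_eq_same, Finset.prod_range_succ, mul_comm]
  · refine Finset.prod_congr rfl fun j hj => ?_
    rw [Pi.add_apply, Pi.single_eq_of_ne (Finset.ne_of_mem_erase hj), add_zero]

@[simp] theorem hyperPoly_zero (w : Fin n → ℕ) : hyperPoly w 0 = 1 := by
  simp [hyperPoly, fallPoly]

/-! ### The family of monomial sections attached to a solution of the hypergeometric equation -/

/-- The section corresponding to the monomial with exponent `b - m w`. -/
def preMonomial (t Y : Rˣ) (D : Module.End ℂ M) (w : Fin n → ℕ) (e : M) (m : ℕ) (b : Fin n → ℕ) : M :=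
  (↑(t⁻¹ ^ (∑ i, b i)) : R) • (downOp t Y D ^ m) (aeval D (hyperPoly w b) e)

/-- An exponent has many representations b − m w. The hypergeometric equation `he` is precisely what
makes the sections attached to two neighbouring representations agree. -/
theorem IsConnection.preMonomial_succ (hD : IsConnection δ D) {t Y : Rˣ} (ht : δ t = 0)
    (hY : δ Y = Y) {w : Fin n → ℕ} {e : M}
    (he : downOp t Y D (aeval D (hyperPoly w w) e) = (↑(t ^ (∑ i, w i)) : R) • e)
    (m : ℕ) (b : Fin n → ℕ) :
    preMonomial t Y D w e (m + 1) (b + w) = preMonomial t Y D w e m b := by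
  rw [preMonomial, preMonomial, hyperPoly_add, map_mul, Module.End.mul_apply, pow_succ,
    Module.End.mul_apply, ← hD.aeval_downOp ht hY, he,
    hD.aeval_smul_const (derivation_unit_pow_eq_zero t ht _),
    hD.downOp_pow_smul_const (derivation_unit_pow_eq_zero t ht _), smul_smul, ← Units.val_mul]
  congr 2
  simp only [Pi.add_apply, Finset.sum_add_distrib, pow_add, mul_assoc, ← mul_pow, inv_mul_cancel,
    one_pow, mul_one]

theorem IsConnection.preMonomial_add (hD : IsConnection δ D) {t Y : Rˣ} (ht : δ t = 0)
    (hY : δ Y = Y) {w : Fin n → ℕ} {e : M}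
    (he : downOp t Y D (aeval D (hyperPoly w w) e) = (↑(t ^ (∑ i, w i)) : R) • e)
    (m j : ℕ) (b : Fin n → ℕ) :
    preMonomial t Y D w e (m + j) (b + j • w) = preMonomial t Y D w e m b := by
  induction j with
  | zero => simp
  | succ j ih => rw [← add_assoc, succ_nsmul, ← add_assoc, hD.preMonomial_succ ht hY he, ih]

/-- The section corresponding to the monomial with exponent `a`. -/
def monomialSection (t Y : Rˣ) (D : Module.End ℂ M) (w : Fin n → ℕ) (e : M) (a : Fin n → ℤ) : M :=
  preMonomial t Y D w e (∑ i, (a i).natAbs) fun i => (a i + (∑ i, (a i).natAbs : ℕ) * w i).toNat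

theorem IsConnection.monomialSection_eq (hD : IsConnection δ D) {t Y : Rˣ} (ht : δ t = 0)
    (hY : δ Y = Y) {w : Fin n → ℕ} (hw : ∀ i, 0 < w i) {e : M}
    (he : downOp t Y D (aeval D (hyperPoly w w) e) = (↑(t ^ (∑ i, w i)) : R) • e)
    (a : Fin n → ℤ) (m : ℕ) (b : Fin n → ℕ) (hab : ∀ i, a i = b i - m * w i) :
    monomialSection t Y D w e a = preMonomial t Y D w e m b := by
  -- Since every w_i is at least 1, adding Σ|a_j| copies of w makes each exponent nonnegative, so
  -- the truncation `toNat` in the definition loses nothing.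
  have hM : ∀ i, 0 ≤ a i + (∑ i, (a i).natAbs : ℕ) * w i := by
    intro i
    have h1 : (a i).natAbs ≤ ∑ i, (a i).natAbs :=
      Finset.single_le_sum (f := fun i => (a i).natAbs) (fun _ _ => Nat.zero_le _)
        (Finset.mem_univ i)
    have h2 : (∑ i, (a i).natAbs) * 1 ≤ (∑ i, (a i).natAbs) * w i := Nat.mul_le_mul_left _ (hw i)
    have h3 : ((a i).natAbs : ℤ) ≤ ((∑ i, (a i).natAbs : ℕ) : ℤ) * w i := by
      exact_mod_cast h1.trans (by simpa using h2)
    omega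
  rw [monomialSection]
  set k := ∑ i, (a i).natAbs with hk
  rcases le_total k m with h | h
  · obtain ⟨j, rfl⟩ := Nat.exists_eq_add_of_le h
    rw [← hD.preMonomial_add ht hY he k j]
    congr 1
    funext i
    zify
    simp only [Pi.add_apply, Pi.smul_apply, smul_eq_mul, Nat.cast_add, Nat.cast_mul]
    rw [Int.toNat_of_nonneg (hM i), hab]
    push_cast
    ring
  · obtain ⟨j, hj⟩ := Nat.exists_eq_add_of_le h
    rw [hj, ← hD.preMonomial_add ht hY he m j]
    congr 1
    funext i
    zify
    simp only [Pi.add_apply, Pi.smul_apply, smul_eq_mul, Nat.cast_add, Nat.cast_mul]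
    rw [Int.toNat_of_nonneg (by rw [← Nat.cast_add, ← hj]; exact hM i), hab]
    ring

theorem exists_monomial_shift {w : Fin n → ℕ} (hw : ∀ i, 0 < w i) (a : Fin n → ℤ) :
    ∃ (m : ℕ) (b : Fin n → ℕ), ∀ i, a i = b i - m * w i := by
  refine ⟨∑ i, (a i).natAbs, fun i => (a i + (∑ i, (a i).natAbs : ℕ) * w i).toNat, fun i => ?_⟩
  have h1 : (a i).natAbs ≤ ∑ i, (a i).natAbs :=
    Finset.single_le_sum (f := fun i => (a i).natAbs) (fun _ _ => Nat.zero_le _)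
      (Finset.mem_univ i)
  have h2 : (∑ i, (a i).natAbs) * 1 ≤ (∑ i, (a i).natAbs) * w i := Nat.mul_le_mul_left _ (hw i)
  have h3 : ((a i).natAbs : ℤ) ≤ ((∑ i, (a i).natAbs : ℕ) : ℤ) * w i := by
    exact_mod_cast h1.trans (by simpa using h2)
  rw [Int.toNat_of_nonneg (by omega)]
  ring

/-- D equals −τx times `downOp`, and one more application of `downOp` passes from b − m w to b −
(m+1) w. -/
theorem IsConnection.apply_monomialSection (hD : IsConnection δ D) {t Y : Rˣ} (ht : δ t = 0)
    (hY : δ Y = Y) {w : Fin n → ℕ} (hw : ∀ i, 0 < w i) {e : M}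
    (he : downOp t Y D (aeval D (hyperPoly w w) e) = (↑(t ^ (∑ i, w i)) : R) • e)
    (a : Fin n → ℤ) :
    D (monomialSection t Y D w e a) =
      -((↑(t * Y) : R) • monomialSection t Y D w e fun i => a i - w i) := by
  obtain ⟨m, b, hab⟩ := exists_monomial_shift hw a
  rw [hD.monomialSection_eq ht hY hw he a m b hab,
    hD.monomialSection_eq ht hY hw he (fun i => a i - w i) (m + 1) b
      (fun i => by rw [hab]; push_cast; ring), preMonomial, preMonomial, hD,
    derivation_unit_pow_eq_zero _ (derivation_unit_inv_eq_zero t ht), zero_smul, zero_add, smul_comm,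
    pow_succ' (downOp t Y D), Module.End.mul_apply, downOp_apply, smul_neg, smul_neg, neg_neg,
    smul_smul (↑(t * Y) : R), ← Units.val_mul, mul_comm t⁻¹, ← mul_inv_rev, mul_inv_cancel,
    Units.val_one, one_smul]

/-- Raising b_i inserts the factor b_i − w_i D. Moving it to the left of the m-th power of `downOp`
replaces D by D + m, giving (b_i − m w_i) − w_i D, and b_i − m w_i = a_i. -/
theorem IsConnection.smul_monomialSection_add_single (hD : IsConnection δ D) {t Y : Rˣ}
    (ht : δ t = 0) (hY : δ Y = Y) {w : Fin n → ℕ} (hw : ∀ i, 0 < w i) {e : M}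
    (he : downOp t Y D (aeval D (hyperPoly w w) e) = (↑(t ^ (∑ i, w i)) : R) • e)
    (a : Fin n → ℤ) (i : Fin n) :
    (t : R) • monomialSection t Y D w e (a + Pi.single i 1) =
      (a i : ℂ) • monomialSection t Y D w e a - (w i : ℂ) • D (monomialSection t Y D w e a) := by
  obtain ⟨m, b, hab⟩ := exists_monomial_shift hw a
  have h1 : ∀ y : M, (a i : ℂ) • y - (w i : ℂ) • D y =
      aeval D (C (a i : ℂ) - C (w i : ℂ) * X) y := by
    intro y
    rw [map_sub, map_mul, aeval_C, aeval_C, aeval_X, LinearMap.sub_apply, Module.End.mul_apply,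
      Module.algebraMap_end_apply, Module.algebraMap_end_apply]
  rw [h1, hD.monomialSection_eq ht hY hw he a m b hab,
    hD.monomialSection_eq ht hY hw he (a + Pi.single i 1) m (b + Pi.single i 1) (fun j => by
      rw [Pi.add_apply, Pi.add_apply, hab]
      rcases eq_or_ne j i with rfl | hj
      · simp; ring
      · simp [hj]), preMonomial, preMonomial,
    hD.aeval_smul_const (derivation_unit_pow_eq_zero _ (derivation_unit_inv_eq_zero t ht) _),
    hD.aeval_downOp_pow ht hY, ← Module.End.mul_apply (aeval D _), ← map_mul, smul_smul,
    ← Units.val_mul, hyperPoly_add_single]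
  congr 2
  · have h2 : ∑ j, (b + Pi.single i 1 : Fin n → ℕ) j = ∑ j, b j + 1 := by
      simp [Finset.sum_add_distrib]
    rw [h2, pow_succ',
      mul_inv_cancel_left]
  · congr 4
    rw [hab]
    simp
    ring

end Connection

/-! ### Monomial families, the chain of the ω_k and its companion model -/

section Chain

open Polynomial

variable {R M : Type*} [CommRing R] [Algebra ℂ R] [AddCommGroup M] [Module R M] [Module ℂ M]
  [IsScalarTower ℂ R M] {δ : Derivation ℂ R R} {D : Module.End ℂ M} {n : ℕ}

/-- Each factor D − v_k moves one step along the chain at the cost of −τ, and the accumulated power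
of −τ is constant for D. -/
theorem IsConnection.aeval_prod_chain (hD : IsConnection δ D) {t : Rˣ} (ht : δ t = 0)
    {v : ℕ → ℂ} {ω : ℕ → M} {μ : ℕ}
    (hω : ∀ k < μ, D (ω k) = v k • ω k - (t : R) • ω (k + 1)) {k : ℕ} (hk : k ≤ μ) :
    aeval D (∏ j ∈ Finset.range k, (X - C (v j))) (ω 0) = (-(t : R)) ^ k • ω k := by
  induction k with
  | zero => simp
  | succ k ih =>
    have hc : δ ((-(t : R)) ^ k) = 0 := by
      rw [Derivation.leibniz_pow, map_neg, ht, neg_zero, smul_zero, smul_zero]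
    rw [Finset.prod_range_succ, mul_comm, map_mul, Module.End.mul_apply, ih (by omega),
      hD.aeval_smul_const hc, pow_succ, mul_smul, map_sub, aeval_X, aeval_C, LinearMap.sub_apply,
      Module.algebraMap_end_apply, hω k (by omega), neg_smul]
    congr 1
    abel

/-- Applying the identity `hP` to ω_0 equates c(−τ)^μ ω_μ with D of the hypergeometric polynomial,
up to sign; units are then cancelled. Both directions matter: the Gauss–Manin system satisfies the
right side and needs the left, while the companion model satisfies the left by construction and
needs the right. -/
theorem IsConnection.chain_wrap_iff (hD : IsConnection δ D) {t Y : Rˣ} (ht : δ t = 0)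
    {v : ℕ → ℂ} {ω : ℕ → M} {w : Fin n → ℕ} {c : ℂ}
    (hP : C c * ∏ j ∈ Finset.range (1 + ∑ i, w i), (X - C (v j)) =
      X * ((-1) ^ (∑ i, w i) * hyperPoly w w))
    (hω : ∀ k < 1 + ∑ i, w i, D (ω k) = v k • ω k - (t : R) • ω (k + 1)) :
    c • ω (1 + ∑ i, w i) = (Y : R) • ω 0 ↔
      downOp t Y D (aeval D (hyperPoly w w) (ω 0)) = (↑(t ^ (∑ i, w i)) : R) • ω 0 := by
  have h1 := congrArg (fun p => aeval D p (ω 0)) hP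
  have h2 : aeval D ((-1 : ℂ[X]) ^ (∑ i, w i)) = ((-1) ^ (∑ i, w i) : Module.End ℂ M) := by simp
  have h3 : ∀ y : M, ((-1) ^ (∑ i, w i) : Module.End ℂ M) y = ((-1 : R) ^ (∑ i, w i)) • y := by
    intro y
    rcases Nat.even_or_odd (∑ i, w i) with h | h <;> simp [h.neg_one_pow]
  simp only [map_mul, Module.End.mul_apply, hD.aeval_prod_chain ht hω le_rfl, aeval_C, aeval_X,
    Module.algebraMap_end_apply, h2, h3] at h1
  have h4 : D ((-1 : R) ^ (∑ i, w i) • aeval D (hyperPoly w w) (ω 0)) =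
      (-1 : R) ^ (∑ i, w i) • D (aeval D (hyperPoly w w) (ω 0)) := by
    rcases Nat.even_or_odd (∑ i, w i) with h | h <;> simp [h.neg_one_pow]
  rw [h4, smul_comm, neg_pow, add_comm 1, pow_succ (-1 : R), mul_neg_one, neg_mul, neg_smul,
    mul_smul, ← smul_neg] at h1
  have h5 : ((-1 : R) ^ (∑ i, w i)) * (-1 : R) ^ (∑ i, w i) = 1 := by
    rw [← mul_pow]; simp
  have h6 : D (aeval D (hyperPoly w w) (ω 0)) =
      -((t : R) ^ (∑ i, w i + 1) • c • ω (∑ i, w i + 1)) := by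
    have := congrArg (fun y => ((-1 : R) ^ (∑ i, w i)) • y) h1
    simp only [smul_smul, h5, one_smul] at this
    exact this.symm
  rw [downOp_apply, h6, smul_neg, neg_neg, smul_smul, add_comm 1]
  have h7 : (↑(t⁻¹ * Y⁻¹) : R) * (t : R) ^ (∑ i, w i + 1) = ↑(t ^ (∑ i, w i) * Y⁻¹) := by
    rw [← Units.val_pow_eq_pow_val, ← Units.val_mul]
    congr 1
    rw [pow_succ, mul_comm (t ^ _), mul_comm t⁻¹, mul_assoc, inv_mul_cancel_left, mul_comm]
  rw [h7, Units.val_mul, mul_smul]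
  constructor
  · intro h
    rw [h, ← mul_smul (↑Y⁻¹ : R), Units.inv_mul, one_smul]
  · intro h
    have h8 := congrArg (fun y => ((↑(Y * (t ^ (∑ i, w i))⁻¹) : R) • y)) h
    simp only [smul_smul, ← Units.val_mul] at h8
    simpa [mul_assoc] using h8

/-- The relations satisfied by the classes of the monomials in the Gauss–Manin system. -/
structure IsMonomialFamily (t Y : Rˣ) (D : Module.End ℂ M) (w : Fin n → ℕ)
    (e : (Fin n → ℤ) → M) : Prop where
  smul_add_single : ∀ a i, (t : R) • e (a + Pi.single i 1) = (a i : ℂ) • e a - (w i : ℂ) • D (e a)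
  apply_eq : ∀ a, D (e a) = -((↑(t * Y) : R) • e fun i => a i - w i)

theorem nat_fun_induction {p : (Fin n → ℕ) → Prop} (h0 : p 0)
    (h1 : ∀ b i, p b → p (b + Pi.single i 1)) (b : Fin n → ℕ) : p b := by
  induction hN : ∑ i, b i generalizing b with
  | zero =>
    have : b = 0 := by
      funext i
      exact Finset.sum_eq_zero_iff.1 hN i (Finset.mem_univ i)
    rwa [this]
  | succ N ih =>
    obtain ⟨i, hi⟩ : ∃ i, b i ≠ 0 := by
      by_contra! h
      simp [h] at hN
    have hb : b = (b - Pi.single i 1) + Pi.single i 1 := by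
      funext j
      rcases eq_or_ne j i with rfl | hj
      · simp; omega
      · simp [hj]
    have hs : ∑ j, b j = ∑ j, (b - Pi.single i 1 : Fin n → ℕ) j + 1 := by
      conv_lhs => rw [hb]
      simp [Finset.sum_add_distrib]
    rw [hb]
    exact h1 _ i (ih _ (by omega))

/-- Climbing from exponent 0 to b by unit steps, each step in direction i contributes the same
factor that `hyperPoly_add_single` adds. -/
theorem IsMonomialFamily.smul_eq_aeval {t Y : Rˣ} {w : Fin n → ℕ} {e : (Fin n → ℤ) → M}
    (he : IsMonomialFamily t Y D w e) (hD : IsConnection δ D) (ht : δ t = 0) (b : Fin n → ℕ) :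
    (↑(t ^ (∑ i, b i)) : R) • e (fun i => b i) = aeval D (hyperPoly w b) (e 0) := by
  induction b using nat_fun_induction with
  | h0 => simp; rfl
  | h1 b i ih =>
    have h2 : ∑ j, (b + Pi.single i 1 : Fin n → ℕ) j = ∑ j, b j + 1 := by
      simp [Finset.sum_add_distrib]
    have h3 : (fun j => (((b + Pi.single i 1 : Fin n → ℕ) j : ℕ) : ℤ)) =
        (fun j => (b j : ℤ)) + Pi.single i 1 := by
      funext j
      rcases eq_or_ne j i with rfl | hj
      · simp
      · simp [hj]
    rw [h2, h3, pow_succ, Units.val_mul, mul_smul, he.smul_add_single, hyperPoly_add_single, map_mul,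
      Module.End.mul_apply, ← ih, hD.aeval_smul_const (derivation_unit_pow_eq_zero t ht _), map_sub,
      map_mul, aeval_C, aeval_C, aeval_X, LinearMap.sub_apply, Module.End.mul_apply,
      Module.algebraMap_end_apply, Module.algebraMap_end_apply]
    simp

/-- Climb from 0 to the exponent w by multiplication relations, then return to 0 in one step with D:
this closed loop is the hypergeometric equation. -/
theorem IsMonomialFamily.downOp_hyperPoly {t Y : Rˣ} {w : Fin n → ℕ} {e : (Fin n → ℤ) → M}
    (he : IsMonomialFamily t Y D w e) (hD : IsConnection δ D) (ht : δ t = 0) :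
    downOp t Y D (aeval D (hyperPoly w w) (e 0)) = (↑(t ^ (∑ i, w i)) : R) • e 0 := by
  rw [← he.smul_eq_aeval hD ht, downOp_apply, hD, derivation_unit_pow_eq_zero t ht, zero_smul,
    zero_add, he.apply_eq, smul_neg, smul_neg, neg_neg, smul_comm, smul_smul (↑(t⁻¹ * Y⁻¹) : R),
    ← Units.val_mul, ← mul_inv, inv_mul_cancel, Units.val_one, one_smul]
  congr 2
  funext i
  simp

/-- As τ and x are invertible, the two relations permit the moves a ↦ a − w and a ↦ a + 1_i inside a
D-stable submodule. With all w_i positive, every exponent is reached from 0 by such moves. -/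
theorem IsMonomialFamily.mem {t Y : Rˣ} {w : Fin n → ℕ} {e : (Fin n → ℤ) → M}
    (he : IsMonomialFamily t Y D w e) (hw : ∀ i, 0 < w i) (W : Submodule R M)
    (hW : ∀ m ∈ W, D m ∈ W) (h0 : e 0 ∈ W) (a : Fin n → ℤ) : e a ∈ W := by
  have hC : ∀ (c : ℂ), ∀ m ∈ W, c • m ∈ W := fun c m hm => by
    rw [← algebraMap_smul R]
    exact W.smul_mem _ hm
  have hdown : ∀ a, e a ∈ W → e (fun i => a i - w i) ∈ W := by
    intro a ha
    have h := hW _ ha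
    rw [he.apply_eq] at h
    have h2 := W.smul_mem (↑(t * Y)⁻¹ : R) (W.neg_mem h)
    rwa [neg_neg, smul_smul, Units.inv_mul, one_smul] at h2
  have hup : ∀ a i, e a ∈ W → e (a + Pi.single i 1) ∈ W := by
    intro a i ha
    have h := W.sub_mem (hC (a i) _ ha) (hC (w i) _ (hW _ ha))
    rw [← he.smul_add_single] at h
    have h2 := W.smul_mem (↑t⁻¹ : R) h
    rwa [smul_smul, Units.inv_mul, one_smul] at h2
  obtain ⟨m, b, hab⟩ := exists_monomial_shift hw a
  have hm : ∀ m : ℕ, e (fun i => -(m * w i : ℤ)) ∈ W := by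
    intro m
    induction m with
    | zero =>
      have : (fun i => -(((0 : ℕ) : ℤ) * (w i : ℤ))) = 0 := by
        funext i
        simp
      rwa [this]
    | succ m ih =>
      have := hdown _ ih
      convert this using 2
      funext i
      push_cast
      ring
  have hb : ∀ b : Fin n → ℕ, e ((fun i => -(m * w i : ℤ)) + fun i => (b i : ℤ)) ∈ W := by
    intro b
    induction b using nat_fun_induction with
    | h0 =>
      convert hm m using 2
      funext i
      simp
    | h1 b i ih =>
      have := hup _ i ih
      convert this using 2
      funext j
      rcases eq_or_ne j i with rfl | hj
      · simp; ring
      · simp [hj]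
  convert hb b using 2
  funext i
  rw [hab, Pi.add_apply]
  ring

theorem IsConnection.isMonomialFamily_monomialSection (hD : IsConnection δ D) {t Y : Rˣ}
    (ht : δ t = 0) (hY : δ Y = Y) {w : Fin n → ℕ} (hw : ∀ i, 0 < w i) {e : M}
    (he : downOp t Y D (aeval D (hyperPoly w w) e) = (↑(t ^ (∑ i, w i)) : R) • e) :
    IsMonomialFamily t Y D w (monomialSection t Y D w e) where
  smul_add_single a i := hD.smul_monomialSection_add_single ht hY hw he a i
  apply_eq a := hD.apply_monomialSection ht hY hw he a

theorem monomialSection_zero (t Y : Rˣ) (w : Fin n → ℕ) (e : M) :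
    monomialSection t Y D w e 0 = e := by
  have h : (fun i => ((0 : Fin n → ℤ) i +
      ((∑ i, ((0 : Fin n → ℤ) i).natAbs : ℕ) : ℤ) * (w i : ℤ)).toNat) = 0 := by
    funext i
    simp
  rw [monomialSection, h, preMonomial]
  simp

/-! ### The companion connection on a free module -/

variable {μ : ℕ}

/-- The cyclic predecessor on `Fin μ`. -/
def cycPred (k : Fin μ) : Fin μ :=
  ⟨if k.1 = 0 then μ - 1 else k.1 - 1, by have := k.2; split_ifs <;> omega⟩

/-- The connection on `R^μ` with `D ε_k = v_k ε_k - τ ε_{k+1}` for `k + 1 < μ` and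
`D ε_{μ-1} = v_{μ-1} ε_{μ-1} - κ τ x ε_0`. -/
def companion (δ : Derivation ℂ R R) (v : ℕ → ℂ) (t Y : R) (κ : ℂ) (μ : ℕ) :
    Module.End ℂ (Fin μ → R) where
  toFun f k := δ (f k) + v k • f k - t * ((if k.1 = 0 then κ • Y else 1) * f (cycPred k))
  map_add' f g := by
    funext k
    simp only [Pi.add_apply, map_add, smul_add, mul_add]
    abel
  map_smul' c f := by
    funext k
    simp only [Pi.smul_apply, RingHom.id_apply, Derivation.map_smul, smul_add, smul_sub,
      smul_comm _ c, mul_smul_comm]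

theorem companion_apply (δ : Derivation ℂ R R) (v : ℕ → ℂ) (t Y : R) (κ : ℂ) (f : Fin μ → R)
    (k : Fin μ) : companion δ v t Y κ μ f k = δ (f k) + v k • f k -
      t * ((if k.1 = 0 then κ • Y else 1) * f (cycPred k)) := rfl

theorem isConnection_companion (δ : Derivation ℂ R R) (v : ℕ → ℂ) (t Y : R) (κ : ℂ) :
    IsConnection δ (companion δ v t Y κ μ) := by
  intro f m
  funext k
  simp only [companion_apply, Pi.add_apply, Pi.smul_apply, smul_eq_mul, Derivation.leibniz]
  rw [← mul_smul_comm]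
  ring

/-- The `k`-th standard vector of `R^μ`. -/
def stdVec (R : Type*) [CommRing R] (μ k : ℕ) : Fin μ → R := fun j => if j.1 = k then 1 else 0

theorem derivation_add_smul_stdVec (δ : Derivation ℂ R R) (v : ℕ → ℂ) (k : ℕ) (j : Fin μ) :
    δ (stdVec R μ k j) + v j • stdVec R μ k j = v k • stdVec R μ k j := by
  rw [stdVec]
  split_ifs with h
  · simp [h]
  · simp

theorem companion_stdVec_succ (δ : Derivation ℂ R R) (v : ℕ → ℂ) (t Y : R) (κ : ℂ) {k : ℕ}
    (hk : k + 1 < μ) : companion δ v t Y κ μ (stdVec R μ k) =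
      v k • stdVec R μ k - t • stdVec R μ (k + 1) := by
  funext j
  rw [companion_apply, derivation_add_smul_stdVec, Pi.sub_apply, Pi.smul_apply, Pi.smul_apply,
    smul_eq_mul]
  congr 2
  simp only [stdVec, cycPred]
  have := j.2
  split_ifs <;> first | omega | simp

theorem companion_stdVec_last (δ : Derivation ℂ R R) (v : ℕ → ℂ) (t Y : R) (κ : ℂ) {k : ℕ}
    (hk : k + 1 = μ) : companion δ v t Y κ μ (stdVec R μ k) =
      v k • stdVec R μ k - t • (κ • Y) • stdVec R μ 0 := by
  funext j
  rw [companion_apply, derivation_add_smul_stdVec, Pi.sub_apply, Pi.smul_apply, Pi.smul_apply,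
    Pi.smul_apply, smul_eq_mul, smul_eq_mul]
  congr 2
  simp only [stdVec, cycPred]
  have := j.2
  split_ifs <;> first | omega | simp

end Chain

/-! ### Leibniz rules on the Gauss–Manin system -/

section SystemLeibniz

variable {n : ℕ} {A : Type*} [CommRing A]

theorem coeffDerivation_smul {k S N : Type*} [CommRing k] [CommRing S] [Algebra k S]
    [AddCommMonoid N] (d : Derivation k S S) (c : S) (h : AddMonoidAlgebra S N) :
    coeffDerivation d (c • h) = d c • h + c • coeffDerivation d h := by
  induction h using AddMonoidAlgebra.induction_linear with
  | zero => simp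
  | add f g hf hg =>
    rw [smul_add, map_add, hf, hg, map_add, smul_add, smul_add]
    abel
  | single a s =>
    rw [AddMonoidAlgebra.smul_single, coeffDerivation_single, coeffDerivation_single,
      AddMonoidAlgebra.smul_single, AddMonoidAlgebra.smul_single, smul_eq_mul, Derivation.leibniz,
      ← AddMonoidAlgebra.single_add]
    simp only [smul_eq_mul]
    congr 1
    ring

theorem System.mk_surjective (w : Fin n → ℕ) (x : A) : Function.Surjective (System.mk w x) :=
  Submodule.mkQ_surjective _

/-- The class of the form `u^a ω₀`. -/
def monomialClass (w : Fin n → ℕ) (x : A) (a : Fin n → ℤ) : System w x :=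
  System.mk w x (AddMonoidAlgebra.single a 1)

theorem potential_mul_single (w : Fin n → ℕ) (x : A) (a : Fin n → ℤ) :
    potential w x * AddMonoidAlgebra.single a 1 =
      ∑ i, AddMonoidAlgebra.single (a + Pi.single i 1) 1 +
        LaurentPolynomial.C x • AddMonoidAlgebra.single (fun i => a i - w i) 1 := by
  rw [potential, add_mul, Finset.sum_mul, AddMonoidAlgebra.single_mul_single,
    AddMonoidAlgebra.smul_single]
  congr 1
  · refine Finset.sum_congr rfl fun i _ => ?_
    rw [AddMonoidAlgebra.single_mul_single, add_comm, one_mul]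
  · rw [mul_one, smul_eq_mul, mul_one]
    congr 1
    funext i
    simp only [Pi.add_apply]
    ring

theorem logU_potential (w : Fin n → ℕ) (x : A) (i : Fin n) :
    logU i (potential w x) = AddMonoidAlgebra.single (Pi.single i 1) 1 -
      AddMonoidAlgebra.single (fun i => -(w i : ℤ)) ((w i : A[T;T⁻¹]) * LaurentPolynomial.C x) := by
  rw [potential, map_add, map_sum, Finset.sum_eq_single i]
  · simp only [logU, weightDerivation_single, AddMonoidHom.comp_apply, Pi.evalAddMonoidHom_apply]
    rw [Pi.single_eq_same, sub_eq_add_neg, ← AddMonoidAlgebra.single_neg]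
    simp
  · intro j _ hj
    simp [logU, weightDerivation_single, Pi.single_eq_of_ne hj.symm]
  · simp

theorem logU_potential_mul_single (w : Fin n → ℕ) (x : A) (i : Fin n) (a : Fin n → ℤ)
    (c : A[T;T⁻¹]) :
    logU i (potential w x) * AddMonoidAlgebra.single a c =
      AddMonoidAlgebra.single (a + Pi.single i 1) c -
        AddMonoidAlgebra.single (fun i => a i - w i) ((w i : A[T;T⁻¹]) * LaurentPolynomial.C x * c) := by
  rw [logU_potential, sub_mul, AddMonoidAlgebra.single_mul_single,
    AddMonoidAlgebra.single_mul_single, one_mul, add_comm]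
  congr 2
  funext i
  simp only [Pi.add_apply]
  ring

theorem twistedDiff_single (w : Fin n → ℕ) (x : A) (i : Fin n) (a : Fin n → ℤ) (c : A[T;T⁻¹]) :
    twistedDiff w x (Pi.single i (AddMonoidAlgebra.single a c)) =
      AddMonoidAlgebra.single a ((a i : A[T;T⁻¹]) * c) -
        (LaurentPolynomial.T 1 : A[T;T⁻¹]) • (AddMonoidAlgebra.single (a + Pi.single i 1) c -
        AddMonoidAlgebra.single (fun i => a i - w i)
          ((w i : A[T;T⁻¹]) * LaurentPolynomial.C x * c)) := by
  rw [twistedDiff, LinearMap.coe_mk, AddHom.coe_mk, Finset.sum_eq_single i]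
  · rw [Pi.single_eq_same, logU_potential_mul_single]
    congr 1
    simp [logU, weightDerivation_single]
  · intro j _ hj
    simp [Pi.single_eq_of_ne hj]
  · simp

/-- This is the vanishing of the twisted differential of the (n−1)-form whose only component is u^a
in position i. -/
theorem smul_monomialClass_add_single (w : Fin n → ℕ) (x : A) (a : Fin n → ℤ) (i : Fin n) :
    (LaurentPolynomial.T 1 : A[T;T⁻¹]) • monomialClass w x (a + Pi.single i 1) =
      (a i : A[T;T⁻¹]) • monomialClass w x a + (w i : A[T;T⁻¹]) •
        (LaurentPolynomial.T 1 * LaurentPolynomial.C x : A[T;T⁻¹]) •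
          monomialClass w x fun i => a i - w i := by
  have h : System.mk w x (twistedDiff w x (Pi.single i (AddMonoidAlgebra.single a 1))) = 0 :=
    (Submodule.Quotient.mk_eq_zero _).2 ⟨_, rfl⟩
  rw [twistedDiff_single, smul_sub, map_sub, map_sub] at h
  have h1 : AddMonoidAlgebra.single a ((a i : A[T;T⁻¹]) * 1) =
      (a i : A[T;T⁻¹]) • (AddMonoidAlgebra.single a 1 : TorusFun A n) := by
    rw [AddMonoidAlgebra.smul_single, smul_eq_mul]
  have h2 : AddMonoidAlgebra.single (fun i => a i - w i)
      ((w i : A[T;T⁻¹]) * LaurentPolynomial.C x * 1) =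
      ((w i : A[T;T⁻¹]) * LaurentPolynomial.C x) •
        (AddMonoidAlgebra.single (fun i => a i - (w i : ℤ)) 1 : TorusFun A n) := by
    rw [AddMonoidAlgebra.smul_single, smul_eq_mul]
  rw [h1, h2, map_smul, map_smul, map_smul, map_smul, smul_smul] at h
  simp only [monomialClass, smul_smul]
  have h3 := eq_of_sub_eq_zero h
  rw [eq_sub_iff_add_eq] at h3
  rw [← h3]
  congr 2
  ring

theorem span_monomialClass (w : Fin n → ℕ) (x : A) :
    Submodule.span A[T;T⁻¹] (Set.range (monomialClass w x)) = ⊤ := by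
  rw [eq_top_iff]
  rintro m -
  obtain ⟨h, rfl⟩ := System.mk_surjective w x m
  induction h using AddMonoidAlgebra.induction_linear with
  | zero => simp
  | add f g hf hg => rw [map_add]; exact Submodule.add_mem _ hf hg
  | single a c =>
    have : (AddMonoidAlgebra.single a c : TorusFun A n) = c • AddMonoidAlgebra.single a 1 := by
      rw [AddMonoidAlgebra.smul_single, smul_eq_mul, mul_one]
    rw [this, map_smul]
    exact Submodule.smul_mem _ _ (Submodule.subset_span ⟨a, rfl⟩)

/-- A family of elements satisfying the relations between the classes of the monomials defines a
linear map on the Gauss–Manin system. -/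
theorem exists_system_lift {N : Type*} [AddCommGroup N] [Module A[T;T⁻¹] N] (w : Fin n → ℕ) (x : A)
    (φ : (Fin n → ℤ) → N)
    (hφ : ∀ a i, (LaurentPolynomial.T 1 : A[T;T⁻¹]) • φ (a + Pi.single i 1) =
      (a i : A[T;T⁻¹]) • φ a + (w i : A[T;T⁻¹]) •
        (LaurentPolynomial.T 1 * LaurentPolynomial.C x : A[T;T⁻¹]) • φ fun i => a i - w i) :
    ∃ Φ : System w x →ₗ[A[T;T⁻¹]] N, ∀ a, Φ (monomialClass w x a) = φ a := by
  let Ψ : TorusFun A n →ₗ[A[T;T⁻¹]] N :=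
    Finsupp.linearCombination A[T;T⁻¹] φ ∘ₗ
      (AddMonoidAlgebra.coeffLinearEquiv (S := A[T;T⁻¹]) (M := Fin n → ℤ) A[T;T⁻¹]).toLinearMap
  have hΨ : ∀ a c, Ψ (AddMonoidAlgebra.single a c) = c • φ a := by
    intro a c
    change Finsupp.linearCombination A[T;T⁻¹] φ (Finsupp.single a c) = _
    rw [Finsupp.linearCombination_single]
  have hker : LinearMap.range (twistedDiff w x) ≤ LinearMap.ker Ψ := by
    rintro _ ⟨g, rfl⟩
    -- By additivity it suffices to treat families with a single component, and then single
    -- monomials c u^a, where the claim is c times the relation `hφ`.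
    rw [← Finset.univ_sum_single g, map_sum]
    refine Submodule.sum_mem _ fun i _ => ?_
    rw [LinearMap.mem_ker]
    generalize g i = h
    induction h using AddMonoidAlgebra.induction_linear with
    | zero => simp
    | add f g hf hg => rw [Pi.single_add, map_add, map_add, hf, hg, add_zero]
    | single a c =>
      rw [twistedDiff_single, map_sub, map_smul, map_sub, hΨ, hΨ, hΨ, smul_sub, sub_eq_zero,
        smul_comm (LaurentPolynomial.T 1) c, hφ, mul_comm, mul_smul, smul_add, smul_smul, smul_smul,
        smul_smul, smul_smul, eq_sub_iff_add_eq]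
      congr 2
      ring
  exact ⟨(LinearMap.range (twistedDiff w x)).liftQ Ψ hker, fun a => by
    rw [← one_smul A[T;T⁻¹] (φ a), ← hΨ]; rfl⟩

variable [Algebra ℂ A]

theorem nablaX_smul (w : Fin n → ℕ) (x : A) (d : Derivation ℂ A A) (f : A[T;T⁻¹])
    (m : System w x) :
    nablaX w x d (f • m) = coeffDerivation d f • m + f • nablaX w x d m := by
  obtain ⟨h, rfl⟩ := System.mk_surjective w x m
  rw [← map_smul, nablaX_mk, nablaX_mk, ← map_smul, ← map_smul, ← map_add]
  congr 1
  simp only [preNablaX, LinearMap.coe_mk, AddHom.coe_mk, funX, coeffDerivation_smul, smul_sub,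
    mul_smul_comm, smul_comm f]
  abel

theorem nablaTau_smul (w : Fin n → ℕ) (x : A) (f : A[T;T⁻¹]) (m : System w x) :
    nablaTau w x (f • m) = derivTau f • m + f • nablaTau w x m := by
  obtain ⟨h, rfl⟩ := System.mk_surjective w x m
  rw [← map_smul, nablaTau_mk, nablaTau_mk, ← map_smul, ← map_smul, ← map_add]
  congr 1
  simp only [preNablaTau, LinearMap.coe_mk, AddHom.coe_mk, funTau, coeffDerivation_smul, smul_sub,
    mul_smul_comm]
  abel

theorem nablaTau_monomialClass (w : Fin n → ℕ) (x : A) (a : Fin n → ℤ) :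
    nablaTau w x (monomialClass w x a) = -(∑ i, monomialClass w x (a + Pi.single i 1) +
      (LaurentPolynomial.C x : A[T;T⁻¹]) • monomialClass w x fun i => a i - w i) := by
  rw [monomialClass, nablaTau_mk]
  simp only [preNablaTau, LinearMap.coe_mk, AddHom.coe_mk, potential_mul_single, funTau,
    coeffDerivation_single, Derivation.map_one_eq_zero, AddMonoidAlgebra.single_zero, zero_sub,
    map_neg, map_add, map_sum, map_smul]
  rfl

theorem nablaX_monomialClass (w : Fin n → ℕ) (x : A) (d : Derivation ℂ A A) (hd : d x = 1)
    (a : Fin n → ℤ) :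
    nablaX w x d (monomialClass w x a) =
      -((LaurentPolynomial.T 1 : A[T;T⁻¹]) • monomialClass w x fun i => a i - w i) := by
  have h : funX d (potential w x) = AddMonoidAlgebra.single (fun i => -(w i : ℤ)) 1 := by
    rw [potential, map_add, map_sum, funX, coeffDerivation_single, ← LaurentPolynomial.single_eq_C,
      coeffDerivation_single, hd]
    simp [coeffDerivation_single]
  have h2 : (fun i => -(w i : ℤ)) + a = fun i => a i - w i := by
    funext i
    simp only [Pi.add_apply]
    ring
  rw [monomialClass, nablaX_mk]
  simp only [preNablaX, LinearMap.coe_mk, AddHom.coe_mk, h]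
  rw [funX, coeffDerivation_single, Derivation.map_one_eq_zero, AddMonoidAlgebra.single_zero,
    zero_sub, map_neg, map_smul, AddMonoidAlgebra.single_mul_single, one_mul, h2]
  rfl

end SystemLeibniz

/-! ### The spectral numbers -/

section Spectrum

variable {n : ℕ} (w : Fin n → ℕ)

theorem mu_pos : 0 < mu w := by
  rw [mu]
  omega

theorem specMultiset_eq : specMultiset w = ∑ i : Fin (n + 1), (Multiset.range (allWeights w i)).map
    fun l : ℕ => (l * mu w : ℚ) / allWeights w i := by
  simp [specMultiset, Multiset.bind_def, Multiset.pure_def, Multiset.bind_singleton]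

theorem card_specMultiset : (specMultiset w).card = mu w := by
  simp [specMultiset_eq, allWeights, mu, Fin.sum_univ_succ, add_comm]

theorem length_sort_specMultiset : (specMultiset w).sort.length = mu w := by
  rw [Multiset.length_sort, card_specMultiset]

theorem mem_specMultiset_of_lt {k : ℕ} (hk : k < mu w) : spec w k ∈ specMultiset w := by
  rw [spec, List.getD_eq_getElem _ _ (by rwa [length_sort_specMultiset]), ← Multiset.mem_sort (· ≤ ·)]
  exact List.getElem_mem _

theorem spec_mono {j k : ℕ} (hjk : j ≤ k) (hk : k < mu w) : spec w j ≤ spec w k := by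
  have hk' : k < (specMultiset w).sort.length := by rwa [length_sort_specMultiset]
  rw [spec, spec, List.getD_eq_getElem _ _ hk', List.getD_eq_getElem _ _ (hjk.trans_lt hk')]
  exact (List.sortedLE_iff_pairwise.2 (Multiset.pairwise_sort _ _)).getElem_le_getElem_of_le hjk

theorem spec_nonneg {k : ℕ} (hk : k < mu w) : 0 ≤ spec w k := by
  have h := mem_specMultiset_of_lt w hk
  simp only [specMultiset_eq, Multiset.mem_sum, Multiset.mem_map] at h
  obtain ⟨i, -, l, -, h⟩ := h
  rw [← h]
  positivity

theorem spec_lt {k : ℕ} (hk : k < mu w) : spec w k < mu w := by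
  have h := mem_specMultiset_of_lt w hk
  simp only [specMultiset_eq, Multiset.mem_sum, Multiset.mem_map, Multiset.mem_range] at h
  obtain ⟨i, -, l, hl, h⟩ := h
  have h0 : (0 : ℚ) < allWeights w i := by exact_mod_cast (Nat.zero_le l).trans_lt hl
  have h1 : (0 : ℚ) < mu w := by exact_mod_cast mu_pos w
  have h2 : (l : ℚ) < allWeights w i := by exact_mod_cast hl
  rw [← h, div_lt_iff₀ h0, mul_comm]
  gcongr

theorem weight_mono {j k : ℕ} (hjk : j ≤ k) (hk : k < mu w) : weight w j ≤ weight w k := by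
  rw [weight, weight, Rat.cast_le]
  have := spec_mono w hjk hk
  gcongr

theorem weight_nonneg {k : ℕ} (hk : k < mu w) : 0 ≤ weight w k := by
  have := spec_nonneg w hk
  rw [weight, Rat.cast_nonneg]
  positivity

theorem weight_lt_one {k : ℕ} (hk : k < mu w) : weight w k < 1 := by
  have h1 : (0 : ℚ) < mu w := by exact_mod_cast mu_pos w
  rw [weight, ← Rat.cast_one, Rat.cast_lt, div_lt_one h1]
  exact spec_lt w hk

theorem weight_eq_iff {j k : ℕ} : weight w j = weight w k ↔ spec w j = spec w k := by
  have h1 : (mu w : ℚ) ≠ 0 := by exact_mod_cast (mu_pos w).ne'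
  rw [weight, weight, Rat.cast_inj, div_left_inj' h1]

theorem prod_range_getD {α N : Type*} [CommMonoid N] (f : α → N) (d : α) (L : List α) :
    ∏ j ∈ Finset.range L.length, f (L.getD j d) = (L.map f).prod := by
  induction L with
  | nil => simp
  | cons a L ih => rw [List.length_cons, Finset.prod_range_succ', List.map_cons, List.prod_cons,
      ← ih, mul_comm]; simp

-- After division by μ the spectral numbers become the fractions l/w_i with l < w_i. The weight w_0
-- = 1 gives the factor X. For the others, distributing w_i^{w_i} over the w_i linear factors turns
-- each X − l/w_i into w_i X − l, that is, −(l − w_i X).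
open Polynomial in
theorem prod_X_sub_C_spec (hw : ∀ i, 0 < w i) :
    C (∏ i, (w i : ℂ) ^ w i) * ∏ j ∈ Finset.range (1 + ∑ i, w i), (X - C ((weight w j : ℝ) : ℂ)) =
      X * ((-1) ^ (∑ i, w i) * hyperPoly w w) := by
  have hmu : (mu w : ℂ) ≠ 0 := by exact_mod_cast (mu_pos w).ne'
  have h1 : ∏ j ∈ Finset.range (1 + ∑ i, w i), (X - C ((weight w j : ℝ) : ℂ)) =
      ((specMultiset w).map fun s => (X - C (((s / mu w : ℚ) : ℝ) : ℂ))).prod := by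
    have := prod_range_getD (fun s : ℚ => (X - C (((s / mu w : ℚ) : ℝ) : ℂ))) 0
      (specMultiset w).sort
    rw [length_sort_specMultiset] at this
    conv_rhs => rw [← Multiset.sort_eq (specMultiset w) (· ≤ ·)]
    exact this
  rw [h1, specMultiset_eq, ← Multiset.coe_mapAddMonoidHom, map_sum, Multiset.prod_sum, Fin.prod_univ_succ, mul_left_comm]
  congr 1
  · simp [allWeights]
  · rw [map_prod, ← Finset.prod_mul_distrib, hyperPoly, ← Finset.prod_pow_eq_pow_sum,
      ← Finset.prod_mul_distrib]
    refine Finset.prod_congr rfl fun i _ => ?_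
    have hwi : (w i : ℂ) ≠ 0 := by exact_mod_cast (hw i).ne'
    rw [fallPoly, Multiset.coe_mapAddMonoidHom, Multiset.map_map, ← Finset.range_val]
    change _ * ∏ l ∈ Finset.range (w i), (X - _) = _
    rw [map_pow, ← Finset.card_range (w i), ← Finset.prod_const, ← Finset.prod_const,
      Finset.card_range, ← Finset.prod_mul_distrib, ← Finset.prod_mul_distrib]
    refine Finset.prod_congr rfl fun l _ => ?_
    have h2 : ((((l * mu w : ℚ) / allWeights w i.succ / mu w : ℚ) : ℝ) : ℂ) = l / w i := by
      simp only [allWeights, Fin.cons_succ]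
      push_cast
      field_simp
    rw [h2, mul_sub, ← C_mul, mul_div_cancel₀ _ hwi]
    ring

end Spectrum

/-! ### The connection on the germ of the Gauss–Manin system -/

section Germ

theorem xPow_mul (p q : ℤ) : xPow p * xPow q = xPow (p + q) :=
  Subtype.ext ((HahnSeries.single_mul_single (Γ := ℤ)).trans (by rw [mul_one]; rfl))

theorem xPow_zero : xPow 0 = 1 := Subtype.ext rfl

theorem derivK_xPow_one : derivK (xPow 1) = 1 := by
  apply Subtype.ext
  change LaurentSeries.derivative ℂ (HahnSeries.single 1 1) = (1 : ℂ⸨X⸩)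
  ext m
  rw [coeff_derivative, HahnSeries.coeff_single, HahnSeries.coeff_one]
  rcases eq_or_ne m 0 with rfl | h
  · simp
  · rw [if_neg (by omega), if_neg h, mul_zero]

/-- `τ` as a unit. -/
def tauU : LamKˣ where
  val := LaurentPolynomial.T 1
  inv := LaurentPolynomial.T (-1)
  val_inv := by rw [← LaurentPolynomial.T_add]; simp
  inv_val := by rw [← LaurentPolynomial.T_add]; simp

/-- `x` as a unit. -/
def xU : LamKˣ where
  val := LaurentPolynomial.C (xPow 1)
  inv := LaurentPolynomial.C (xPow (-1))
  val_inv := by rw [← map_mul, xPow_mul]; exact map_one _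
  inv_val := by rw [← map_mul, xPow_mul]; exact map_one _

/-- The derivation `x ∂/∂x` of `ℂ{x}[x⁻¹][τ, τ⁻¹]`. -/
def eulerX : Derivation ℂ LamK LamK := (LaurentPolynomial.C (xPow 1) : LamK) • coeffDerivation derivK

/-- The derivation `τ ∂/∂τ` of `ℂ{x}[x⁻¹][τ, τ⁻¹]`. -/
def eulerTau : Derivation ℂ LamK LamK := (LaurentPolynomial.T 1 : LamK) • derivTau

theorem eulerX_single (k : ℤ) (f : ConvK) :
    eulerX (AddMonoidAlgebra.single k f : LamK) = AddMonoidAlgebra.single k (xPow 1 * derivK f) := by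
  rw [eulerX, Derivation.smul_apply, coeffDerivation_single, smul_eq_mul,
    ← LaurentPolynomial.single_eq_C, AddMonoidAlgebra.single_mul_single, zero_add]

theorem eulerTau_single (k : ℤ) (f : ConvK) :
    eulerTau (AddMonoidAlgebra.single k f : LamK) = AddMonoidAlgebra.single k ((k : ConvK) * f) := by
  rw [eulerTau, derivTau, Derivation.smul_apply, Derivation.smul_apply, smul_smul,
    ← LaurentPolynomial.T_add, Derivation.restrictScalars_apply, weightDerivation_single]
  simp

theorem eulerX_tau : eulerX tauU = 0 := by
  change eulerX (AddMonoidAlgebra.single 1 1 : LamK) = 0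
  rw [eulerX_single, Derivation.map_one_eq_zero, mul_zero, AddMonoidAlgebra.single_zero]

theorem eulerX_x : eulerX xU = xU := by
  change eulerX (AddMonoidAlgebra.single 0 (xPow 1) : LamK) = AddMonoidAlgebra.single 0 (xPow 1)
  rw [eulerX_single, derivK_xPow_one, mul_one]

theorem eulerTau_tau : eulerTau tauU = tauU := by
  change eulerTau (AddMonoidAlgebra.single 1 1 : LamK) = AddMonoidAlgebra.single 1 1
  rw [eulerTau_single, Int.cast_one, mul_one]

theorem eulerTau_x : eulerTau xU = 0 := by
  change eulerTau (AddMonoidAlgebra.single 0 (xPow 1) : LamK) = 0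
  rw [eulerTau_single, Int.cast_zero, zero_mul, AddMonoidAlgebra.single_zero]

theorem eulerTau_eulerX (f : LamK) : eulerTau (eulerX f) = eulerX (eulerTau f) := by
  induction f using AddMonoidAlgebra.induction_linear with
  | zero => simp
  | add f g hf hg => simp [hf, hg]
  | single k f =>
    rw [eulerX_single, eulerTau_single, eulerTau_single, eulerX_single, Derivation.leibniz,
      Derivation.map_intCast]
    simp only [smul_eq_mul, mul_zero, add_zero]
    congr 1
    ring

variable {n : ℕ} (w : Fin n → ℕ)

/-- The operator `x ∇_{∂/∂x}`. -/
def xNabla : Module.End ℂ (G w) :=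
  Algebra.lsmul ℂ ℂ (G w) (LaurentPolynomial.C (xPow 1) : LamK) * gNablaX w

/-- The operator `τ ∇_{∂/∂τ}`. -/
def tauNabla : Module.End ℂ (G w) :=
  Algebra.lsmul ℂ ℂ (G w) (LaurentPolynomial.T 1 : LamK) * gNablaTau w

theorem xNabla_apply (m : G w) :
    xNabla w m = (LaurentPolynomial.C (xPow 1) : LamK) • gNablaX w m := rfl

theorem tauNabla_apply (m : G w) :
    tauNabla w m = (LaurentPolynomial.T 1 : LamK) • gNablaTau w m := rfl

theorem xLam_smul_gNablaX (m : G w) : xLam • gNablaX w m = xNabla w m := by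
  rw [xNabla_apply]
  change (algebraMap LamO LamK xLam) • gNablaX w m = _
  congr 1
  rw [xLam, ← LaurentPolynomial.single_eq_C]
  change AddMonoidAlgebra.mapRingHom ℤ _ (AddMonoidAlgebra.single 0 xO) = _
  rw [AddMonoidAlgebra.mapRingHom_single, LaurentPolynomial.single_eq_C]
  congr 1
  exact Subtype.ext (HahnSeries.ofPowerSeries_X ..)

theorem isConnection_xNabla : IsConnection eulerX (xNabla w) := by
  intro f m
  rw [xNabla_apply, xNabla_apply, gNablaX, nablaX_smul, smul_add, smul_smul, eulerX,
    Derivation.smul_apply, smul_eq_mul, smul_comm f]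

theorem isConnection_tauNabla : IsConnection eulerTau (tauNabla w) := by
  intro f m
  rw [tauNabla_apply, tauNabla_apply, gNablaTau, nablaTau_smul, smul_add, smul_smul, eulerTau,
    Derivation.smul_apply, smul_eq_mul, smul_comm f]

theorem natCast_smul_eq (k : ℕ) (m : G w) : (k : LamK) • m = (k : ℂ) • m := by
  rw [← algebraMap_smul LamK (k : ℂ) m, map_natCast]

theorem intCast_smul_eq (k : ℤ) (m : G w) : (k : LamK) • m = (k : ℂ) • m := by
  rw [← algebraMap_smul LamK (k : ℂ) m, map_intCast]

theorem isMonomialFamily_monomialClass :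
    IsMonomialFamily tauU xU (xNabla w) w (monomialClass w (xPow 1)) := by
  have h : ∀ a, xNabla w (monomialClass w (xPow 1) a) =
      -((↑(tauU * xU) : LamK) • monomialClass w (xPow 1) fun i => a i - w i) := by
    intro a
    rw [xNabla_apply, gNablaX, nablaX_monomialClass w _ _ derivK_xPow_one, smul_neg, smul_smul,
      mul_comm]
    rfl
  refine ⟨fun a i => ?_, h⟩
  rw [h, smul_neg, sub_neg_eq_add, ← intCast_smul_eq, ← natCast_smul_eq]
  exact smul_monomialClass_add_single w (xPow 1) a i

/-- A homogeneity relation: in −τF u^a each term τ u_i u^a is rewritten by the i-th relation, and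
the last term contributes D itself, so the coefficient of D is Σ w_i + 1 = μ. -/
theorem tauNabla_monomialClass (a : Fin n → ℤ) : tauNabla w (monomialClass w (xPow 1) a) =
    (mu w : ℂ) • xNabla w (monomialClass w (xPow 1) a) -
      ((∑ i, a i : ℤ) : ℂ) • monomialClass w (xPow 1) a := by
  have h := (isMonomialFamily_monomialClass w).smul_add_single a
  have h2 := (isMonomialFamily_monomialClass w).apply_eq a
  rw [tauNabla_apply, gNablaTau, nablaTau_monomialClass, smul_neg, smul_add, Finset.smul_sum]
  have h3 : ∀ i ∈ Finset.univ, (LaurentPolynomial.T 1 : LamK) •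
      monomialClass w (xPow 1) (a + Pi.single i 1) =
      (a i : ℂ) • monomialClass w (xPow 1) a -
        (w i : ℂ) • xNabla w (monomialClass w (xPow 1) a) := fun i _ => h i
  have h4 : (LaurentPolynomial.T 1 : LamK) • (LaurentPolynomial.C (xPow 1) : LamK) •
      (monomialClass w (xPow 1) fun i => a i - w i) =
      -xNabla w (monomialClass w (xPow 1) a) := by
    rw [h2, neg_neg, smul_smul]
    rfl
  rw [Finset.sum_congr rfl h3, h4, Finset.sum_sub_distrib, ← Finset.sum_smul, ← Finset.sum_smul, mu]
  push_cast
  module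

/-- Flatness of the connection. The Leibniz rules reduce it to monomial classes, where both sides
follow from the homogeneity relation. -/
theorem tauNabla_xNabla (m : G w) : tauNabla w (xNabla w m) = xNabla w (tauNabla w m) := by
  have hm : m ∈ Submodule.span LamK (Set.range (monomialClass w (xPow 1))) := by
    rw [span_monomialClass]
    trivial
  induction hm using Submodule.span_induction with
  | zero => simp
  | add a b _ _ ha hb => simp [ha, hb]
  | smul f m _ h =>
    rw [isConnection_xNabla w f m, isConnection_tauNabla w f m, map_add, map_add,
      isConnection_xNabla w, isConnection_xNabla w, isConnection_tauNabla w, isConnection_tauNabla w,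
      h, eulerTau_eulerX]
    abel
  | mem m hm =>
    obtain ⟨a, rfl⟩ := hm
    have h2 := (isMonomialFamily_monomialClass w).apply_eq a
    have hx : eulerX (↑(tauU * xU) : LamK) = ↑(tauU * xU) := by
      rw [Units.val_mul, Derivation.leibniz, eulerX_tau, eulerX_x, smul_zero, add_zero]
      rfl
    have ht : eulerTau (↑(tauU * xU) : LamK) = ↑(tauU * xU) := by
      rw [Units.val_mul, Derivation.leibniz, eulerTau_tau, eulerTau_x, smul_zero, zero_add, mul_comm]
      rfl
    -- The drop μ − 1 in total degree is compensated by the factor τx: it contributes 1 under τ∂_τ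
    -- and μ under μ x∂_x.
    have hs : (∑ i, (a i - (w i : ℤ)) : ℤ) = ∑ i, a i + 1 - mu w := by
      rw [mu, Finset.sum_sub_distrib]
      push_cast
      ring
    rw [tauNabla_monomialClass, map_sub, map_smul, map_smul, h2, map_neg, map_neg,
      isConnection_xNabla w, isConnection_tauNabla w, tauNabla_monomialClass, hs, hx, ht]
    push_cast
    rw [smul_sub, smul_comm _ (mu w : ℂ), smul_comm _ ((_ : ℂ) - _)]
    module

end Germ

/-! ### The basis `ω_k` of the germ of the Gauss–Manin system -/

section OmegaBasis

variable {n : ℕ} (w : Fin n → ℕ)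

theorem omegaPhi_zero : omegaPhi w 0 = monomialClass w (xPow 1) 0 := rfl

theorem omegaPhi_succ (k : ℕ) : omegaPhi w (k + 1) = (↑tauU⁻¹ : LamK) •
    (-(1 / (mu w : ℂ))) • (tauNabla w (omegaPhi w k) + ((alphaInf w k : ℚ) : ℂ) • omegaPhi w k) := rfl

theorem weight_complex (k : ℕ) : ((weight w k : ℝ) : ℂ) = (spec w k : ℂ) / mu w := by
  rw [weight]
  push_cast
  rfl

/-- The first identity is what gives α_k = k − s_k its meaning: substituted into the recursion, it
cancels k and leaves D − s_k/μ. It propagates from k to k+1 because the two operators commute and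
the factor τ⁻¹ is an eigenvector of τ∂_τ with eigenvalue −1. -/
theorem omegaPhi_spec (k : ℕ) :
    tauNabla w (omegaPhi w k) = (mu w : ℂ) • xNabla w (omegaPhi w k) - (k : ℂ) • omegaPhi w k ∧
      omegaPhi w (k + 1) = -((↑tauU⁻¹ : LamK) •
        (xNabla w (omegaPhi w k) - ((weight w k : ℝ) : ℂ) • omegaPhi w k)) := by
  have hmu : (mu w : ℂ) ≠ 0 := by exact_mod_cast (mu_pos w).ne'
  have step : ∀ k, tauNabla w (omegaPhi w k) =
      (mu w : ℂ) • xNabla w (omegaPhi w k) - (k : ℂ) • omegaPhi w k →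
      omegaPhi w (k + 1) = -((↑tauU⁻¹ : LamK) •
        (xNabla w (omegaPhi w k) - ((weight w k : ℝ) : ℂ) • omegaPhi w k)) := by
    intro k h
    rw [omegaPhi_succ, h, weight_complex, alphaInf, ← smul_neg]
    congr 1
    push_cast
    match_scalars
    · field_simp
    · field_simp
      ring
  suffices h : tauNabla w (omegaPhi w k) =
      (mu w : ℂ) • xNabla w (omegaPhi w k) - (k : ℂ) • omegaPhi w k from ⟨h, step k h⟩
  induction k with
  | zero =>
    rw [omegaPhi_zero, tauNabla_monomialClass]
    simp
  | succ k ih =>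
    have ht : eulerTau (↑tauU⁻¹ : LamK) = -(↑tauU⁻¹ : LamK) :=
      IsConnection.derivation_inv tauU eulerTau_tau
    have hx : eulerX (↑tauU⁻¹ : LamK) = 0 := derivation_unit_inv_eq_zero tauU eulerX_tau
    rw [step k ih, map_neg, map_neg, isConnection_tauNabla w, isConnection_xNabla w, ht, hx, map_sub,
      map_sub, map_smul, map_smul, tauNabla_xNabla, ih, map_sub, map_smul, map_smul, zero_smul,
      zero_add]
    generalize xNabla w (omegaPhi w k) = y
    generalize xNabla w y = z
    generalize omegaPhi w k = u
    simp only [smul_sub, smul_comm (↑tauU⁻¹ : LamK) (_ : ℂ), neg_smul]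
    push_cast
    module

theorem xNabla_omegaPhi (k : ℕ) : xNabla w (omegaPhi w k) =
    ((weight w k : ℝ) : ℂ) • omegaPhi w k - (tauU : LamK) • omegaPhi w (k + 1) := by
  rw [(omegaPhi_spec w k).2, smul_neg, smul_smul, Units.mul_inv, one_smul]
  abel

/-- `∏ wᵢ^{wᵢ}`. -/
def weightConst : ℂ := ∏ i, (w i : ℂ) ^ w i

theorem weightConst_ne_zero (hw : ∀ i, 0 < w i) : weightConst w ≠ 0 :=
  Finset.prod_ne_zero_iff.2 fun i _ => pow_ne_zero _ (by exact_mod_cast (hw i).ne')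

/-- The chain closes up after μ steps, because ω_0 = e(0) solves the hypergeometric equation. -/
theorem weightConst_smul_omegaPhi_mu (hw : ∀ i, 0 < w i) :
    weightConst w • omegaPhi w (mu w) = (xU : LamK) • omegaPhi w 0 :=
  ((isConnection_xNabla w).chain_wrap_iff eulerX_tau (prod_X_sub_C_spec w hw)
    (fun k _ => xNabla_omegaPhi w k)).2
    ((isMonomialFamily_monomialClass w).downOp_hyperPoly (isConnection_xNabla w) eulerX_tau)

/-- The matrix form of `x ∇_{∂/∂x}` in the basis `ω_k`. -/
abbrev modelX : Module.End ℂ (Fin (mu w) → LamK) :=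
  companion eulerX (fun k => ((weight w k : ℝ) : ℂ)) (tauU : LamK) xU (weightConst w)⁻¹ (mu w)

theorem downOp_modelX (hw : ∀ i, 0 < w i) :
    downOp tauU xU (modelX w) (Polynomial.aeval (modelX w) (hyperPoly w w) (stdVec LamK (mu w) 0)) =
      (↑(tauU ^ (∑ i, w i)) : LamK) • stdVec LamK (mu w) 0 := by
  -- The chain must have a term at index μ; it is set to the value forced by the last column of the
  -- companion matrix.
  let ω : ℕ → (Fin (mu w) → LamK) := fun k =>
    if k < mu w then stdVec LamK (mu w) k else ((weightConst w)⁻¹ • (xU : LamK)) • stdVec LamK (mu w) 0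
  have h0 : ω 0 = stdVec LamK (mu w) 0 := if_pos (mu_pos w)
  have hmu : ω (1 + ∑ i, w i) = ((weightConst w)⁻¹ • (xU : LamK)) • stdVec LamK (mu w) 0 :=
    if_neg (by rw [mu]; omega)
  rw [← h0]
  refine ((isConnection_companion _ _ _ _ _).chain_wrap_iff eulerX_tau (prod_X_sub_C_spec w hw)
    (ω := ω) ?_).1 ?_
  · intro k hk
    have hk' : ω k = stdVec LamK (mu w) k := if_pos hk
    rw [hk']
    rcases Nat.lt_or_ge (k + 1) (mu w) with h | h
    · rw [show ω (k + 1) = stdVec LamK (mu w) (k + 1) from if_pos h, companion_stdVec_succ _ _ _ _ _ h]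
    · rw [show ω (k + 1) = _ from if_neg (not_lt.2 h),
        companion_stdVec_last _ _ _ _ _ (show k + 1 = mu w by rw [mu] at h ⊢; omega)]
  · rw [hmu, h0, smul_assoc]
    exact smul_inv_smul₀ (weightConst_ne_zero w hw) _

/-- This is what yields linear independence of the ω_k. The monomial sections generated by the first
standard vector of the model satisfy the relations of the e(a), so G maps to the model compatibly
with D; following the chain from ω_0 then determines the image of every ω_k. -/
theorem exists_coordMap (hw : ∀ i, 0 < w i) : ∃ Φ : G w →ₗ[LamK] (Fin (mu w) → LamK),
    (∀ m, Φ (xNabla w m) = modelX w (Φ m)) ∧ ∀ k < mu w, Φ (omegaPhi w k) = stdVec LamK (mu w) k := by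
  have hfam : IsMonomialFamily tauU xU (modelX w) w
      (monomialSection tauU xU (modelX w) w (stdVec LamK (mu w) 0)) :=
    (isConnection_companion _ _ _ _ _).isMonomialFamily_monomialSection eulerX_tau eulerX_x hw
      (downOp_modelX w hw)
  obtain ⟨Φ, hΦ⟩ := exists_system_lift w (xPow 1)
    (monomialSection tauU xU (modelX w) w (stdVec LamK (mu w) 0)) (fun a i => by
      have h := hfam.smul_add_single a i
      rw [hfam.apply_eq, smul_neg, sub_neg_eq_add] at h
      refine h.trans ?_
      rw [← algebraMap_smul LamK (a i : ℂ), ← algebraMap_smul LamK (w i : ℂ), map_intCast,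
        map_natCast]
      rfl)
  have hx : ∀ m, Φ (xNabla w m) = modelX w (Φ m) := by
    intro m
    have hm : m ∈ Submodule.span LamK (Set.range (monomialClass w (xPow 1))) := by
      rw [span_monomialClass]
      trivial
    induction hm using Submodule.span_induction with
    | zero => simp
    | add a b _ _ ha hb => rw [map_add, map_add, ha, hb, map_add, map_add]
    | smul f m _ h =>
      rw [isConnection_xNabla w f m, map_add, map_smul, map_smul, map_smul,
        isConnection_companion, h]
    | mem m hm =>
      obtain ⟨a, rfl⟩ := hm
      rw [(isMonomialFamily_monomialClass w).apply_eq, map_neg, map_smul, hΦ, hΦ, hfam.apply_eq]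
  refine ⟨Φ, hx, fun k => ?_⟩
  induction k with
  | zero => rw [omegaPhi_zero, hΦ, monomialSection_zero]; exact fun _ => rfl
  | succ k ih =>
    intro hk
    rw [(omegaPhi_spec w k).2, map_neg, map_smul, map_sub, hx, ih (by omega),
      companion_stdVec_succ _ _ _ _ _ hk]
    have h : Φ (((weight w k : ℝ) : ℂ) • omegaPhi w k) =
        ((weight w k : ℝ) : ℂ) • stdVec LamK (mu w) k := by
      rw [← algebraMap_smul LamK, map_smul, ih (by omega), algebraMap_smul]
    rw [h, sub_sub_cancel_left, smul_neg, neg_neg, smul_smul, Units.inv_mul, one_smul]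

/-- The span is D-stable because ω_μ, which appears in D ω_{μ−1}, is a multiple of x ω_0. Containing
e(0), it contains every monomial class. -/
theorem span_omegaPhi (hw : ∀ i, 0 < w i) :
    Submodule.span LamK (Set.range fun k : Fin (mu w) => omegaPhi w k) = ⊤ := by
  set W := Submodule.span LamK (Set.range fun k : Fin (mu w) => omegaPhi w k) with hW
  have h0 : ∀ k < mu w, omegaPhi w k ∈ W := fun k hk => Submodule.subset_span ⟨⟨k, hk⟩, rfl⟩
  have h1 : ∀ k ≤ mu w, omegaPhi w k ∈ W := by
    intro k hk
    rcases hk.lt_or_eq with h | rfl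
    · exact h0 k h
    · have h2 : omegaPhi w (mu w) = (algebraMap ℂ LamK (weightConst w)⁻¹) • (xU : LamK) •
          omegaPhi w 0 := by
        rw [← weightConst_smul_omegaPhi_mu w hw, algebraMap_smul,
          inv_smul_smul₀ (weightConst_ne_zero w hw)]
      rw [h2]
      exact W.smul_mem _ (W.smul_mem _ (h0 0 (mu_pos w)))
  have hD : ∀ m ∈ W, xNabla w m ∈ W := by
    intro m hm
    induction hm using Submodule.span_induction with
    | zero => simp
    | add a b _ _ ha hb => rw [map_add]; exact W.add_mem ha hb
    | smul f m hm h =>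
      rw [isConnection_xNabla w f m]
      exact W.add_mem (W.smul_mem _ hm) (W.smul_mem _ h)
    | mem m hm =>
      obtain ⟨k, rfl⟩ := hm
      simp only
      rw [xNabla_omegaPhi, ← algebraMap_smul LamK]
      exact W.sub_mem (W.smul_mem _ (h0 _ k.2)) (W.smul_mem _ (h1 _ k.2))
  rw [eq_top_iff, ← span_monomialClass, Submodule.span_le]
  rintro _ ⟨a, rfl⟩
  exact (isMonomialFamily_monomialClass w).mem hw W hD (h0 0 (mu_pos w)) a

/-- The coordinates in the basis `ω_k`, together with the matrices of the connection. -/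
theorem exists_coordEquiv (hw : ∀ i, 0 < w i) : ∃ Φ : G w ≃ₗ[LamK] (Fin (mu w) → LamK),
    (∀ k < mu w, Φ (omegaPhi w k) = stdVec LamK (mu w) k) ∧
    (∀ m, Φ (xNabla w m) = modelX w (Φ m)) ∧
    ∀ m k, Φ (tauNabla w m) k = (mu w : ℂ) • Φ (xNabla w m) k +
      (eulerTau (Φ m k) - (mu w : ℂ) • eulerX (Φ m k)) - ((k : ℕ) : ℂ) • Φ m k := by
  obtain ⟨Φ, hx, hΦ⟩ := exists_coordMap w hw
  have hm : ∀ m : G w, ∃ f : Fin (mu w) → LamK, m = ∑ k, f k • omegaPhi w k := by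
    intro m
    have hm : m ∈ Submodule.span LamK (Set.range fun k : Fin (mu w) => omegaPhi w k) := by
      rw [span_omegaPhi w hw]
      trivial
    obtain ⟨f, hf⟩ := (Submodule.mem_span_range_iff_exists_fun LamK).1 hm
    exact ⟨f, hf.symm⟩
  have hf : ∀ f : Fin (mu w) → LamK, Φ (∑ k, f k • omegaPhi w k) = f := by
    intro f
    rw [map_sum]
    funext j
    rw [Finset.sum_apply, Finset.sum_eq_single j]
    · rw [map_smul, hΦ _ j.2]
      simp [stdVec]
    · intro k _ hk
      rw [map_smul, hΦ _ k.2]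
      simp [stdVec, Fin.val_ne_of_ne hk.symm]
    · simp
  have hinj : Function.Injective Φ := by
    intro a b hab
    obtain ⟨f, rfl⟩ := hm a
    obtain ⟨g, rfl⟩ := hm b
    rw [hf, hf] at hab
    rw [hab]
  have hbij : Function.Bijective Φ := ⟨hinj, fun f => ⟨_, hf f⟩⟩
  refine ⟨LinearEquiv.ofBijective Φ hbij, hΦ, hx, fun m k => ?_⟩
  simp only [LinearEquiv.ofBijective_apply]
  have hm : m ∈ Submodule.span LamK (Set.range fun k : Fin (mu w) => omegaPhi w k) := by
    rw [span_omegaPhi w hw]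
    trivial
  have hC : ∀ (c : ℂ) (m : G w), Φ (c • m) = c • Φ m := fun c m => by
    rw [← algebraMap_smul LamK, map_smul, algebraMap_smul]
  -- The operator τ∇_{∂/∂τ} − μD is a connection along τ∂_τ − μ x∂_x, diagonal in the basis with
  -- eigenvalues −k. Both sides obey the same Leibniz rule, so only the basis vectors need checking.
  induction hm using Submodule.span_induction with
  | zero => simp
  | add a b _ _ ha hb =>
    simp only [map_add, Pi.add_apply, ha, hb, smul_add]
    abel
  | smul f m _ h =>
    rw [isConnection_tauNabla w f m, isConnection_xNabla w f m, map_add, map_add]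
    simp only [map_smul, Pi.add_apply, Pi.smul_apply, smul_eq_mul, h, Derivation.leibniz]
    simp only [Algebra.smul_def]
    ring
  | mem m hm =>
    obtain ⟨j, rfl⟩ := hm
    simp only
    rw [(omegaPhi_spec w j).1, map_sub, hC, hC, hΦ _ j.2]
    simp only [stdVec, Pi.sub_apply, Pi.smul_apply]
    by_cases h : k.1 = j.1
    · simp [h]
    · simp [h]

end OmegaBasis

/-! ### Orders in `x` and the value at `x = 0` -/

section Order

/-- Division by x preserves convergence: the index shift in the coefficient bound is absorbed into
the constant as a factor r. -/
theorem exists_xO_mul {f : ConvO} (hf : PowerSeries.constantCoeff f.1 = 0) :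
    ∃ g : ConvO, f = xO * g := by
  obtain ⟨g, hg⟩ := PowerSeries.X_dvd_iff.2 hf
  obtain ⟨C, r, hC, hr, h⟩ := f.2
  refine ⟨⟨g, C * r, r, by positivity, hr, fun k => ?_⟩, Subtype.ext hg⟩
  have h1 := h (k + 1)
  rw [hg, PowerSeries.coeff_succ_X_mul] at h1
  rwa [mul_assoc, ← pow_succ']

theorem exists_derivK_inclOK (f : ConvO) : ∃ g : ConvO, derivK (inclOK f) = inclOK g := by
  refine ⟨⟨PowerSeries.derivative ℂ f.1, IsConvergent.derivative f.2⟩, Subtype.ext ?_⟩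
  change LaurentSeries.derivative ℂ (HahnSeries.ofPowerSeries ℤ ℂ f.1) =
    HahnSeries.ofPowerSeries ℤ ℂ (PowerSeries.derivative ℂ f.1)
  ext m
  rw [coeff_derivative, PowerSeries.coeff_coe, PowerSeries.coeff_coe]
  rcases lt_trichotomy m (-1) with hm | hm | hm
  · rw [if_pos (by omega), if_pos (by omega), mul_zero]
  · subst hm
    simp
  · obtain ⟨k, rfl⟩ := Int.eq_ofNat_of_zero_le (show 0 ≤ m by omega)
    rw [if_neg (by omega), if_neg (by omega), PowerSeries.coeff_derivative, mul_comm]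
    simp [show ((k : ℤ) + 1).natAbs = k + 1 by omega]

theorem inclOK_xO : inclOK xO = xPow 1 := Subtype.ext (HahnSeries.ofPowerSeries_X ..)

theorem exists_xPow_mul_inclOK (f : ConvK) : ∃ (p : ℤ) (g : ConvO), f = xPow p * inclOK g := by
  obtain ⟨p, g, hg, h⟩ := f.2
  refine ⟨-p, ⟨g, hg⟩, ?_⟩
  have h1 : xPow p * f = inclOK ⟨g, hg⟩ := Subtype.ext h
  rw [← h1, ← mul_assoc, xPow_mul, neg_add_cancel, xPow_zero, one_mul]

theorem algebraMap_single (k : ℤ) (f : ConvO) :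
    algebraMap LamO LamK (AddMonoidAlgebra.single k f) = AddMonoidAlgebra.single k (inclOK f) :=
  AddMonoidAlgebra.mapRingHom_single ..

theorem algebraMap_xLam : algebraMap LamO LamK xLam = xU := by
  rw [xLam, ← LaurentPolynomial.single_eq_C, algebraMap_single, inclOK_xO]
  rfl

/-- The value at `x = 0`. -/
def evalZero : LamO →+* LamC :=
  AddMonoidAlgebra.mapRingHom ℤ ((PowerSeries.constantCoeff (R := ℂ)).comp
    (show ConvO →+* PowerSeries ℂ from convergentPowerSeries.val.toRingHom))

theorem evalZero_single (k : ℤ) (f : ConvO) :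
    evalZero (AddMonoidAlgebra.single k f) =
      AddMonoidAlgebra.single k (PowerSeries.constantCoeff f.1) :=
  AddMonoidAlgebra.mapRingHom_single ..

theorem evalZero_algebraMap (c : LamC) : evalZero (algebraMap LamC LamO c) = c := by
  induction c using AddMonoidAlgebra.induction_linear with
  | zero => simp
  | add f g hf hg => rw [map_add, map_add, hf, hg]
  | single k c =>
    have h : algebraMap LamC LamO (AddMonoidAlgebra.single k c) =
        AddMonoidAlgebra.single k (algebraMap ℂ ConvO c) := AddMonoidAlgebra.mapRingHom_single ..
    rw [h, evalZero_single]
    congr 1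

theorem evalZero_xLam : evalZero xLam = 0 := by
  rw [xLam, ← LaurentPolynomial.single_eq_C, evalZero_single]
  have h : PowerSeries.constantCoeff xO.1 = (0 : ℂ) := PowerSeries.constantCoeff_X
  rw [h, AddMonoidAlgebra.single_zero]

theorem exists_xLam_mul {a : LamO} (ha : evalZero a = 0) : ∃ b : LamO, a = xLam * b := by
  have h : ∀ m, ∃ g : ConvO, a.coeff m = xO * g := fun m =>
    exists_xO_mul (congrArg (fun p : LamC => p.coeff m) ha)
  choose g hg using h
  refine ⟨∑ m ∈ a.coeff.support, AddMonoidAlgebra.single m (g m), ?_⟩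
  conv_lhs => rw [← AddMonoidAlgebra.sum_coeff_single a, Finsupp.sum]
  rw [Finset.mul_sum]
  refine Finset.sum_congr rfl fun m _ => ?_
  rw [hg, xLam, ← LaurentPolynomial.single_eq_C, AddMonoidAlgebra.single_mul_single, zero_add]

theorem exists_eulerX_algebraMap (a : LamO) :
    ∃ b : LamO, eulerX (algebraMap LamO LamK a) = algebraMap LamO LamK (xLam * b) := by
  induction a using AddMonoidAlgebra.induction_linear with
  | zero => exact ⟨0, by simp⟩
  | add f g hf hg =>
    obtain ⟨b, hb⟩ := hf
    obtain ⟨c, hc⟩ := hg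
    exact ⟨b + c, by rw [map_add, map_add, hb, hc, mul_add, map_add]⟩
  | single k f =>
    obtain ⟨g, hg⟩ := exists_derivK_inclOK f
    refine ⟨AddMonoidAlgebra.single k g, ?_⟩
    rw [algebraMap_single, eulerX_single, hg, xLam, ← LaurentPolynomial.single_eq_C,
      AddMonoidAlgebra.single_mul_single, zero_add, algebraMap_single, map_mul, inclOK_xO]

theorem exists_eulerTau_algebraMap (a : LamO) :
    ∃ b : LamO, eulerTau (algebraMap LamO LamK a) = algebraMap LamO LamK b := by
  induction a using AddMonoidAlgebra.induction_linear with
  | zero => exact ⟨0, by simp⟩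
  | add f g hf hg =>
    obtain ⟨b, hb⟩ := hf
    obtain ⟨c, hc⟩ := hg
    exact ⟨b + c, by rw [map_add, map_add, hb, hc, map_add]⟩
  | single k f =>
    refine ⟨AddMonoidAlgebra.single k (k * f), ?_⟩
    rw [algebraMap_single, eulerTau_single, algebraMap_single, map_mul, map_intCast]

/-- The powers of `x` in `ℂ{x}[x⁻¹][τ, τ⁻¹]`. -/
theorem xU_zpow (p : ℤ) : (↑(xU ^ p) : LamK) = LaurentPolynomial.C (xPow p) := by
  have h : ∀ k : ℕ, (↑(xU ^ k) : LamK) = LaurentPolynomial.C (xPow k) := by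
    intro k
    induction k with
    | zero => rw [pow_zero, Nat.cast_zero, xPow_zero]; exact (map_one _).symm
    | succ k ih => rw [pow_succ, Units.val_mul, ih, Nat.cast_succ, ← xPow_mul, map_mul]; rfl
  obtain ⟨k, rfl | rfl⟩ := p.eq_nat_or_neg
  · rw [zpow_natCast, h]
  · rw [zpow_neg, zpow_natCast, ← mul_one (↑(xU ^ k)⁻¹ : LamK), Units.inv_mul_eq_iff_eq_mul, h,
      ← map_mul, xPow_mul, add_neg_cancel, xPow_zero, map_one]

theorem eulerX_xU_zpow (p : ℤ) : eulerX (↑(xU ^ p) : LamK) = (p : LamK) * ↑(xU ^ p) := by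
  have h : ∀ k : ℕ, eulerX (↑(xU ^ k) : LamK) = (k : LamK) * ↑(xU ^ k) := by
    intro k
    induction k with
    | zero => simp
    | succ k ih =>
      rw [pow_succ, Units.val_mul, Derivation.leibniz, ih, eulerX_x]
      simp only [smul_eq_mul]
      push_cast
      ring
  obtain ⟨k, rfl | rfl⟩ := p.eq_nat_or_neg
  · rw [zpow_natCast, h, Int.cast_natCast]
  · have h1 : eulerX ((↑(xU ^ k) : LamK) * ↑(xU ^ (-(k : ℤ)))) = 0 := by
      rw [zpow_neg, zpow_natCast, Units.mul_inv, Derivation.map_one_eq_zero]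
    rw [Derivation.leibniz, h, smul_eq_mul, smul_eq_mul] at h1
    have h2 := congrArg ((↑(xU ^ (-(k : ℤ))) : LamK) * ·) h1
    have h3 : (↑(xU ^ (-(k : ℤ))) : LamK) * ↑(xU ^ k) = 1 := by
      rw [zpow_neg, zpow_natCast, Units.inv_mul]
    simp only [mul_add, ← mul_assoc, h3, one_mul, mul_zero] at h2
    rw [eq_neg_of_add_eq_zero_left h2]
    generalize (↑(xU ^ k) : LamK) = z at h3 ⊢
    push_cast
    linear_combination (-(k : LamK) * ↑(xU ^ (-(k : ℤ)))) * h3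

/-- `x^p ℂ{x}[τ, τ⁻¹]`. -/
def ordSub (p : ℤ) : Submodule LamO LamK where
  carrier := {f | ∃ a : LamO, f = (↑(xU ^ p) : LamK) * algebraMap LamO LamK a}
  zero_mem' := ⟨0, by simp⟩
  add_mem' := by
    rintro _ _ ⟨a, rfl⟩ ⟨b, rfl⟩
    exact ⟨a + b, by rw [map_add, mul_add]⟩
  smul_mem' := by
    rintro c _ ⟨a, rfl⟩
    exact ⟨c * a, by rw [Algebra.smul_def, map_mul, mul_left_comm]⟩

theorem mem_ordSub {p : ℤ} {f : LamK} :
    f ∈ ordSub p ↔ ∃ a : LamO, f = (↑(xU ^ p) : LamK) * algebraMap LamO LamK a := Iff.rfl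

theorem mem_ordSub_zero {f : LamK} : f ∈ ordSub 0 ↔ ∃ a : LamO, f = algebraMap LamO LamK a := by
  simp [mem_ordSub]

theorem zpow_mul_mem_ordSub {p q : ℤ} {f : LamK} :
    (↑(xU ^ q) : LamK) * f ∈ ordSub p ↔ f ∈ ordSub (p - q) := by
  constructor
  · rintro ⟨a, ha⟩
    refine ⟨a, ?_⟩
    rw [zpow_sub, mul_comm (xU ^ p), Units.val_mul, mul_assoc, ← ha, Units.inv_mul_cancel_left]
  · rintro ⟨a, rfl⟩
    exact ⟨a, by rw [← mul_assoc, ← Units.val_mul, ← zpow_add, add_sub_cancel]⟩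

theorem xU_mul_mem_ordSub {p : ℤ} {f : LamK} :
    (xU : LamK) * f ∈ ordSub p ↔ f ∈ ordSub (p - 1) := by
  rw [← zpow_mul_mem_ordSub, zpow_one]

theorem ordSub_antitone : Antitone ordSub := by
  refine antitone_int_of_succ_le fun p => ?_
  rintro _ ⟨a, rfl⟩
  exact ⟨xLam * a, by rw [map_mul, algebraMap_xLam, zpow_add_one, Units.val_mul, mul_assoc]⟩

/-- The factor x^p is an eigenvector of x∂_x with eigenvalue p, and x∂_x maps ℂ{x}[τ, τ⁻¹] into its
multiples of x, so the leading term cancels. -/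
theorem eulerX_sub_mem_ordSub {p : ℤ} {f : LamK} (hf : f ∈ ordSub p) :
    eulerX f - (p : ℂ) • f ∈ ordSub (p + 1) := by
  obtain ⟨a, rfl⟩ := hf
  obtain ⟨b, hb⟩ := exists_eulerX_algebraMap a
  refine ⟨b, ?_⟩
  rw [Derivation.leibniz, hb, eulerX_xU_zpow, map_mul, algebraMap_xLam,
    ← algebraMap_smul LamK (p : ℂ), map_intCast, zpow_add_one, Units.val_mul]
  simp only [smul_eq_mul]
  ring

instance : IsScalarTower ℂ LamO LamK := IsScalarTower.of_algebraMap_eq fun c => by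
  have h1 : algebraMap ℂ LamK c = AddMonoidAlgebra.single 0 (algebraMap ℂ ConvK c) := rfl
  have h2 : algebraMap ℂ LamO c = AddMonoidAlgebra.single 0 (algebraMap ℂ ConvO c) := rfl
  rw [h1, h2, algebraMap_single]
  rfl

theorem smul_mem_ordSub {p : ℤ} {f : LamK} (c : ℂ) (hf : f ∈ ordSub p) : c • f ∈ ordSub p :=
  Submodule.smul_of_tower_mem _ c hf

theorem eulerX_mem_ordSub {p : ℤ} {f : LamK} (hf : f ∈ ordSub p) : eulerX f ∈ ordSub p := by
  have h := Submodule.add_mem _ (ordSub_antitone (Int.le_add_one le_rfl) (eulerX_sub_mem_ordSub hf))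
    (smul_mem_ordSub (p : ℂ) hf)
  rwa [sub_add_cancel] at h

theorem eulerTau_mem_ordSub {p : ℤ} {f : LamK} (hf : f ∈ ordSub p) : eulerTau f ∈ ordSub p := by
  obtain ⟨a, rfl⟩ := hf
  obtain ⟨b, hb⟩ := exists_eulerTau_algebraMap a
  refine ⟨b, ?_⟩
  have h : eulerTau (↑(xU ^ p) : LamK) = 0 := by
    rw [xU_zpow, ← LaurentPolynomial.single_eq_C, eulerTau_single, Int.cast_zero, zero_mul,
      AddMonoidAlgebra.single_zero]
  rw [Derivation.leibniz, hb, h, smul_zero, add_zero, smul_eq_mul]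

theorem exists_mem_ordSub (f : LamK) : ∃ p, f ∈ ordSub p := by
  induction f using AddMonoidAlgebra.induction_linear with
  | zero => exact ⟨0, Submodule.zero_mem _⟩
  | add f g hf hg =>
    obtain ⟨p, hp⟩ := hf
    obtain ⟨q, hq⟩ := hg
    exact ⟨min p q, Submodule.add_mem _ (ordSub_antitone (min_le_left _ _) hp)
      (ordSub_antitone (min_le_right _ _) hq)⟩
  | single k f =>
    obtain ⟨p, g, rfl⟩ := exists_xPow_mul_inclOK f
    refine ⟨p, AddMonoidAlgebra.single k g, ?_⟩
    rw [algebraMap_single, xU_zpow, ← LaurentPolynomial.single_eq_C,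
      AddMonoidAlgebra.single_mul_single, zero_add]

/-- `τ` as a unit of `ℂ[τ, τ⁻¹]`. -/
def tauC : LamCˣ where
  val := LaurentPolynomial.T 1
  inv := LaurentPolynomial.T (-1)
  val_inv := by rw [← LaurentPolynomial.T_add]; simp
  inv_val := by rw [← LaurentPolynomial.T_add]; simp

theorem algebraMap_LamC_T (k : ℤ) :
    algebraMap LamC LamK (LaurentPolynomial.T k) = LaurentPolynomial.T k := by
  have h : algebraMap LamC LamO (LaurentPolynomial.T k) = AddMonoidAlgebra.single k 1 :=
    (AddMonoidAlgebra.mapRingHom_single ..).trans (by rw [map_one])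
  rw [IsScalarTower.algebraMap_apply LamC LamO LamK, h, algebraMap_single, map_one]
  rfl

theorem LamC_mul_mem_ordSub {p : ℤ} {f : LamK} (c : LamC) (hf : f ∈ ordSub p) :
    algebraMap LamC LamK c * f ∈ ordSub p := by
  rw [IsScalarTower.algebraMap_apply LamC LamO LamK, ← Algebra.smul_def]
  exact Submodule.smul_mem _ _ hf

theorem T_mul_mem_ordSub {p : ℤ} {f : LamK} (k : ℤ) (hf : f ∈ ordSub p) :
    (LaurentPolynomial.T k : LamK) * f ∈ ordSub p := by
  rw [← algebraMap_LamC_T]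
  exact LamC_mul_mem_ordSub _ hf

theorem tauU_mul_mem_ordSub {p : ℤ} {f : LamK} (hf : f ∈ ordSub p) : (tauU : LamK) * f ∈ ordSub p :=
  T_mul_mem_ordSub 1 hf

end Order

/-! ### Description of the filtration in coordinates -/

section Coordinates

variable {n : ℕ} {w : Fin n → ℕ}

instance : IsScalarTower ℂ LamO (G w) := ⟨fun c a m => by
  have h : ∀ (b : LamO), b • m = (algebraMap LamO LamK b) • m := fun _ => rfl
  rw [h, h, ← smul_assoc]
  congr 1
  rw [Algebra.algebraMap_eq_smul_one, Algebra.algebraMap_eq_smul_one, smul_assoc]⟩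

theorem LamO_smul_eq (a : LamO) (m : G w) : a • m = (algebraMap LamO LamK a) • m := rfl

theorem LamC_smul_eq (a : LamC) (m : G w) : a • m = (algebraMap LamC LamK a) • m := rfl

theorem xMul_apply (p : ℤ) (m : G w) : xMul w p m = (↑(xU ^ p) : LamK) • m := by
  rw [xU_zpow]
  rfl

theorem mem_map_xMul {p : ℤ} {S : Submodule LamO (G w)} {m : G w} :
    m ∈ S.map (xMul w p) ↔ (↑(xU ^ (-p)) : LamK) • m ∈ S := by
  rw [Submodule.mem_map]
  constructor
  · rintro ⟨y, hy, rfl⟩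
    rwa [xMul_apply, smul_smul, ← Units.val_mul, ← zpow_add, neg_add_cancel, zpow_zero,
      Units.val_one, one_smul]
  · intro h
    exact ⟨_, h, by rw [xMul_apply, smul_smul, ← Units.val_mul, ← zpow_add, add_neg_cancel,
      zpow_zero, Units.val_one, one_smul]⟩

variable {Φ : G w ≃ₗ[LamK] (Fin (mu w) → LamK)}

theorem coord_LamO_smul (Φ : G w ≃ₗ[LamK] (Fin (mu w) → LamK)) (a : LamO) (m : G w)
    (k : Fin (mu w)) : Φ (a • m) k = a • Φ m k := by
  rw [LamO_smul_eq, map_smul, Pi.smul_apply, smul_eq_mul, Algebra.smul_def]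

theorem coord_LamC_smul (Φ : G w ≃ₗ[LamK] (Fin (mu w) → LamK)) (a : LamC) (m : G w)
    (k : Fin (mu w)) : Φ (a • m) k = algebraMap LamC LamK a * Φ m k := by
  rw [LamC_smul_eq, map_smul, Pi.smul_apply, smul_eq_mul]

theorem coord_complex_smul (Φ : G w ≃ₗ[LamK] (Fin (mu w) → LamK)) (c : ℂ) (m : G w) :
    Φ (c • m) = c • Φ m := by
  rw [← algebraMap_smul LamK, map_smul, algebraMap_smul]

theorem eq_sum_omegaPhi (hΦ : ∀ k < mu w, Φ (omegaPhi w k) = stdVec LamK (mu w) k) (m : G w) :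
    m = ∑ k : Fin (mu w), Φ m k • omegaPhi w k := by
  apply Φ.injective
  rw [map_sum]
  funext j
  rw [Finset.sum_apply, Finset.sum_eq_single j]
  · rw [map_smul, hΦ _ j.2]
    simp [stdVec]
  · intro k _ hk
    rw [map_smul, hΦ _ k.2]
    simp [stdVec, Fin.val_ne_of_ne hk.symm]
  · simp

theorem mem_spanWeight (hΦ : ∀ k < mu w, Φ (omegaPhi w k) = stdVec LamK (mu w) k) {P : ℝ → Prop}
    {m : G w} : m ∈ spanWeight w P ↔ ∀ k : Fin (mu w),
      (P (weight w k) → Φ m k ∈ ordSub 0) ∧ (¬ P (weight w k) → Φ m k = 0) := by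
  constructor
  · intro hm k
    rw [spanWeight] at hm
    induction hm using Submodule.span_induction with
    | zero => simp
    | add a b _ _ ha hb =>
      rw [map_add, Pi.add_apply]
      exact ⟨fun h => Submodule.add_mem _ (ha.1 h) (hb.1 h), fun h => by
        rw [ha.2 h, hb.2 h, add_zero]⟩
    | smul c m _ h =>
      rw [coord_LamO_smul]
      exact ⟨fun hP => Submodule.smul_mem _ _ (h.1 hP), fun hP => by rw [h.2 hP, smul_zero]⟩
    | mem m hm =>
      obtain ⟨j, hj, hP, rfl⟩ := hm
      rw [hΦ j hj, stdVec]
      refine ⟨fun _ => ?_, fun h => if_neg fun hk => h (by rwa [hk])⟩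
      split_ifs
      · exact mem_ordSub_zero.2 ⟨1, by rw [map_one]⟩
      · exact Submodule.zero_mem _
  · intro h
    rw [eq_sum_omegaPhi hΦ m]
    refine Submodule.sum_mem _ fun k _ => ?_
    by_cases hP : P (weight w k)
    · obtain ⟨a, ha⟩ := mem_ordSub_zero.1 ((h k).1 hP)
      rw [ha, ← LamO_smul_eq]
      exact Submodule.smul_mem _ _ (Submodule.subset_span ⟨k, k.2, hP, rfl⟩)
    · rw [(h k).2 hP, zero_smul]
      exact Submodule.zero_mem _

-- Because the ω_k form a basis, the coordinates satisfying P and the others can be treated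
-- separately; the others carry one extra factor x.
open Classical in
theorem mem_map_spanWeight_sup (hΦ : ∀ k < mu w, Φ (omegaPhi w k) = stdVec LamK (mu w) k)
    (P : ℝ → Prop) (p : ℤ) {m : G w} :
    m ∈ (spanWeight w P ⊔ (spanWeight w fun v => ¬ P v).map (xMul w 1)).map (xMul w p) ↔
      ∀ k : Fin (mu w), Φ m k ∈ ordSub (p + if P (weight w k) then 0 else 1) := by
  have hk : ∀ k : Fin (mu w), Φ m k ∈ ordSub (p + if P (weight w k) then 0 else 1) ↔
      Φ ((↑(xU ^ (-p)) : LamK) • m) k ∈ ordSub (if P (weight w k) then 0 else 1) := by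
    intro k
    rw [map_smul, Pi.smul_apply, smul_eq_mul, zpow_mul_mem_ordSub, sub_neg_eq_add, add_comm]
  rw [mem_map_xMul, forall_congr' hk]
  generalize (↑(xU ^ (-p)) : LamK) • m = y
  constructor
  · intro hy k
    obtain ⟨a, ha, b, hb, rfl⟩ := Submodule.mem_sup.1 hy
    rw [mem_map_xMul] at hb
    have ha' := (mem_spanWeight hΦ).1 ha k
    have hb' := (mem_spanWeight hΦ).1 hb k
    rw [map_smul, Pi.smul_apply, smul_eq_mul, zpow_mul_mem_ordSub, Units.mul_right_eq_zero] at hb'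
    rw [map_add, Pi.add_apply]
    split_ifs with hP
    · rw [hb'.2 (not_not.2 hP), add_zero]
      exact ha'.1 hP
    · rw [ha'.2 hP, zero_add]
      simpa using hb'.1 hP
  · intro hy
    refine Submodule.mem_sup.2 ⟨Φ.symm fun k => if P (weight w k) then Φ y k else 0, ?_,
      Φ.symm fun k => if P (weight w k) then 0 else Φ y k, ?_, ?_⟩
    · rw [mem_spanWeight hΦ]
      intro k
      rw [LinearEquiv.apply_symm_apply]
      refine ⟨fun hP => ?_, fun hP => if_neg hP⟩
      have := hy k
      rw [if_pos hP] at this ⊢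
      exact this
    · rw [mem_map_xMul, mem_spanWeight hΦ]
      intro k
      rw [map_smul, LinearEquiv.apply_symm_apply, Pi.smul_apply, smul_eq_mul, zpow_mul_mem_ordSub,
        Units.mul_right_eq_zero]
      refine ⟨fun hP => ?_, fun hP => if_pos (not_not.1 hP)⟩
      have := hy k
      rw [if_neg hP] at this ⊢
      simpa using this
    · rw [← map_add]
      apply Φ.injective
      rw [LinearEquiv.apply_symm_apply]
      funext k
      rw [Pi.add_apply]
      split_ifs <;> simp

theorem ceil_sub_eq {α v : ℝ} (h0 : 0 ≤ v) (h1 : v < 1) [Decidable (Int.fract α ≤ v)] :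
    ⌈α - v⌉ = ⌊α⌋ + if Int.fract α ≤ v then 0 else 1 := by
  have h := Int.floor_add_fract α
  have h2 := Int.fract_nonneg α
  have h3 := Int.fract_lt_one α
  rw [Int.ceil_eq_iff]
  split_ifs with hv
  · push_cast
    constructor <;> linarith
  · push_cast
    constructor <;> linarith

theorem floor_sub_add_one_eq {α v : ℝ} (h0 : 0 ≤ v) (h1 : v < 1) [Decidable (Int.fract α < v)] :
    ⌊α - v⌋ + 1 = ⌊α⌋ + if Int.fract α < v then 0 else 1 := by
  have h := Int.floor_add_fract α
  have h2 := Int.fract_nonneg α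
  have h3 := Int.fract_lt_one α
  rw [← eq_sub_iff_add_eq, Int.floor_eq_iff]
  split_ifs with hv
  · push_cast
    constructor <;> linarith
  · push_cast
    constructor <;> linarith

/-- The element x^p ω_k has weight p + v_k, so it belongs to V^α when p ≥ α − v_k. This form treats
all real α uniformly, without splitting off the integer part. -/
theorem mem_V (hΦ : ∀ k < mu w, Φ (omegaPhi w k) = stdVec LamK (mu w) k) {α : ℝ} {m : G w} :
    m ∈ V w α ↔ ∀ k : Fin (mu w), Φ m k ∈ ordSub ⌈α - weight w k⌉ := by
  classical
  rw [V]
  simp only [← not_le]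
  rw [mem_map_spanWeight_sup hΦ (fun v => Int.fract α ≤ v)]
  refine forall_congr' fun k => ?_
  rw [ceil_sub_eq (weight_nonneg w k.2) (weight_lt_one w k.2)]

theorem mem_VGt (hΦ : ∀ k < mu w, Φ (omegaPhi w k) = stdVec LamK (mu w) k) {α : ℝ} {m : G w} :
    m ∈ VGt w α ↔ ∀ k : Fin (mu w), Φ m k ∈ ordSub (⌊α - weight w k⌋ + 1) := by
  classical
  rw [VGt]
  simp only [← not_lt]
  rw [mem_map_spanWeight_sup hΦ (fun v => Int.fract α < v)]
  refine forall_congr' fun k => ?_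
  rw [floor_sub_add_one_eq (weight_nonneg w k.2) (weight_lt_one w k.2)]

end Coordinates

/-! ### Uniqueness of the Kashiwara–Malgrange filtration -/

section KashiwaraMalgrange

open Polynomial

variable {O M : Type*} [CommRing O] [AddCommGroup M] [Module O M]

theorem mem_filtGt {V : ℝ → Submodule O M} (hV : Antitone V) {α : ℝ} {m : M} :
    m ∈ filtGt V α ↔ ∃ β > α, m ∈ V β := by
  have : Nonempty (Set.Ioi α) := ⟨⟨α + 1, by simp⟩⟩
  rw [filtGt, Submodule.mem_iSup_of_directed]
  · simp
  · exact Antitone.directed_le fun a b hab => hV hab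

/-- The elements of `S + ℤ` in `[a, b)`. -/
def jumps (S : Finset ℝ) (a b : ℝ) : Set ℝ :=
  {r | a ≤ r ∧ r < b ∧ ∃ σ ∈ S, ∃ p : ℤ, r = σ + p}

theorem jumps_finite (S : Finset ℝ) (a b : ℝ) : (jumps S a b).Finite := by
  have h : jumps S a b ⊆ ⋃ σ ∈ S, (fun p : ℤ => σ + p) '' Set.Icc ⌈a - σ⌉ ⌊b - σ⌋ := by
    rintro r ⟨ha, hb, σ, hσ, p, rfl⟩
    simp only [Set.mem_iUnion]
    refine ⟨σ, hσ, p, ⟨Int.ceil_le.2 (by linarith), Int.le_floor.2 (by linarith)⟩, rfl⟩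
  exact (S.finite_toSet.biUnion fun σ _ => (Set.finite_Icc _ _).image _).subset h

/-- The number of jumps in a bounded interval serves as induction measure below: passing strictly
beyond a jump decreases it. -/
theorem ncard_jumps_lt {S : Finset ℝ} {a b c r : ℝ} (hr : r ∈ jumps S a b) (hc : r < c) :
    (jumps S c b).ncard < (jumps S a b).ncard := by
  refine Set.ncard_lt_ncard ⟨fun t ht => ⟨?_, ht.2⟩, fun h => ?_⟩ (jumps_finite S a b)
  · linarith [ht.1, hr.1]
  · linarith [(h hr).1]

/-- The jumps of `V` are contained in `S + ℤ`. -/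
def HasJumpsIn (V : ℝ → Submodule O M) (S : Finset ℝ) : Prop :=
  ∀ α β : ℝ, α ≤ β → (∀ σ ∈ S, ∀ p : ℤ, ¬ (α ≤ σ + p ∧ σ + p < β)) → V α = V β

theorem HasJumpsIn.mono {V : ℝ → Submodule O M} {S S' : Finset ℝ} (h : HasJumpsIn V S)
    (hS : S ⊆ S') : HasJumpsIn V S' :=
  fun α β hαβ h' => h α β hαβ fun σ hσ => h' σ (hS hσ)

theorem HasJumpsIn.le_of_jumps_eq_empty {V : ℝ → Submodule O M} {S : Finset ℝ}
    (h : HasJumpsIn V S) (hV : Antitone V) {a b : ℝ} (hab : jumps S a b = ∅) : V a ≤ V b := by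
  rcases le_total b a with hba | hba
  · exact hV hba
  · refine (h a b hba fun σ hσ p hp => ?_).le
    have : σ + p ∈ jumps S a b := ⟨hp.1, hp.2, σ, hσ, p, rfl⟩
    rw [hab] at this
    exact this

theorem HasJumpsIn.exists_jump {V : ℝ → Submodule O M} {S : Finset ℝ}
    (h : HasJumpsIn V S) {a b : ℝ} (hab : (jumps S a b).Nonempty) :
    ∃ r ∈ jumps S a b, V a = V r := by
  obtain ⟨r, hr, hmin⟩ := Set.exists_min_image _ id (jumps_finite S a b) hab
  refine ⟨r, hr, h a r hr.1 fun σ hσ p hp => ?_⟩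
  have := hmin (σ + p) ⟨hp.1, hp.2.trans hr.2.1, σ, hσ, p, rfl⟩
  simp only [id] at this
  linarith [hp.2]

variable [Module ℂ M] [Algebra ℂ O] [IsScalarTower ℂ O M]

/-- The operator `x ∂ₓ`. -/
def eulerOp (x : O) (Dx : M →ₗ[ℂ] M) : Module.End ℂ M := Algebra.lsmul ℂ ℂ M x * Dx

theorem eulerOp_apply (x : O) (Dx : M →ₗ[ℂ] M) (m : M) : eulerOp x Dx m = x • Dx m := rfl

theorem eulerSub_iterate (x : O) (Dx : M →ₗ[ℂ] M) (α : ℝ) (N : ℕ) (m : M) :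
    (eulerSub x Dx α)^[N] m = aeval (eulerOp x Dx) ((X - C (α : ℂ)) ^ N) m := by
  have h : eulerSub x Dx α = ⇑(aeval (eulerOp x Dx) (X - C (α : ℂ))) := by
    funext m
    simp [eulerSub, eulerOp_apply]
  rw [h, map_pow, Module.End.pow_apply]

theorem aeval_mem {W : Submodule O M} {E : Module.End ℂ M} (hE : ∀ m ∈ W, E m ∈ W) (p : ℂ[X])
    {m : M} (hm : m ∈ W) : aeval E p m ∈ W := by
  induction p using Polynomial.induction_on generalizing m with
  | C a =>
    rw [aeval_C, Module.algebraMap_end_apply]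
    exact Submodule.smul_of_tower_mem _ _ hm
  | add p q hp hq => rw [map_add]; exact W.add_mem (hp hm) (hq hm)
  | monomial k a h =>
    rw [pow_succ, ← mul_assoc, map_mul, Module.End.mul_apply, aeval_X]
    exact h (hE _ hm)

/-- At a jump r < b ≤ 0 the polynomial (X − r)^N has the form c₀ + X q with c₀ ≠ 0. Thus c₀ m is (E
− r)^N m, which lies deeper in the filtration, minus E q(E) m, with E = x∂_x. Finitely many such
descents reach V^b. -/
theorem exists_eq_add_eulerOp {x : O} {Dx : M →ₗ[ℂ] M} {V : ℝ → Submodule O M} {S : Finset ℝ}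
    (hV : Antitone V) (hS : HasJumpsIn V S) (hE : ∀ α, ∀ m ∈ V α, eulerOp x Dx m ∈ V α)
    (hN : ∀ α, ∃ N : ℕ, ∀ m ∈ V α, (eulerSub x Dx α)^[N] m ∈ filtGt V α) {a b : ℝ} (hb : b ≤ 0) :
    ∀ (k : ℕ) (c : ℝ), a ≤ c → (jumps S c b).ncard = k → ∀ m ∈ V c,
      ∃ u ∈ V b, ∃ z ∈ V a, m = u + eulerOp x Dx z := by
  intro k
  induction k using Nat.strong_induction_on with
  | _ k ih =>
    intro c hac hk m hm
    rcases (jumps S c b).eq_empty_or_nonempty with he | he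
    · exact ⟨m, hS.le_of_jumps_eq_empty hV he hm, 0, Submodule.zero_mem _, by simp⟩
    obtain ⟨r, hr, hcr⟩ := hS.exists_jump he
    rw [hcr] at hm
    obtain ⟨N, hN⟩ := hN r
    obtain ⟨β, hβ, hmβ⟩ := (mem_filtGt hV).1 (hN m hm)
    obtain ⟨u, hu, z, hz, huz⟩ := ih _ (hk ▸ ncard_jumps_lt hr hβ) β (by linarith [hr.1]) rfl _ hmβ
    obtain ⟨q, hq⟩ : (X : ℂ[X]) ∣ (X - C (r : ℂ)) ^ N - C (((X - C (r : ℂ)) ^ N : ℂ[X]).coeff 0) := by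
      rw [X_dvd_iff]
      simp
    have hne : (((X - C (r : ℂ)) ^ N : ℂ[X]).coeff 0) ≠ 0 := by
      have h0 : (r : ℂ) ≠ 0 := by exact_mod_cast (hr.2.1.trans_le hb).ne
      rw [coeff_zero_eq_eval_zero]
      simp [h0]
    set c₀ := (((X - C (r : ℂ)) ^ N : ℂ[X]).coeff 0)
    have h1 := congrArg (fun p => aeval (eulerOp x Dx) p m) hq
    simp only [map_sub, map_mul, aeval_X, aeval_C, LinearMap.sub_apply, Module.End.mul_apply,
      Module.algebraMap_end_apply] at h1
    rw [eulerSub_iterate] at huz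
    simp only [map_sub, aeval_X, aeval_C, map_pow] at h1 huz
    rw [huz] at h1
    refine ⟨c₀⁻¹ • u, Submodule.smul_of_tower_mem _ _ hu,
      c₀⁻¹ • (z - aeval (eulerOp x Dx) q m), Submodule.smul_of_tower_mem _ _ (Submodule.sub_mem _ hz
        (hV (hac.trans hr.1) (aeval_mem (hE r) q hm))), ?_⟩
    rw [map_smul, ← smul_add, map_sub, ← h1]
    rw [show u + (eulerOp x Dx z - (u + eulerOp x Dx z - c₀ • m)) = c₀ • m by abel,
      inv_smul_smul₀ hne]

variable {x : O} {Dτ Dx : M →ₗ[ℂ] M} {V V' : ℝ → Submodule O M}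

theorem IsKashiwaraMalgrange.eulerOp_mem (h : IsKashiwaraMalgrange x Dτ Dx V) (α : ℝ) (m : M)
    (hm : m ∈ V α) : eulerOp x Dx m ∈ V α := by
  have := h.smul_mem _ _ (h.derivX_mem _ _ hm)
  rwa [sub_add_cancel] at this

/-- The finitely many generators of V^{α₀} lie in some V'^c, hence so does all of V^{α₀}.
Multiplication by x^p moves this inclusion to α₀ + p and c + p, because V^{α₀+p} = x^p V^{α₀}. -/
theorem IsKashiwaraMalgrange.exists_le (h : IsKashiwaraMalgrange x Dτ Dx V)
    (h' : IsKashiwaraMalgrange x Dτ Dx V') (β : ℝ) : ∃ α, V α ≤ V' β := by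
  obtain ⟨α₀, h0⟩ := h.good_pos
  obtain ⟨T, hT, hT'⟩ := h.finite α₀
  have hc : ∀ T : Finset M, ∃ c, (T : Set M) ⊆ V' c := by
    classical
    intro T
    induction T using Finset.induction_on with
    | empty => exact ⟨0, by simp⟩
    | insert a T _ ih =>
      obtain ⟨c, hc⟩ := ih
      obtain ⟨d, hd⟩ := h'.exhaustive a
      refine ⟨min c d, ?_⟩
      rw [Finset.coe_insert, Set.insert_subset_iff]
      exact ⟨h'.antitone (min_le_right _ _) hd, hc.trans (h'.antitone (min_le_left _ _))⟩
  obtain ⟨c, hc⟩ := hc T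
  have hle : ∀ p : ℕ, V (α₀ + p) ≤ V' (c + p) := by
    intro p
    induction p with
    | zero =>
      simp only [Nat.cast_zero, add_zero]
      exact hT' _ hc (h'.derivTau_mem c) (h'.eulerOp_mem c)
    | succ p ih =>
      intro m hm
      push_cast at hm ⊢
      rw [← add_assoc] at hm ⊢
      obtain ⟨m', hm', rfl⟩ := h0 (α₀ + p) (by simp) m hm
      exact h'.smul_mem _ _ (ih hm')
  obtain ⟨p, hp⟩ := exists_nat_ge (β - c)
  exact ⟨α₀ + p, (hle p).trans (h'.antitone (by linarith))⟩

/-- Take m in V^r ∩ V'^s at jumps s < α ≤ r. A power of E − r sends m deeper into V, and a power of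
E − s sends it deeper into V'. As r ≠ s, these powers are coprime, so m is a sum of two elements,
each with fewer jumps left in one of the filtrations. The induction ends in V^A or in V'^α. -/
theorem IsKashiwaraMalgrange.inf_le (h : IsKashiwaraMalgrange x Dτ Dx V)
    (h' : IsKashiwaraMalgrange x Dτ Dx V') {S : Finset ℝ} (hS : HasJumpsIn V S)
    (hS' : HasJumpsIn V' S) {α A : ℝ} (hA : V A ≤ V' α) : ∀ (k : ℕ) (a b : ℝ), α ≤ a →
      (jumps S a A).ncard + (jumps S b α).ncard = k → V a ⊓ V' b ≤ V' α := by
  intro k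
  induction k using Nat.strong_induction_on with
  | _ k ih =>
    intro a b ha hk
    rcases (jumps S a A).eq_empty_or_nonempty with he | he
    · exact inf_le_left.trans ((hS.le_of_jumps_eq_empty h.antitone he).trans hA)
    rcases (jumps S b α).eq_empty_or_nonempty with he' | he'
    · exact inf_le_right.trans (hS'.le_of_jumps_eq_empty h'.antitone he')
    obtain ⟨r, hr, har⟩ := hS.exists_jump he
    obtain ⟨s, hs, hbs⟩ := hS'.exists_jump he'
    rw [har, hbs]
    rintro m ⟨hm, hm'⟩
    obtain ⟨N, hN⟩ := h.nilpotent r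
    obtain ⟨N', hN'⟩ := h'.nilpotent s
    obtain ⟨β, hβ, hmβ⟩ := (mem_filtGt h.antitone).1 (hN m hm)
    obtain ⟨γ, hγ, hmγ⟩ := (mem_filtGt h'.antitone).1 (hN' m hm')
    rw [eulerSub_iterate] at hmβ hmγ
    have hrs : (r : ℂ) - s ≠ 0 := by
      rw [sub_ne_zero]
      exact_mod_cast ((hs.2.1.trans_le ha).trans_le hr.1).ne'
    obtain ⟨p, q, hpq⟩ := (isCoprime_X_sub_C_of_isUnit_sub hrs.isUnit).pow (m := N) (n := N')
    have h1 := congrArg (fun p => aeval (eulerOp x Dx) p m) hpq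
    simp only [map_add, map_mul, LinearMap.add_apply, Module.End.mul_apply, map_one,
      Module.End.one_apply] at h1
    rw [← h1]
    refine Submodule.add_mem _ ?_ ?_
    · refine ih _ ?_ β b (by linarith [hr.1]) rfl ⟨aeval_mem (h.eulerOp_mem β) _ hmβ, ?_⟩
      · have := ncard_jumps_lt hr hβ
        omega
      · rw [hbs]
        exact aeval_mem (h'.eulerOp_mem s) _ (aeval_mem (h'.eulerOp_mem s) _ hm')
    · refine ih _ ?_ a γ ha rfl ⟨?_, aeval_mem (h'.eulerOp_mem γ) _ hmγ⟩
      · have := ncard_jumps_lt hs hγ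
        omega
      · rw [har]
        exact aeval_mem (h.eulerOp_mem r) _ (aeval_mem (h.eulerOp_mem r) _ hm)

theorem IsKashiwaraMalgrange.le (h : IsKashiwaraMalgrange x Dτ Dx V)
    (h' : IsKashiwaraMalgrange x Dτ Dx V') (α : ℝ) : V α ≤ V' α := by
  classical
  obtain ⟨S, hS⟩ := h.discrete
  obtain ⟨S', hS'⟩ := h'.discrete
  obtain ⟨A, hA⟩ := h.exists_le h' α
  intro m hm
  obtain ⟨b, hb⟩ := h'.exhaustive m
  -- Exhaustiveness of V' supplies a starting index b, possibly far below α.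
  exact h.inf_le h' (HasJumpsIn.mono hS Finset.subset_union_left)
    (HasJumpsIn.mono hS' Finset.subset_union_right) hA _ α b le_rfl rfl ⟨hm, hb⟩

theorem IsKashiwaraMalgrange.unique (h : IsKashiwaraMalgrange x Dτ Dx V)
    (h' : IsKashiwaraMalgrange x Dτ Dx V') : V = V' :=
  funext fun α => le_antisymm (h.le h' α) (h'.le h α)

end KashiwaraMalgrange

/-! ### The filtration `V` is the Kashiwara–Malgrange filtration -/

section VIsKashiwaraMalgrange

variable {n : ℕ} {w : Fin n → ℕ} {Φ : G w ≃ₗ[LamK] (Fin (mu w) → LamK)}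

theorem V_antitone (hΦ : ∀ k < mu w, Φ (omegaPhi w k) = stdVec LamK (mu w) k) : Antitone (V w) := by
  intro α β hαβ m hm
  rw [mem_V hΦ] at hm ⊢
  exact fun k => ordSub_antitone (Int.ceil_le_ceil (by linarith)) (hm k)

theorem VGt_eq_filtGt (hΦ : ∀ k < mu w, Φ (omegaPhi w k) = stdVec LamK (mu w) k) (α : ℝ) :
    VGt w α = filtGt (V w) α := by
  ext m
  rw [mem_filtGt (V_antitone hΦ), mem_VGt hΦ]
  simp only [mem_V hΦ]
  constructor
  · intro hm
    -- For β slightly above α, ⌈β − v_k⌉ does not exceed ⌊α − v_k⌋ + 1; with finitely many k, one β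
    -- serves all of them.
    have h : ∀ᶠ β in nhdsWithin α (Set.Ioi α), ∀ k : Fin (mu w),
        β < weight w k + ⌊α - weight w k⌋ + 1 := by
      rw [Filter.eventually_all]
      intro k
      refine Filter.Eventually.filter_mono nhdsWithin_le_nhds (gt_mem_nhds ?_)
      linarith [Int.lt_floor_add_one (α - weight w k)]
    obtain ⟨β, hβ, hαβ⟩ := (h.and self_mem_nhdsWithin).exists
    refine ⟨β, hαβ, fun k => ordSub_antitone (Int.ceil_le.2 ?_) (hm k)⟩
    push_cast
    linarith [hβ k]
  · rintro ⟨β, hβ, hm⟩ k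
    refine ordSub_antitone ?_ (hm k)
    rw [Int.add_one_le_iff, Int.lt_ceil]
    exact (Int.floor_le _).trans_lt (by linarith [show α < β from hβ])

theorem xU_smul_mem_V (hΦ : ∀ k < mu w, Φ (omegaPhi w k) = stdVec LamK (mu w) k) {α : ℝ} {m : G w} :
    (xU : LamK) • m ∈ V w (α + 1) ↔ m ∈ V w α := by
  rw [mem_V hΦ, mem_V hΦ]
  refine forall_congr' fun k => ?_
  rw [map_smul, Pi.smul_apply, smul_eq_mul, xU_mul_mem_ordSub, add_sub_right_comm, Int.ceil_add_one,
    add_sub_cancel_right]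

theorem xLam_smul_eq (m : G w) : xLam • m = (xU : LamK) • m := by
  rw [LamO_smul_eq, algebraMap_xLam]

theorem modelX_apply (f : Fin (mu w) → LamK) (k : Fin (mu w)) : modelX w f k =
    eulerX (f k) + ((weight w k : ℝ) : ℂ) • f k -
      tauU * ((if k.1 = 0 then (weightConst w)⁻¹ • (xU : LamK) else 1) * f (cycPred k)) := rfl

/-- The coefficient coming from the predecessor in `modelX`. -/
theorem cycPred_mem_ordSub {f : Fin (mu w) → LamK} {α : ℝ} {g : ℝ → ℤ} (hg : Monotone g)
    (hg1 : ∀ t, g (t + 1) = g t + 1) {k : Fin (mu w)}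
    (hf : f (cycPred k) ∈ ordSub (g (α - weight w (cycPred k)))) :
    (tauU : LamK) * ((if k.1 = 0 then (weightConst w)⁻¹ • (xU : LamK) else 1) * f (cycPred k)) ∈
      ordSub (g (α - weight w k)) := by
  refine tauU_mul_mem_ordSub ?_
  have hk := (cycPred k).2
  -- For k = 0 the predecessor is the last index; the factor x gains one order, which suffices as
  -- v_{μ−1} < 1 + v_0. Otherwise monotonicity of the weights suffices. Here g stands for either the
  -- ceiling or the floor plus one, so that V^α and V^{>α} are handled together.
  split_ifs with h
  · rw [smul_mul_assoc]
    refine smul_mem_ordSub _ (xU_mul_mem_ordSub.2 (ordSub_antitone ?_ hf))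
    rw [sub_le_iff_le_add, ← hg1]
    exact hg (by linarith [weight_lt_one w hk, weight_nonneg w k.2])
  · rw [one_mul]
    refine ordSub_antitone (hg ?_) hf
    have h1 : (cycPred k).1 ≤ k.1 := by
      simp only [cycPred, if_neg h]
      omega
    linarith [weight_mono w h1 k.2]

theorem modelX_mem_ordSub {f : Fin (mu w) → LamK} {α : ℝ} {g : ℝ → ℤ} (hg : Monotone g)
    (hg1 : ∀ t, g (t + 1) = g t + 1) (hf : ∀ k : Fin (mu w), f k ∈ ordSub (g (α - weight w k)))
    (k : Fin (mu w)) : modelX w f k ∈ ordSub (g (α - weight w k)) := by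
  rw [modelX_apply]
  exact Submodule.sub_mem _ (Submodule.add_mem _ (eulerX_mem_ordSub (hf k))
    (smul_mem_ordSub _ (hf k))) (cycPred_mem_ordSub hg hg1 (hf _))

theorem xNabla_mem_V (hΦ : ∀ k < mu w, Φ (omegaPhi w k) = stdVec LamK (mu w) k)
    (hX : ∀ m, Φ (xNabla w m) = modelX w (Φ m)) {α : ℝ} {m : G w} (hm : m ∈ V w α) :
    xNabla w m ∈ V w α := by
  rw [mem_V hΦ] at hm ⊢
  rw [hX]
  exact modelX_mem_ordSub (g := fun t => ⌈t⌉) Int.ceil_mono (fun t => Int.ceil_add_one t) hm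

theorem xNabla_mem_VGt (hΦ : ∀ k < mu w, Φ (omegaPhi w k) = stdVec LamK (mu w) k)
    (hX : ∀ m, Φ (xNabla w m) = modelX w (Φ m)) {α : ℝ} {m : G w} (hm : m ∈ VGt w α) :
    xNabla w m ∈ VGt w α := by
  rw [mem_VGt hΦ] at hm ⊢
  rw [hX]
  exact modelX_mem_ordSub (g := fun t => ⌊t⌋ + 1) (fun a b hab => by
    have := Int.floor_mono hab; simp only; omega) (fun t => by simp [Int.floor_add_one]) hm

theorem eulerSub_eq (α : ℝ) (m : G w) :
    eulerSub xLam (gNablaX w) α m = xNabla w m - (α : ℂ) • m := by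
  rw [eulerSub, xLam_smul_gNablaX]

theorem eulerSub_coord (hX : ∀ m, Φ (xNabla w m) = modelX w (Φ m)) (α : ℝ) (m : G w)
    (k : Fin (mu w)) : Φ (eulerSub xLam (gNablaX w) α m) k =
      (eulerX (Φ m k) - ((α - weight w k : ℝ) : ℂ) • Φ m k) -
      tauU * ((if k.1 = 0 then (weightConst w)⁻¹ • (xU : LamK) else 1) * Φ m (cycPred k)) := by
  rw [eulerSub_eq, map_sub, hX, coord_complex_smul, Pi.sub_apply, modelX_apply, Pi.smul_apply,
    Complex.ofReal_sub, sub_smul]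
  abel

/-- For integral t the leading term is annihilated; for other t, ⌈t⌉ already equals ⌊t⌋ + 1 and
nothing needs to be gained. -/
theorem eulerX_sub_smul_mem_ordSub {t : ℝ} {f : LamK} (hf : f ∈ ordSub ⌈t⌉) :
    eulerX f - (t : ℂ) • f ∈ ordSub (⌊t⌋ + 1) := by
  by_cases h : (⌊t⌋ : ℝ) = t
  · have h2 : ⌈t⌉ = ⌊t⌋ := by
      conv_lhs => rw [← h]
      rw [Int.ceil_intCast]
    rw [h2] at hf
    have h3 := eulerX_sub_mem_ordSub hf
    rwa [show ((⌊t⌋ : ℤ) : ℂ) = (t : ℂ) by rw [← h]; push_cast; simp] at h3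
  · have h2 : ⌊t⌋ + 1 ≤ ⌈t⌉ := by
      rw [Int.add_one_le_iff, Int.lt_ceil]
      exact lt_of_le_of_ne (Int.floor_le t) h
    have hf' := ordSub_antitone h2 hf
    exact Submodule.sub_mem _ (eulerX_mem_ordSub hf') (smul_mem_ordSub _ hf')

theorem eulerSub_mem_V (hΦ : ∀ k < mu w, Φ (omegaPhi w k) = stdVec LamK (mu w) k)
    (hX : ∀ m, Φ (xNabla w m) = modelX w (Φ m)) {α : ℝ} {m : G w} (hm : m ∈ V w α) :
    eulerSub xLam (gNablaX w) α m ∈ V w α := by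
  rw [eulerSub_eq]
  exact Submodule.sub_mem _ (xNabla_mem_V hΦ hX hm) (Submodule.smul_of_tower_mem _ _ hm)

/-- Modulo V^{>α} the diagonal of x∇_{∂/∂x} − α vanishes, and coordinate k of the image depends only
on coordinate k − 1. Each application therefore brings one more coordinate, counted from 0, to the
order required in V^{>α}. -/
theorem eulerSub_iterate_mem (hΦ : ∀ k < mu w, Φ (omegaPhi w k) = stdVec LamK (mu w) k)
    (hX : ∀ m, Φ (xNabla w m) = modelX w (Φ m)) {α : ℝ} {m : G w} (hm : m ∈ V w α) (j : ℕ) :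
    (eulerSub xLam (gNablaX w) α)^[j] m ∈ V w α ∧ ∀ k : Fin (mu w), k.1 < j →
      Φ ((eulerSub xLam (gNablaX w) α)^[j] m) k ∈ ordSub (⌊α - weight w k⌋ + 1) := by
  induction j with
  | zero => exact ⟨hm, fun k hk => absurd hk (Nat.not_lt_zero _)⟩
  | succ j ih =>
    rw [Function.iterate_succ_apply']
    set y := (eulerSub xLam (gNablaX w) α)^[j] m
    refine ⟨eulerSub_mem_V hΦ hX ih.1, fun k hk => ?_⟩
    rw [eulerSub_coord hX]
    have hy := (mem_V hΦ).1 ih.1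
    refine Submodule.sub_mem _ (eulerX_sub_smul_mem_ordSub (hy k)) ?_
    -- The wrap-around entry contains x and has strictly larger weight than needed, since v_{μ−1} <
    -- 1; it already lies in V^{>α}.
    by_cases h : k.1 = 0
    · rw [if_pos h, smul_mul_assoc]
      refine tauU_mul_mem_ordSub (smul_mem_ordSub _ (xU_mul_mem_ordSub.2 (ordSub_antitone ?_ (hy _))))
      rw [add_sub_cancel_right, ← Int.lt_add_one_iff, ← sub_lt_iff_lt_add, Int.lt_ceil]
      push_cast
      linarith [Int.floor_le (α - weight w k), weight_lt_one w (cycPred k).2, weight_nonneg w k.2]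
    · have hc : (cycPred k).1 < j := by
        simp only [cycPred, if_neg h]
        omega
      exact cycPred_mem_ordSub (g := fun t => ⌊t⌋ + 1) (fun a b hab => by
        have := Int.floor_mono hab; simp only; omega) (fun t => by simp [Int.floor_add_one])
        (ih.2 _ hc)

theorem eulerSub_iterate_mem_VGt (hΦ : ∀ k < mu w, Φ (omegaPhi w k) = stdVec LamK (mu w) k)
    (hX : ∀ m, Φ (xNabla w m) = modelX w (Φ m)) {α : ℝ} {m : G w} (hm : m ∈ V w α) :
    (eulerSub xLam (gNablaX w) α)^[mu w] m ∈ VGt w α :=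
  (mem_VGt hΦ).2 fun k => (eulerSub_iterate_mem hΦ hX hm (mu w)).2 k k.2

theorem V_hasJumpsIn (hΦ : ∀ k < mu w, Φ (omegaPhi w k) = stdVec LamK (mu w) k) :
    HasJumpsIn (V w) ((Finset.range (mu w)).image (weight w)) := by
  intro α β hαβ h
  refine le_antisymm (fun m hm => ?_) (V_antitone hΦ hαβ)
  rw [mem_V hΦ] at hm ⊢
  intro k
  refine ordSub_antitone ?_ (hm k)
  by_contra! hlt
  refine h (weight w k) (Finset.mem_image_of_mem _ (Finset.mem_range.2 k.2)) ⌈α - weight w k⌉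
    ⟨?_, ?_⟩
  · linarith [Int.le_ceil (α - weight w k)]
  · linarith [Int.lt_ceil.1 hlt]

theorem gNablaX_mem_V (hΦ : ∀ k < mu w, Φ (omegaPhi w k) = stdVec LamK (mu w) k)
    (hX : ∀ m, Φ (xNabla w m) = modelX w (Φ m)) {α : ℝ} {m : G w} (hm : m ∈ V w α) :
    gNablaX w m ∈ V w (α - 1) := by
  rw [← xU_smul_mem_V hΦ, sub_add_cancel]
  exact xNabla_mem_V hΦ hX hm

theorem gNablaTau_mem_V (hΦ : ∀ k < mu w, Φ (omegaPhi w k) = stdVec LamK (mu w) k)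
    (hX : ∀ m, Φ (xNabla w m) = modelX w (Φ m))
    (hT : ∀ m k, Φ (tauNabla w m) k = (mu w : ℂ) • Φ (xNabla w m) k +
      (eulerTau (Φ m k) - (mu w : ℂ) • eulerX (Φ m k)) - ((k : ℕ) : ℂ) • Φ m k)
    {α : ℝ} {m : G w} (hm : m ∈ V w α) : gNablaTau w m ∈ V w α := by
  have h1 : gNablaTau w m = (LaurentPolynomial.T (-1) : LamK) • tauNabla w m := by
    rw [tauNabla_apply, smul_smul, ← LaurentPolynomial.T_add]
    simp
  have hx := (mem_V hΦ).1 (xNabla_mem_V hΦ hX hm)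
  rw [mem_V hΦ] at hm ⊢
  intro k
  rw [h1, map_smul, Pi.smul_apply, smul_eq_mul, hT]
  exact T_mul_mem_ordSub _ (Submodule.sub_mem _ (Submodule.add_mem _ (smul_mem_ordSub _ (hx k))
    (Submodule.sub_mem _ (eulerTau_mem_ordSub (hm k)) (smul_mem_ordSub _
      (eulerX_mem_ordSub (hm k))))) (smul_mem_ordSub _ (hm k)))

theorem V_exhaustive (hΦ : ∀ k < mu w, Φ (omegaPhi w k) = stdVec LamK (mu w) k) (m : G w) :
    ∃ α, m ∈ V w α := by
  choose p hp using fun k => exists_mem_ordSub (Φ m k)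
  refine ⟨-∑ k, |(p k : ℝ)|, (mem_V hΦ).2 fun k => ordSub_antitone (Int.ceil_le.2 ?_) (hp k)⟩
  have h1 : |(p k : ℝ)| ≤ ∑ k, |(p k : ℝ)| :=
    Finset.single_le_sum (f := fun k => |(p k : ℝ)|) (fun _ _ => abs_nonneg _) (Finset.mem_univ k)
  linarith [neg_abs_le (p k : ℝ), weight_nonneg w k.2]

/-- The elements x^{⌈α − v_k⌉} ω_k generate V^α already over ℂ{x}[θ, θ⁻¹], without the help of
differential operators. -/
theorem V_finite (hΦ : ∀ k < mu w, Φ (omegaPhi w k) = stdVec LamK (mu w) k) (α : ℝ) :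
    ∃ T : Finset (G w), (T : Set (G w)) ⊆ V w α ∧
      ∀ W : Submodule LamO (G w), (T : Set (G w)) ⊆ W → V w α ≤ W := by
  classical
  let b : Fin (mu w) → G w := fun k => (↑(xU ^ ⌈α - weight w k⌉) : LamK) • omegaPhi w k
  refine ⟨Finset.univ.image b, ?_, fun W hW m hm => ?_⟩
  · intro y hy
    obtain ⟨k, -, rfl⟩ := Finset.mem_image.1 (Finset.mem_coe.1 hy)
    rw [SetLike.mem_coe, mem_V hΦ]
    intro j
    rw [map_smul, hΦ k k.2, Pi.smul_apply, stdVec]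
    split_ifs with h
    · rw [h]
      exact ⟨1, by rw [map_one]; rfl⟩
    · rw [smul_zero]
      exact Submodule.zero_mem _
  · rw [mem_V hΦ] at hm
    rw [eq_sum_omegaPhi hΦ m]
    refine Submodule.sum_mem _ fun k _ => ?_
    obtain ⟨a, ha⟩ := hm k
    rw [ha, mul_comm, mul_smul, ← LamO_smul_eq]
    exact W.smul_mem _ (hW (Finset.mem_coe.2 (Finset.mem_image_of_mem b (Finset.mem_univ k))))

theorem isKashiwaraMalgrange_V (hΦ : ∀ k < mu w, Φ (omegaPhi w k) = stdVec LamK (mu w) k)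
    (hX : ∀ m, Φ (xNabla w m) = modelX w (Φ m))
    (hT : ∀ m k, Φ (tauNabla w m) k = (mu w : ℂ) • Φ (xNabla w m) k +
      (eulerTau (Φ m k) - (mu w : ℂ) • eulerX (Φ m k)) - ((k : ℕ) : ℂ) • Φ m k) :
    IsKashiwaraMalgrange xLam (gNablaTau w) (gNablaX w) (V w) := by
  have hnil : ∀ α, ∃ N : ℕ, ∀ m ∈ V w α,
      (eulerSub xLam (gNablaX w) α)^[N] m ∈ filtGt (V w) α := fun α =>
    ⟨mu w, fun m hm => by rw [← VGt_eq_filtGt hΦ]; exact eulerSub_iterate_mem_VGt hΦ hX hm⟩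
  have hE : ∀ m : G w, eulerOp xLam (gNablaX w) m = xNabla w m := fun m => by
    rw [eulerOp_apply, xLam_smul_gNablaX]
  have hdiv : ∀ α, ∀ m ∈ V w (α + 1), ∃ m' ∈ V w α, m = xLam • m' := by
    intro α m hm
    have h : m = (xU : LamK) • (↑xU⁻¹ : LamK) • m := by
      rw [smul_smul, Units.mul_inv, one_smul]
    refine ⟨(↑xU⁻¹ : LamK) • m, ?_, ?_⟩
    · rwa [← xU_smul_mem_V hΦ, ← h]
    · rwa [xLam_smul_eq]
  refine ⟨V_antitone hΦ, V_exhaustive hΦ, ⟨_, V_hasJumpsIn hΦ⟩, fun α m hm => ?_,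
    fun α m hm => gNablaX_mem_V hΦ hX hm, fun α m hm => gNablaTau_mem_V hΦ hX hT hm, fun α => ?_,
    ⟨0, fun α _ => hdiv α⟩, ⟨-1, fun α hα m hm => ?_⟩, hnil⟩
  · rwa [xLam_smul_eq, xU_smul_mem_V hΦ]
  · obtain ⟨T, hT, h⟩ := V_finite hΦ α
    exact ⟨T, hT, fun W hW _ _ => h W hW⟩
  · have hxm : (xU : LamK) • m ∈ V w α := by
      have := (xU_smul_mem_V hΦ).2 hm
      rwa [sub_add_cancel] at this
    obtain ⟨u, hu, z, hz, h⟩ := exists_eq_add_eulerOp (V_antitone hΦ) (V_hasJumpsIn hΦ)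
      (fun α m hm => by rw [hE]; exact xNabla_mem_V hΦ hX hm) hnil (b := α + 1) (by linarith) _ α
      le_rfl rfl _ hxm
    obtain ⟨a, ha, rfl⟩ := hdiv α u hu
    refine ⟨a, ha, z, hz, ?_⟩
    rw [eulerOp_apply, ← smul_add, xLam_smul_eq] at h
    have h2 := congrArg ((↑xU⁻¹ : LamK) • ·) h
    simpa only [smul_smul, Units.inv_mul, one_smul] using h2

end VIsKashiwaraMalgrange

/-! ### The graded module and its Jordan basis -/

section Residue

/-- The coefficient of `x^0` in `ℂ{x}[x⁻¹]`. -/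
def coeffZero : ConvK →+ ℂ where
  toFun f := f.1.coeff 0
  map_zero' := rfl
  map_add' _ _ := rfl

theorem coeffZero_inclOK (f : ConvO) : coeffZero (inclOK f) = PowerSeries.constantCoeff f.1 := by
  change (HahnSeries.ofPowerSeries ℤ ℂ f.1).coeff 0 = _
  rw [PowerSeries.coeff_coe]
  simp

theorem coeffZero_smul (c : ℂ) (f : ConvK) :
    coeffZero (inclOK (algebraMap ℂ ConvO c) * f) = c * coeffZero f := by
  have h : ((inclOK (algebraMap ℂ ConvO c) * f : ConvK).1 : ℂ⸨X⸩) = HahnSeries.C c * f.1 := by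
    change HahnSeries.ofPowerSeries ℤ ℂ (PowerSeries.C c) * f.1 = _
    rw [HahnSeries.ofPowerSeries_C]
  change ((inclOK (algebraMap ℂ ConvO c) * f : ConvK).1 : ℂ⸨X⸩).coeff 0 = _
  rw [h, HahnSeries.C_mul_eq_smul, HahnSeries.coeff_smul, smul_eq_mul]
  rfl

/-- The coefficient of `x^0` in `ℂ{x}[x⁻¹][τ, τ⁻¹]`. -/
def resZero : LamK →+ LamC where
  toFun f := AddMonoidAlgebra.ofCoeff (Finsupp.mapRange.addMonoidHom coeffZero f.coeff)
  map_zero' := by simp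
  map_add' f g := by
    rw [AddMonoidAlgebra.coeff_add, map_add]
    rfl

theorem resZero_single (k : ℤ) (f : ConvK) :
    resZero (AddMonoidAlgebra.single k f) = AddMonoidAlgebra.single k (coeffZero f) := by
  change AddMonoidAlgebra.ofCoeff (Finsupp.mapRange.addMonoidHom coeffZero (Finsupp.single k f)) = _
  rw [Finsupp.mapRange.addMonoidHom_apply, Finsupp.mapRange_single]
  rfl

theorem resZero_algebraMap (a : LamO) : resZero (algebraMap LamO LamK a) = evalZero a := by
  induction a using AddMonoidAlgebra.induction_linear with
  | zero => simp
  | add f g hf hg => rw [map_add, map_add, hf, hg, map_add]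
  | single k f => rw [algebraMap_single, resZero_single, evalZero_single, coeffZero_inclOK]

theorem resZero_LamC_mul (c : LamC) (f : LamK) :
    resZero (algebraMap LamC LamK c * f) = c * resZero f := by
  induction c using AddMonoidAlgebra.induction_linear with
  | zero => simp
  | add c d hc hd => rw [map_add, add_mul, map_add, hc, hd, add_mul]
  | single k c =>
    have h : algebraMap LamC LamO (AddMonoidAlgebra.single k c) =
        AddMonoidAlgebra.single k (algebraMap ℂ ConvO c) := AddMonoidAlgebra.mapRingHom_single ..
    induction f using AddMonoidAlgebra.induction_linear with
    | zero => simp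
    | add f g hf hg => rw [mul_add, map_add, hf, hg, map_add, mul_add]
    | single l f =>
      rw [IsScalarTower.algebraMap_apply LamC LamO LamK, h, algebraMap_single,
        AddMonoidAlgebra.single_mul_single, resZero_single, resZero_single,
        AddMonoidAlgebra.single_mul_single, coeffZero_smul]

theorem resZero_tauU_mul (f : LamK) :
    resZero ((tauU : LamK) * f) = LaurentPolynomial.T 1 * resZero f := by
  rw [← resZero_LamC_mul, algebraMap_LamC_T]
  rfl

theorem resZero_eq_zero {f : LamK} (hf : f ∈ ordSub 1) : resZero f = 0 := by
  obtain ⟨a, rfl⟩ := hf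
  rw [zpow_one, ← algebraMap_xLam, ← map_mul, resZero_algebraMap, map_mul, evalZero_xLam, zero_mul]

theorem sub_resZero_mem {f : LamK} (hf : f ∈ ordSub 0) :
    f - algebraMap LamC LamK (resZero f) ∈ ordSub 1 := by
  obtain ⟨a, rfl⟩ := mem_ordSub_zero.1 hf
  obtain ⟨b, hb⟩ := exists_xLam_mul (a := a - algebraMap LamC LamO (evalZero a))
    (by rw [map_sub, evalZero_algebraMap, sub_self])
  refine ⟨b, ?_⟩
  rw [resZero_algebraMap, IsScalarTower.algebraMap_apply LamC LamO LamK, ← map_sub, hb, map_mul,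
    algebraMap_xLam, zpow_one]

end Residue

/-! ### The basis of H formed by the classes of the ω_k, and the matrix of N -/

section Graded

variable {n : ℕ} {w : Fin n → ℕ} {Φ : G w ≃ₗ[LamK] (Fin (mu w) → LamK)}

/-- The weight of `ω_k` as an element of `[0, 1)`. -/
def weightIco (w : Fin n → ℕ) (k : Fin (mu w)) : Set.Ico (0 : ℝ) 1 :=
  ⟨weight w k, weight_nonneg w k.2, weight_lt_one w k.2⟩

/-- The class map `V^α → H` is linear. -/
def classHLin (w : Fin n → ℕ) (α : Set.Ico (0 : ℝ) 1) : V w α →ₗ[LamC] H w :=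
  DirectSum.lof LamC (Set.Ico (0 : ℝ) 1) (fun α => Hgr w α) α ∘ₗ
    (Submodule.mkQ ((VGt w α).submoduleOf (V w α))).restrictScalars LamC

theorem classHLin_apply (α : Set.Ico (0 : ℝ) 1) (m : V w α) : classHLin w α m = classH w α m := rfl

theorem classH_eq_zero {α : Set.Ico (0 : ℝ) 1} {m : V w α} (hm : (m : G w) ∈ VGt w α) :
    classH w α m = 0 := by
  have h : (Submodule.Quotient.mk m : Hgr w α) = 0 := (Submodule.Quotient.mk_eq_zero _).2 hm
  rw [classH, h, map_zero]

open Classical in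
/-- The `k`-th coordinate at `x = 0`, on `V^α`. -/
def coordV (Φ : G w ≃ₗ[LamK] (Fin (mu w) → LamK)) (k : Fin (mu w)) (α : Set.Ico (0 : ℝ) 1) :
    V w α →ₗ[LamC] LamC where
  -- When v_k ≠ α, the spaces V^α and V^{>α} impose the same order on coordinate k, so that
  -- coordinate contributes nothing to H^α.
  toFun m := if weight w k = α then resZero (Φ m k) else 0
  map_add' a b := by
    split_ifs
    · simp
    · simp
  map_smul' c a := by
    split_ifs
    · have h : Φ ((c • a : V w α) : G w) k = algebraMap LamC LamK c * Φ a k :=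
        coord_LamC_smul Φ c a k
      rw [h, resZero_LamC_mul]
      rfl
    · simp

theorem coordV_eq_zero (hΦ : ∀ k < mu w, Φ (omegaPhi w k) = stdVec LamK (mu w) k) (k : Fin (mu w))
    (α : Set.Ico (0 : ℝ) 1) {m : V w α} (hm : (m : G w) ∈ VGt w α) : coordV Φ k α m = 0 := by
  simp only [coordV, LinearMap.coe_mk, AddHom.coe_mk]
  split_ifs with h
  · have := (mem_VGt hΦ).1 hm k
    rw [h, sub_self, Int.floor_zero, zero_add] at this
    exact resZero_eq_zero this
  · rfl

/-- The `k`-th coordinate at `x = 0`, on `H`. -/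
def coordH (hΦ : ∀ k < mu w, Φ (omegaPhi w k) = stdVec LamK (mu w) k) (k : Fin (mu w)) :
    H w →ₗ[LamC] LamC :=
  DirectSum.toModule LamC (Set.Ico (0 : ℝ) 1) LamC fun α =>
    ((((VGt w α).submoduleOf (V w α)).restrictScalars LamC).liftQ (coordV Φ k α)
      fun _ hm => coordV_eq_zero hΦ k α hm) ∘ₗ
    (Submodule.Quotient.restrictScalarsEquiv LamC
      ((VGt w α).submoduleOf (V w α))).symm.toLinearMap

open Classical in
theorem coordH_classH (hΦ : ∀ k < mu w, Φ (omegaPhi w k) = stdVec LamK (mu w) k) (k : Fin (mu w))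
    (α : Set.Ico (0 : ℝ) 1) (m : V w α) :
    coordH hΦ k (classH w α m) = if weight w k = α then resZero (Φ m k) else 0 := by
  rw [coordH, classH]
  erw [DirectSum.toModule_lof]
  rfl

theorem omegaPhi_mem_V (hΦ : ∀ k < mu w, Φ (omegaPhi w k) = stdVec LamK (mu w) k) (k : Fin (mu w)) :
    omegaPhi w k ∈ V w (weight w k) := by
  rw [mem_V hΦ, hΦ k k.2]
  intro j
  rw [stdVec]
  split_ifs with h
  · rw [h, sub_self, Int.ceil_zero]
    exact mem_ordSub_zero.2 ⟨1, by rw [map_one]⟩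
  · exact Submodule.zero_mem _

/-- The class of `ω_k` in `H`. -/
def omegaH (hΦ : ∀ k < mu w, Φ (omegaPhi w k) = stdVec LamK (mu w) k) (k : Fin (mu w)) : H w :=
  classH w (weightIco w k) ⟨omegaPhi w k, omegaPhi_mem_V hΦ k⟩

theorem coordH_omegaH (hΦ : ∀ k < mu w, Φ (omegaPhi w k) = stdVec LamK (mu w) k)
    (j k : Fin (mu w)) : coordH hΦ j (omegaH hΦ k) = if j = k then 1 else 0 := by
  classical
  rw [omegaH, coordH_classH, hΦ k k.2, stdVec]
  by_cases h : j = k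
  · subst h
    rw [if_pos (show weight w j = (weightIco w j : ℝ) from rfl), if_pos rfl, if_pos rfl,
      ← map_one (algebraMap LamO LamK), resZero_algebraMap, map_one]
  · rw [if_neg (fun h' => h (Fin.ext h')), if_neg h, map_zero, ite_self]

/-- Zero is the only integer in (−1, 1). The case of interest is t = α − v_k. -/
theorem ceil_eq_floor_add_one_of_ne {t : ℝ} (h0 : t ≠ 0) (h1 : -1 < t) (h2 : t < 1) :
    ⌈t⌉ = ⌊t⌋ + 1 := by
  rw [Int.ceil_eq_iff]
  refine ⟨?_, by push_cast; exact (Int.lt_floor_add_one t).le⟩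
  push_cast
  rw [add_sub_cancel_right]
  refine lt_of_le_of_ne (Int.floor_le t) fun h => h0 ?_
  have h3 : (-1 : ℤ) < ⌊t⌋ := by exact_mod_cast h ▸ h1
  have h4 : ⌊t⌋ < (1 : ℤ) := by exact_mod_cast h ▸ h2
  rw [← h, show ⌊t⌋ = 0 by omega, Int.cast_zero]

theorem H_zero_smul (h : H w) : (0 : LamC) • h = 0 := zero_smul LamC h

theorem H_add_smul (a b : LamC) (h : H w) : (a + b) • h = a • h + b • h := add_smul a b h

theorem classH_eq_of_sub_mem {α : Set.Ico (0 : ℝ) 1} {m m' : V w α}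
    (h : ((m - m' : V w α) : G w) ∈ VGt w α) : classH w α m = classH w α m' := by
  have h1 := map_add (classHLin w α) (m - m') m'
  rw [sub_add_cancel, classHLin_apply, classHLin_apply, classHLin_apply, classH_eq_zero h] at h1
  exact h1.trans (zero_add (classH w α m'))

/-- Subtracting the values at x = 0 of the coordinates with v_k = α raises their order to 1, and the
remaining coordinates already satisfy the bound of V^{>α}; the difference is zero in H^α. -/
theorem classH_eq_sum (hΦ : ∀ k < mu w, Φ (omegaPhi w k) = stdVec LamK (mu w) k)
    (α : Set.Ico (0 : ℝ) 1) (m : V w α) :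
    classH w α m = ∑ k, coordH hΦ k (classH w α m) • omegaH hΦ k := by
  classical
  let b : Fin (mu w) → V w α := fun k =>
    if h : weight w k = α then ⟨omegaPhi w k, h ▸ omegaPhi_mem_V hΦ k⟩ else 0
  have hb : ∀ k, coordH hΦ k (classH w α m) • omegaH hΦ k =
      classHLin w α (coordH hΦ k (classH w α m) • b k) := by
    intro k
    rw [map_smul, coordH_classH]
    by_cases h : weight w k = α
    · congr 1
      obtain rfl : weightIco w k = α := Subtype.ext h
      rw [classHLin_apply]
      simp only [b, dif_pos h]
      rfl
    · rw [if_neg h, H_zero_smul, H_zero_smul]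
  have hΦb : ∀ k j : Fin (mu w), Φ (b k) j = if weight w k = α ∧ j = k then 1 else 0 := by
    intro k j
    by_cases h : weight w k = α
    · simp only [b, dif_pos h, hΦ k k.2, stdVec, h, true_and, Fin.ext_iff]
    · simp [b, dif_neg h, h]
  rw [Finset.sum_congr rfl fun k _ => hb k, ← map_sum, classHLin_apply]
  refine classH_eq_of_sub_mem ((mem_VGt hΦ).2 fun j => ?_)
  have h1 : Φ ((m - ∑ k, coordH hΦ k (classH w α m) • b k : V w α) : G w) j =
      Φ m j - algebraMap LamC LamK (coordH hΦ j (classH w α m)) *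
        (if weight w j = α then 1 else 0) := by
    rw [Submodule.coe_sub, Submodule.coe_sum, map_sub, map_sum, Pi.sub_apply, Finset.sum_apply,
      Finset.sum_eq_single j]
    · have h : Φ ((coordH hΦ j (classH w α m) • b j : V w α) : G w) j = _ :=
        coord_LamC_smul Φ _ _ _
      rw [h, hΦb]
      simp
    · intro k _ hk
      have h : Φ ((coordH hΦ k (classH w α m) • b k : V w α) : G w) j = _ :=
        coord_LamC_smul Φ _ _ _
      rw [h, hΦb, if_neg (fun h => hk h.2.symm), mul_zero]
    · simp
  have hm := (mem_V hΦ).1 m.2 j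
  rw [h1, coordH_classH]
  by_cases h : weight w j = α
  · rw [if_pos h, if_pos h, mul_one, h, sub_self, Int.floor_zero, zero_add]
    rw [h, sub_self, Int.ceil_zero] at hm
    exact sub_resZero_mem hm
  · rw [if_neg h, if_neg h, mul_zero, sub_zero, ← ceil_eq_floor_add_one_of_ne (sub_ne_zero.2 (Ne.symm h))]
    · exact hm
    · linarith [α.2.1, weight_lt_one w j.2]
    · linarith [α.2.2, weight_nonneg w j.2]

theorem eq_sum_omegaH (hΦ : ∀ k < mu w, Φ (omegaPhi w k) = stdVec LamK (mu w) k) (h : H w) :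
    h = ∑ k, coordH hΦ k h • omegaH hΦ k := by
  induction h using DirectSum.induction_on with
  | zero =>
    refine (Finset.sum_eq_zero fun k _ => ?_).symm
    rw [map_zero, H_zero_smul]
  | of α q =>
    obtain ⟨m, rfl⟩ := Submodule.Quotient.mk_surjective _ q
    exact classH_eq_sum hΦ α m
  | add a b ha hb =>
    conv_lhs => rw [ha, hb]
    rw [← Finset.sum_add_distrib]
    refine Finset.sum_congr rfl fun k _ => ?_
    rw [map_add, H_add_smul]

/-- The coordinates of `H` in the basis of the classes of the `ω_k`. -/
def equivH (hΦ : ∀ k < mu w, Φ (omegaPhi w k) = stdVec LamK (mu w) k) :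
    H w ≃ₗ[LamC] (Fin (mu w) → LamC) where
  toFun h k := coordH hΦ k h
  map_add' a b := by funext k; simp
  map_smul' c a := by funext k; simp
  invFun c := ∑ k, c k • omegaH hΦ k
  left_inv h := (eq_sum_omegaH hΦ h).symm
  right_inv c := by
    funext j
    change coordH hΦ j (∑ k, c k • omegaH hΦ k) = c j
    rw [map_sum, Finset.sum_eq_single j]
    · simp [coordH_omegaH]
    · intro k _ hk
      simp [coordH_omegaH, hk.symm]
    · simp

theorem equivH_apply (hΦ : ∀ k < mu w, Φ (omegaPhi w k) = stdVec LamK (mu w) k) (h : H w)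
    (k : Fin (mu w)) : equivH hΦ h k = coordH hΦ k h := rfl

open Classical in
/-- The matrix of `N` in the basis of the classes of the `ω_k`. -/
def modelN (w : Fin n → ℕ) : (Fin (mu w) → LamC) →ₗ[LamC] (Fin (mu w) → LamC) where
  toFun c j := if 0 < j.1 ∧ weight w (cycPred j) = weight w j then
    -LaurentPolynomial.T 1 * c (cycPred j) else 0
  map_add' a b := by
    funext j
    simp only [Pi.add_apply]
    split_ifs
    · ring
    · simp
  map_smul' a b := by
    funext j
    simp only [Pi.smul_apply, RingHom.id_apply, smul_eq_mul]
    split_ifs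
    · ring
    · simp

/-- The endomorphism `N` of `H`. -/
def nilH (hΦ : ∀ k < mu w, Φ (omegaPhi w k) = stdVec LamK (mu w) k) : H w →ₗ[LamC] H w :=
  (equivH hΦ).symm.toLinearMap ∘ₗ modelN w ∘ₗ (equivH hΦ).toLinearMap

theorem equivH_nilH (hΦ : ∀ k < mu w, Φ (omegaPhi w k) = stdVec LamK (mu w) k) (h : H w) :
    equivH hΦ (nilH hΦ h) = modelN w (equivH hΦ h) := by
  simp [nilH]

/-- Take values at x = 0 in the coordinates of weight α. The diagonal term vanishes there, the
wrap-around entry contains x, and a predecessor of smaller weight has positive order in x. Only −τ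
times a predecessor of equal weight survives. -/
theorem nilH_classH (hΦ : ∀ k < mu w, Φ (omegaPhi w k) = stdVec LamK (mu w) k)
    (hX : ∀ m, Φ (xNabla w m) = modelX w (Φ m)) (α : Set.Ico (0 : ℝ) 1) (m m' : V w α)
    (hm : (m' : G w) = eulerSub xLam (gNablaX w) α (m : G w)) :
    nilH hΦ (classH w α m) = classH w α m' := by
  classical
  apply (equivH hΦ).injective
  rw [equivH_nilH]
  funext j
  simp only [modelN, LinearMap.coe_mk, AddHom.coe_mk, equivH_apply, coordH_classH]
  have hmV := (mem_V hΦ).1 m.2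
  by_cases hj : weight w j = α
  · rw [if_pos hj, hm, eulerSub_coord hX, map_sub, resZero_tauU_mul, hj, sub_self,
      Complex.ofReal_zero, zero_smul, sub_zero]
    have h0 : resZero (eulerX (Φ m j)) = 0 := by
      have h1 := hmV j
      rw [hj, sub_self, Int.ceil_zero] at h1
      have h2 := eulerX_sub_mem_ordSub h1
      rw [Int.cast_zero, zero_smul, sub_zero] at h2
      exact resZero_eq_zero h2
    rw [h0, zero_sub]
    have hp := hmV (cycPred j)
    rcases Nat.eq_zero_or_pos j.1 with h | h
    · rw [if_pos h, if_neg (fun h' => h'.1.ne' h), smul_mul_assoc, resZero_eq_zero, mul_zero, neg_zero]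
      refine smul_mem_ordSub _ (xU_mul_mem_ordSub.2 (ordSub_antitone ?_ hp))
      rw [sub_self, ← Int.lt_add_one_iff, ← sub_lt_iff_lt_add, Int.lt_ceil]
      push_cast
      linarith [weight_lt_one w (cycPred j).2, α.2.1]
    · rw [if_neg h.ne', one_mul]
      by_cases h' : weight w (cycPred j) = α
      · rw [if_pos h', if_pos ⟨h, h'⟩, neg_mul]
      · rw [if_neg (fun h'' => h' h''.2), resZero_eq_zero, mul_zero, neg_zero]
        refine ordSub_antitone ?_ hp
        have hc : (cycPred j).1 ≤ j.1 := by
          simp only [cycPred, if_neg h.ne']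
          omega
        have h1 := weight_mono w hc j.2
        rw [hj] at h1
        have h2 := lt_of_le_of_ne h1 h'
        rw [Int.one_le_ceil_iff]
        linarith
  · rw [if_neg hj]
    split_ifs with h1 h2
    · exact absurd (h1.2.symm.trans h2) hj
    · rw [mul_zero]
    · rfl

theorem isNilpotent_nilH (hΦ : ∀ k < mu w, Φ (omegaPhi w k) = stdVec LamK (mu w) k) :
    IsNilpotent (nilH hΦ) := by
  have h : ∀ (i : ℕ) (x : H w) (j : Fin (mu w)), j.1 < i → equivH hΦ ((nilH hΦ ^ i) x) j = 0 := by
    intro i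
    induction i with
    | zero => intro x j hj; exact absurd hj (Nat.not_lt_zero _)
    | succ i ih =>
      intro x j hj
      rw [pow_succ', Module.End.mul_apply, equivH_nilH]
      simp only [modelN, LinearMap.coe_mk, AddHom.coe_mk]
      split_ifs with h
      · rw [ih, mul_zero]
        simp only [cycPred, if_neg h.1.ne']
        omega
      · rfl
  refine ⟨mu w, LinearMap.ext fun x => (equivH hΦ).injective (funext fun j => ?_)⟩
  rw [h _ x j j.2]
  simp

end Graded

/-! ### Maximal constant runs -/

section Runs

variable {n : ℕ} {w : Fin n → ℕ}

/-- The position of the `j`-th element of a maximal run. -/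
def runIndex (w : Fin n → ℕ) (p : Σ r : MaxRun w, Fin r.length) : Fin (mu w) :=
  ⟨p.1.start + p.2.1, by have := p.1.le_mu; have := p.2.2; omega⟩

/-- If r' began after r, the index just before its start would lie in r and carry the same value,
contradicting maximality of r' on the left. -/
theorem MaxRun.start_le {r r' : MaxRun w} {i i' : ℕ} (hi : i < r.length) (hi' : i' < r'.length)
    (h : r.start + i = r'.start + i') : r'.start ≤ r.start := by
  by_contra! hlt
  refine r'.maximal_left (r'.start - 1) (by omega) ?_
  have h1 := r.constant (r'.start - 1 - r.start) (by omega)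
  rw [show r.start + (r'.start - 1 - r.start) = r'.start - 1 by omega] at h1
  rw [h1, ← r.constant i hi, h, r'.constant i' hi']

theorem MaxRun.length_le {r r' : MaxRun w} (h : r.start = r'.start) : r.length ≤ r'.length := by
  by_contra! hlt
  refine r'.maximal_right (by have := r.le_mu; omega) ?_
  rw [← h]
  exact r.constant _ hlt

theorem runIndex_bijective : Function.Bijective (runIndex w) := by
  constructor
  · rintro ⟨r, i⟩ ⟨r', i'⟩ h
    have h1 : r.start + i.1 = r'.start + i'.1 := congrArg Fin.val h
    have hs := le_antisymm (MaxRun.start_le i'.2 i.2 h1.symm) (MaxRun.start_le i.2 i'.2 h1)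
    have hl := le_antisymm (MaxRun.length_le hs) (MaxRun.length_le hs.symm)
    have hr : r = r' := by
      cases r
      cases r'
      simp only at hs hl
      subst hs hl
      rfl
    subst hr
    have hi : i = i' := Fin.ext (by omega)
    rw [hi]
  · intro k
    -- The run through k ends at the first later index where the value changes or the list stops.
    -- The alternative `q = mu w` is needed because `spec` takes the default value 0 past the end,
    -- which could coincide with s_k.
    have he : ∃ q, k.1 < q ∧ (q = mu w ∨ spec w q ≠ spec w k) := ⟨mu w, k.2, Or.inl rfl⟩
    have hs : ∃ p, spec w p = spec w k := ⟨k, rfl⟩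
    classical
    have hle : Nat.find he ≤ mu w := Nat.find_min' he ⟨k.2, Or.inl rfl⟩
    have hsk : Nat.find hs ≤ k := Nat.find_min' hs rfl
    have hke := (Nat.find_spec he).1
    have hc : ∀ i, Nat.find hs ≤ i → i < Nat.find he → spec w i = spec w k := by
      intro i h1 h2
      rcases Nat.lt_or_ge k.1 i with h | h
      · have := Nat.find_min he h2
        by_contra! h3
        exact this ⟨h, Or.inr h3⟩
      · refine le_antisymm (spec_mono w h k.2) ?_
        have := spec_mono w h1 (h.trans_lt k.2)
        rwa [Nat.find_spec hs] at this
    refine ⟨⟨⟨Nat.find hs, Nat.find he - Nat.find hs, by omega, by omega, fun i hi => ?_,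
      fun p hp h => ?_, fun hlt => ?_⟩, ⟨k.1 - Nat.find hs, by simp only; omega⟩⟩, ?_⟩
    · rw [hc _ (by omega) (by omega), Nat.find_spec hs]
    · exact Nat.find_min hs (show p < _ by omega) (h.trans (Nat.find_spec hs))
    · rw [show Nat.find hs + (Nat.find he - Nat.find hs) = Nat.find he by omega] at hlt ⊢
      rw [Nat.find_spec hs]
      exact (Nat.find_spec he).2.resolve_left hlt.ne
    · apply Fin.ext
      simp only [runIndex]
      omega

variable {Φ : G w ≃ₗ[LamK] (Fin (mu w) → LamK)}

/-- The Jordan basis of `N`. -/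
def jordanBasis (hΦ : ∀ k < mu w, Φ (omegaPhi w k) = stdVec LamK (mu w) k) :
    Module.Basis (Σ r : MaxRun w, Fin r.length) LamC (H w) :=
  ((Module.Basis.ofEquivFun (equivH hΦ)).reindex
    (Equiv.ofBijective _ (runIndex_bijective (w := w))).symm).unitsSMul
    -- N multiplies by −τ at each step of a run; these powers absorb that unit, so the Jordan
    -- relation holds without coefficient.
    fun p => (-tauC) ^ p.2.1

theorem equivH_jordanBasis (hΦ : ∀ k < mu w, Φ (omegaPhi w k) = stdVec LamK (mu w) k)
    (r : MaxRun w) (i : Fin r.length) (j : Fin (mu w)) :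
    equivH hΦ (jordanBasis hΦ ⟨r, i⟩) j =
      if j.1 = r.start + i.1 then (-LaurentPolynomial.T 1 : LamC) ^ i.1 else 0 := by
  rw [jordanBasis, Module.Basis.unitsSMul_apply, Module.Basis.reindex_apply, Equiv.symm_symm,
    Equiv.ofBijective_apply, Module.Basis.coe_ofEquivFun, Units.smul_def, map_smul,
    LinearEquiv.apply_symm_apply, Pi.smul_apply, Pi.single_apply]
  simp only [Fin.ext_iff, runIndex, smul_eq_mul, mul_ite, mul_one, mul_zero, Units.val_pow_eq_pow_val,
    Units.val_neg]
  rfl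

theorem nilH_jordanBasis (hΦ : ∀ k < mu w, Φ (omegaPhi w k) = stdVec LamK (mu w) k)
    (r : MaxRun w) (i : Fin r.length) : nilH hΦ (jordanBasis hΦ ⟨r, i⟩) =
      if h : (i : ℕ) + 1 < r.length then jordanBasis hΦ ⟨r, ⟨i + 1, h⟩⟩ else 0 := by
  classical
  apply (equivH hΦ).injective
  rw [equivH_nilH]
  funext j
  simp only [modelN, LinearMap.coe_mk, AddHom.coe_mk, equivH_jordanBasis]
  have hp : 0 < j.1 → (cycPred j).1 = j.1 - 1 := fun h => by simp only [cycPred, if_neg h.ne']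
  have hi := i.2
  by_cases h2 : i.1 + 1 < r.length
  · rw [dif_pos h2, equivH_jordanBasis]
    by_cases h1 : 0 < j.1 ∧ weight w (cycPred j) = weight w j
    · have := hp h1.1
      rw [if_pos h1]
      by_cases h3 : (cycPred j).1 = r.start + i.1
      · rw [if_pos h3, if_pos (by simp only; omega), pow_succ']
      · rw [if_neg h3, if_neg (by simp only; omega), mul_zero]
    · rw [if_neg h1, if_neg]
      intro hj
      simp only at hj
      have h0 : 0 < j.1 := by omega
      refine h1 ⟨h0, ?_⟩
      rw [weight_eq_iff, hp h0, hj, r.constant _ h2,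
        show r.start + (i.1 + 1) - 1 = r.start + i.1 by omega, r.constant _ i.2]
  · rw [dif_neg h2, map_zero, Pi.zero_apply]
    split_ifs with h1 h3
    -- At the last position of a run, a nonzero entry would force the next spectral number to be
    -- equal, against maximality on the right.
    · refine absurd h1.2 ?_
      rw [weight_eq_iff, h3, r.constant _ i.2]
      have hj : j.1 = r.start + r.length := by
        have := hp h1.1
        omega
      rw [hj]
      exact (r.maximal_right (hj ▸ j.2)).symm
    · rw [mul_zero]
    · rfl

end Runs

end GaussManin

end

/-! ### The theorem, read off in the coordinates of the basis ω_k -/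

theorem mainTheorem7 {n : ℕ} (w : Fin n → ℕ) (hw : ∀ i, 0 < w i) :
    -- `V^{>α}` is the union of the `V^β`, `β > α`
    (∀ α : ℝ, VGt w α = filtGt (V w) α) ∧
    -- `x ∇_{∂/∂x}` acts on `V^α` and `V^{>α}`, and `x ∇_{∂/∂x} - α` is nilpotent on `H^α`
    (∀ α : ℝ, (∀ m ∈ V w α, xLam • gNablaX w m ∈ V w α) ∧
      (∀ m ∈ VGt w α, xLam • gNablaX w m ∈ VGt w α) ∧
      ∃ N : ℕ, ∀ m ∈ V w α, (eulerSub xLam (gNablaX w) α)^[N] m ∈ VGt w α) ∧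
    -- the operator `N` on `H` restricting to `x ∇_{∂/∂x} - α` on each `H^α` is nilpotent and has
    -- a Jordan basis whose blocks correspond to the maximal constant sequences in `S_w`
    (∃ N : H w →ₗ[LamC] H w,
      (∀ (α : Set.Ico (0 : ℝ) 1) (m m' : V w α),
        (m' : G w) = eulerSub xLam (gNablaX w) α (m : G w) →
          N (classH w α m) = classH w α m') ∧
      IsNilpotent N ∧
      ∃ b : Module.Basis (Σ r : MaxRun w, Fin r.length) LamC (H w),
        ∀ (r : MaxRun w) (j : Fin r.length),
          N (b ⟨r, j⟩) = if h : (j : ℕ) + 1 < r.length then b ⟨r, ⟨j + 1, h⟩⟩ else 0) ∧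
    -- `V` is the unique Kashiwara–Malgrange filtration along `x = 0`
    IsKashiwaraMalgrange xLam (gNablaTau w) (gNablaX w) (V w) ∧
    ∀ V' : ℝ → Submodule LamO (G w),
      IsKashiwaraMalgrange xLam (gNablaTau w) (gNablaX w) V' → V' = V w := by
  
  obtain ⟨Φ, hΦ, hX, hT⟩ := exists_coordEquiv w hw
  have hKM := isKashiwaraMalgrange_V hΦ hX hT
  refine ⟨VGt_eq_filtGt hΦ, fun α => ⟨fun m hm => ?_, fun m hm => ?_, mu w,
    fun m hm => eulerSub_iterate_mem_VGt hΦ hX hm⟩,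
    ⟨nilH hΦ, nilH_classH hΦ hX, isNilpotent_nilH hΦ, jordanBasis hΦ, nilH_jordanBasis hΦ⟩,
    hKM, fun V' hV' => hV'.unique hKM⟩
  · rw [xLam_smul_gNablaX]
    exact xNabla_mem_V hΦ hX hm
  · rw [xLam_smul_gNablaX]
    exact xNabla_mem_VGt hΦ hX hm
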